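/- Let $\mathrm{Rat}_2$ be the space of quadratic rational maps $z\mapsto\frac{a_0z^2+a_1z+a_2}{b_0z^2+b_1z+b_2}$ of the Riemann sphere, that is, the open subset of $\mathbf{CP}^5$ of all points $(a_0:a_1:a_2:b_0:b_1:b_2)$ for which the resultant $$\det\begin{pmatrix}a_0&a_1&a_2&0\\0&a_0&a_1&a_2\\b_0&b_1&b_2&0\\0&b_0&b_1&b_2\end{pmatrix}$$ is non-zero, with the topology induced from $\mathbf{CP}^5$. Then $\mathrm{Rat}_2$ contains a compact, non-orientable, smoothly embedded manifold $M^5$ of real dimension $5$ which is a (strong) deformation retract of $\mathrm{Rat}_2$. Moreover, $M^5$ is the total space of a non-trivial principal $\mathrm{SO}(3)$-bundle over the real projective plane $\mathbf{RP}^2$, and this bundle is the unique non-trivial one: every non-trivial (topological) principal $\mathrm{SO}(3)$-bundle over $\mathbf{RP}^2$ is isomorphic to it, by an $\mathrm{SO}(3)$-equivariant homeomorphism of total spaces covering the identity of $\mathbf{RP}^2$. -/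

import Mathlib

universe u

open scoped Manifold ContDiff Topology LinearAlgebra.Projectivization

/-- The quotient topology on a projective space, induced by `v ↦ [v]` from the nonzero vectors. -/
instance projTopology (K V : Type*) [DivisionRing K] [AddCommGroup V] [Module K V]
    [TopologicalSpace V] : TopologicalSpace (ℙ K V) :=
  TopologicalSpace.coinduced (fun v : {v : V // v ≠ 0} => Projectivization.mk K v.1 v.2)
    inferInstance

/-- The resultant of `p = a₀z² + a₁z + a₂` and `q = b₀z² + b₁z + b₂`, where
`c = (a₀, a₁, a₂, b₀, b₁, b₂)`. -/
def quadResultant (c : Fin 6 → ℂ) : ℂ :=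
  Matrix.det !![c 0, c 1, c 2, 0;
                0, c 0, c 1, c 2;
                c 3, c 4, c 5, 0;
                0, c 3, c 4, c 5]

theorem quadResultant_smul (t : ℂ) (c : Fin 6 → ℂ) :
    quadResultant (t • c) = t ^ 4 * quadResultant c := by
  simp [quadResultant, Matrix.det_succ_row_zero, Fin.sum_univ_succ, Fin.succAbove]
  ring

/-- The space of quadratic rational maps `z ↦ (a₀z² + a₁z + a₂) / (b₀z² + b₁z + b₂)`: the points
`(a₀ : a₁ : a₂ : b₀ : b₁ : b₂)` of complex projective 5-space with nonzero resultant (a condition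
that does not depend on the representative, see `mk_mem_rat2Set_iff`). -/
def rat2Set : Set (ℙ ℂ (Fin 6 → ℂ)) := {x | quadResultant x.rep ≠ 0}

theorem mk_mem_rat2Set_iff (c : Fin 6 → ℂ) (hc : c ≠ 0) :
    Projectivization.mk ℂ c hc ∈ rat2Set ↔ quadResultant c ≠ 0 := by
  obtain ⟨t, ht⟩ := Projectivization.exists_smul_eq_mk_rep ℂ c hc
  have h : quadResultant (Projectivization.mk ℂ c hc).rep = (t : ℂ) ^ 4 * quadResultant c := by
    rw [← ht, ← quadResultant_smul]; rfl
  simp [rat2Set, h]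

/-- `Rat₂`, with the topology induced from complex projective 5-space. -/
abbrev Rat2 : Type := rat2Set

/-- The real projective plane. -/
abbrev RP2 : Type := ℙ ℝ (Fin 3 → ℝ)

/-- The rotation group `SO(3)`. -/
abbrev SO3 : Type := Matrix.specialOrthogonalGroup (Fin 3) ℝ

/-- `A` is a (strong) deformation retract of `X`: the identity of `X` is homotopic, through maps
fixing every point of `A`, to a map with values in `A`. -/
def IsDeformationRetract {X : Type*} [TopologicalSpace X] (A : Set X) : Prop :=
  ∃ r : C(X, X), (∀ x, r x ∈ A) ∧ (ContinuousMap.id X).HomotopicRel r A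

/-- A smooth `n`-manifold (without boundary) is orientable if it is covered by a family of smooth
charts all of whose coordinate changes have positive Jacobian determinant. -/
def IsOrientable (n : ℕ) (M : Type*) [TopologicalSpace M]
    [ChartedSpace (EuclideanSpace ℝ (Fin n)) M] : Prop :=
  ∃ A : Set (OpenPartialHomeomorph M (EuclideanSpace ℝ (Fin n))),
    A ⊆ IsManifold.maximalAtlas (𝓡 n) ∞ M ∧
    (∀ m : M, ∃ e ∈ A, m ∈ e.source) ∧
    ∀ e ∈ A, ∀ e' ∈ A, ∀ x ∈ (e.symm.trans e').source,
      0 < (fderiv ℝ (e.symm.trans e') x).det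

/-- `g` is a smooth immersion of the `n`-manifold `M` into the complex projective space of `V = ℂᴺ`
(regarded as a real manifold). Near each point `g` is `[v]` for a smooth map `v` into `V \ {0}`, and
the derivative of `g`, which is that of `v` taken modulo the complex line `ℂ v` (the tangent space
of the projective space at `[v]` being `V / ℂ v` up to scale), is injective. -/
def IsSmoothImmersionToProj (n : ℕ) {N : ℕ} {M : Type*} [TopologicalSpace M]
    [ChartedSpace (EuclideanSpace ℝ (Fin n)) M] (g : M → ℙ ℂ (Fin N → ℂ)) : Prop :=
  ∀ m : M, ∃ (U : Set M) (v : M → Fin N → ℂ), IsOpen U ∧ m ∈ U ∧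
    ContMDiffOn (𝓡 n) 𝓘(ℝ, Fin N → ℂ) ∞ v U ∧
    (∀ m' ∈ U, ∃ h : v m' ≠ 0, g m' = Projectivization.mk ℂ (v m') h) ∧
    ∀ ξ : TangentSpace (𝓡 n) m,
      (show Fin N → ℂ from mfderiv (𝓡 n) 𝓘(ℝ, Fin N → ℂ) v m ξ) ∈ Submodule.span ℂ {v m} → ξ = 0

/-- `proj : P → B` is a (topological) principal `G`-bundle for the given action of `G` on `P`: the
action is continuous and fibre-preserving, and `P` is locally, over `B`, equivariantly homeomorphic
to the product with `G`, on which `G` acts by left multiplication. (The action is written on the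
left, as for post-composition of maps; `p · g = g⁻¹ • p` is the corresponding right action.) -/
structure IsPrincipalBundle (G : Type*) {B P : Type*} [Group G] [TopologicalSpace G]
    [TopologicalSpace B] [TopologicalSpace P] [MulAction G P] (proj : P → B) : Prop where
  continuous_smul : Continuous fun x : G × P => x.1 • x.2
  proj_smul : ∀ (g : G) (p : P), proj (g • p) = proj p
  locally_trivial : ∀ b : B, ∃ e : Bundle.Trivialization G proj, b ∈ e.baseSet ∧
    ∀ p ∈ e.source, ∀ g : G, (e (g • p)).2 = g * (e p).2

/-- Isomorphism of principal `G`-bundles over `B`: an equivariant homeomorphism of the total spaces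
over the identity of `B`. -/
def PrincipalBundleIso (G : Type*) {B P P' : Type*} [Group G] [TopologicalSpace P]
    [TopologicalSpace P'] [MulAction G P] [MulAction G P'] (proj : P → B) (proj' : P' → B) : Prop :=
  ∃ φ : P ≃ₜ P', (∀ p, proj' (φ p) = proj p) ∧ ∀ (g : G) (p : P), φ (g • p) = g • φ p

/-- A principal `G`-bundle over `B` is trivial if it is isomorphic to the product `B × G`. -/
def IsTrivialPrincipalBundle (G : Type*) {B P : Type*} [Group G] [TopologicalSpace G]
    [TopologicalSpace B] [TopologicalSpace P] [MulAction G P] (proj : P → B) : Prop :=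
  ∃ φ : P ≃ₜ B × G, (∀ p, (φ p).1 = proj p) ∧
    ∀ (g : G) (p : P), φ (g • p) = ((φ p).1, g * (φ p).2)

/-! ### Topology of projective spaces -/

section ProjectiveTopology

variable {𝕜 : Type*} [RCLike 𝕜] {n : ℕ}

/-! A pair of quadratic polynomials is a pair of vectors of `ℂ³`, the rows of a 2 × 3 matrix `X`, in
coordinates where the discriminant is the sum of squares. The resultant is then -1/4 times the
determinant of the bilinear Gram matrix of the rows (`quadResultant_coeffs`). So `Rat2` is the space
of bases of nondegenerate complex planes in `ℂ³`, modulo scalars. Post-composition with Möbius maps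
multiplies `X` on the left, rotations of the source multiply it on the right. The manifold is
`frameSet`: the classes of orthogonal, equally long bases of complexified real planes.

Retraction (`isDeformationRetract_frameSet`). A nondegenerate plane has a normal `w` with `w · w =
1`, unique up to sign. The path `(1 - s/2) w + (s/2) conj w` ends at the real vector `Re w` and
never becomes isotropic; the rows follow by projection along the moving normal. At the same time the
basis is multiplied by a path of invertible matrices, from a multiple of the identity to a multiple
of the inverse square root of the Hermitian Gram matrix. Every formula is homogeneous in `X`, so it
descends to projective classes, and frames move only by scalars.

Bundle. Sending a frame to the real normal line of its plane gives a map to `RP2`. The frames of one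
plane modulo scalars form a torsor under `SU(2)/±1 = SO(3)`, and explicit local frames give local
sections (`isPrincipalBundle_frameProj`).

Classification. Any principal `SO(3)`-bundle over `RP2` has a section over the closed hemisphere,
seen as a disc. Its values at antipodal boundary points differ by a path in `SO(3)`; lifted to a
path `g` in `S³`, it satisfies `g π * g 0 = ±1` (`exists_hasClutching`). Loops in `S³` extend to the
disc, so the sign determines the bundle (`HasClutching.iso`). The product has sign 1, a bundle with
sign -1 is not trivial (`HasClutching.not_trivial`), and the frame bundle has sign -1
(`hasClutching_frameProj`).

Smooth structure. The compact group `S³ × SO(3)` acts transitively on `frameSet`, and the atlas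
consists of the translates of one chart. The coordinates extend to smooth functions of the
homogeneous coordinates, invariant under scaling, which makes the inclusion an immersion. A path in
the group leads from the identity to an element that fixes the base point and has Jacobian -1 there,
so the manifold is not orientable (`not_isOrientable_frameSet`). -/

theorem continuous_projMk :
    Continuous fun v : {v : Fin n → 𝕜 // v ≠ 0} => Projectivization.mk 𝕜 v.1 v.2 :=
  continuous_coinduced_rng

/-- The saturation of an open set is the union of its preimages under the scalings, hence open. -/
theorem isOpenQuotientMap_projMk :
    IsOpenQuotientMap fun v : {v : Fin n → 𝕜 // v ≠ 0} => Projectivization.mk 𝕜 v.1 v.2 := by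
  refine ⟨fun x => ?_, continuous_projMk, fun s hs => ?_⟩
  · induction x using Projectivization.ind with
    | h v hv => exact ⟨⟨v, hv⟩, rfl⟩
  · refine isOpen_coinduced.2 ?_
    have : (fun v : {v : Fin n → 𝕜 // v ≠ 0} => Projectivization.mk 𝕜 v.1 v.2) ⁻¹'
        ((fun v : {v : Fin n → 𝕜 // v ≠ 0} => Projectivization.mk 𝕜 v.1 v.2) '' s) =
        ⋃ a : 𝕜ˣ, (fun v : {v : Fin n → 𝕜 // v ≠ 0} =>
          (⟨a • v.1, (smul_ne_zero_iff_ne a).2 v.2⟩ : {v : Fin n → 𝕜 // v ≠ 0})) ⁻¹' s := by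
      ext v
      simp only [Set.mem_preimage, Set.mem_image, Set.mem_iUnion]
      constructor
      · rintro ⟨w, hw, h⟩
        obtain ⟨a, ha⟩ := (Projectivization.mk_eq_mk_iff 𝕜 _ _ w.2 v.2).1 h
        refine ⟨a, ?_⟩
        convert! hw
      · rintro ⟨a, ha⟩
        exact ⟨_, ha, (Projectivization.mk_eq_mk_iff 𝕜 _ _ _ _).2 ⟨a, rfl⟩⟩
    rw [this]
    refine isOpen_iUnion fun a => hs.preimage ?_
    refine Continuous.subtype_mk ?_ _
    change Continuous fun v : {v : Fin n → 𝕜 // v ≠ 0} => (a : 𝕜) • v.1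
    fun_prop

/-- The orthogonal projector onto a line, as a matrix. -/
noncomputable def lineProjector (x : ℙ 𝕜 (Fin n → 𝕜)) : Matrix (Fin n) (Fin n) 𝕜 :=
  Projectivization.lift
    (fun v : {v : Fin n → 𝕜 // v ≠ 0} =>
      (v.1 ⬝ᵥ star v.1)⁻¹ • Matrix.vecMulVec v.1 (star v.1))
    (by
      rintro ⟨v, hv⟩ ⟨w, hw⟩ t h
      simp only at h
      subst h
      have ht : t ≠ 0 := by rintro rfl; simp at hv
      have ht' : (starRingEnd 𝕜) t ≠ 0 := by simpa using ht
      ext i j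
      simp only [star_smul, smul_dotProduct, dotProduct_smul, smul_eq_mul, Matrix.smul_apply,
        Matrix.vecMulVec_apply, Pi.smul_apply, Pi.star_apply, RCLike.star_def, mul_inv]
      field_simp)
    x

theorem lineProjector_mk (v : Fin n → 𝕜) (hv : v ≠ 0) :
    lineProjector (Projectivization.mk 𝕜 v hv) =
      (v ⬝ᵥ star v)⁻¹ • Matrix.vecMulVec v (star v) := rfl

theorem continuous_lineProjector : Continuous (lineProjector (𝕜 := 𝕜) (n := n)) := by
  refine isOpenQuotientMap_projMk.isQuotientMap.continuous_iff.2 ?_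
  change Continuous fun v : {v : Fin n → 𝕜 // v ≠ 0} =>
    (v.1 ⬝ᵥ star v.1)⁻¹ • Matrix.vecMulVec v.1 (star v.1)
  refine Continuous.smul (Continuous.inv₀
    (f := fun v : {v : Fin n → 𝕜 // v ≠ 0} => v.1 ⬝ᵥ star v.1) ?_ fun v => ?_) ?_
  · fun_prop
  · open scoped ComplexOrder in
    simpa using (dotProduct_star_self_eq_zero (v := v.1)).not.2 v.2
  · refine continuous_matrix fun i j => ?_
    exact ((continuous_apply i).comp continuous_subtype_val).mul
      ((continuous_apply j).comp continuous_subtype_val).star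

/-- The projector of `[v]` fixes `v`, so equal projectors make `v` a multiple of `w`. Projective
space thus maps injectively into a space of matrices, which yields the Hausdorff property and, by
compactness, an embedding. -/
theorem lineProjector_injective : Function.Injective (lineProjector (𝕜 := 𝕜) (n := n)) := by
  intro x y h
  induction x using Projectivization.ind with
  | h v hv =>
  induction y using Projectivization.ind with
  | h w hw =>
  have hvv : v ⬝ᵥ star v ≠ 0 := by
    open scoped ComplexOrder in
    simpa using (dotProduct_star_self_eq_zero (v := v)).not.2 hv
  rw [lineProjector_mk, lineProjector_mk] at h
  rw [Projectivization.mk_eq_mk_iff']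
  have h2 := congrArg (fun A => A.mulVec v) h
  simp only [Matrix.smul_mulVec, Matrix.vecMulVec_mulVec] at h2
  refine ⟨(w ⬝ᵥ star w)⁻¹ * (star w ⬝ᵥ v), ?_⟩
  rw [dotProduct_comm (star v) v] at h2
  simpa [smul_smul, hvv] using h2.symm

instance projT2Space : T2Space (ℙ 𝕜 (Fin n → 𝕜)) :=
  .of_injective_continuous lineProjector_injective continuous_lineProjector

instance projCompactSpace : CompactSpace (ℙ 𝕜 (Fin n → 𝕜)) := by
  have hne : ∀ v : Metric.sphere (0 : Fin n → 𝕜) 1, v.1 ≠ 0 :=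
    fun v => ne_zero_of_mem_unit_sphere v
  refine Function.Surjective.compactSpace (X := Metric.sphere (0 : Fin n → 𝕜) 1)
    (f := fun v => Projectivization.mk 𝕜 v.1 (hne v)) ?_ ?_
  · exact continuous_projMk.comp (Continuous.subtype_mk continuous_subtype_val hne)
  · intro x
    induction x using Projectivization.ind with
    | h v hv =>
    have hv' : (‖v‖ : 𝕜) ≠ 0 := by simpa using hv
    refine ⟨⟨((‖v‖ : 𝕜)⁻¹) • v, ?_⟩, ?_⟩
    · have : ‖v‖ ≠ 0 := by simpa using hv
      simp [norm_smul, this]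
    · rw [Projectivization.mk_eq_mk_iff']
      exact ⟨_, rfl⟩

theorem isEmbedding_lineProjector :
    Topology.IsEmbedding (lineProjector (𝕜 := 𝕜) (n := n)) :=
  (continuous_lineProjector.isClosedEmbedding lineProjector_injective).isEmbedding

instance projSecondCountable : SecondCountableTopology (ℙ 𝕜 (Fin n → 𝕜)) := by
  have : SecondCountableTopology (Matrix (Fin n) (Fin n) 𝕜) :=
    inferInstanceAs (SecondCountableTopology (Fin n → Fin n → 𝕜))
  exact isEmbedding_lineProjector.secondCountableTopology

end ProjectiveTopology

/-! ### Unit quaternions and the double cover of the rotation group -/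

section Quaternions

open Quaternion

/-- The group of unit quaternions. -/
abbrev S3 : Type := Metric.sphere (0 : ℍ[ℝ]) 1

noncomputable instance S3.instMul : Mul S3 :=
  (Metric.unitSphere.instGroup (𝕜 := ℍ[ℝ])).toDivInvMonoid.toMonoid.toMulOneClass.toMul

theorem S3.normSq_eq (q : S3) :
    q.1.re ^ 2 + q.1.imI ^ 2 + q.1.imJ ^ 2 + q.1.imK ^ 2 = 1 := by
  have h : ‖q.1‖ = 1 := by simp
  rw [← Quaternion.normSq_def', Quaternion.normSq_eq_norm_mul_self, h, one_mul]

theorem mem_S3_iff (q : ℍ[ℝ]) :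
    q ∈ Metric.sphere (0 : ℍ[ℝ]) 1 ↔ q.re ^ 2 + q.imI ^ 2 + q.imJ ^ 2 + q.imK ^ 2 = 1 := by
  rw [mem_sphere_zero_iff_norm, ← Quaternion.normSq_def', Quaternion.normSq_eq_norm_mul_self]
  constructor
  · intro h; rw [h, one_mul]
  · intro h; nlinarith [norm_nonneg q]

/-- The quaternion `a + bi + cj + dk`. -/
def quat (a b c d : ℝ) : ℍ[ℝ] := ⟨a, b, c, d⟩

@[simp] theorem quat_re (a b c d : ℝ) : (quat a b c d).re = a := rfl
@[simp] theorem quat_imI (a b c d : ℝ) : (quat a b c d).imI = b := rfl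
@[simp] theorem quat_imJ (a b c d : ℝ) : (quat a b c d).imJ = c := rfl
@[simp] theorem quat_imK (a b c d : ℝ) : (quat a b c d).imK = d := rfl

/-- The matrix of `x ↦ q x q̄` on the imaginary quaternions. -/
def rotMat (q : ℍ[ℝ]) : Matrix (Fin 3) (Fin 3) ℝ :=
  !![q.re ^ 2 + q.imI ^ 2 - q.imJ ^ 2 - q.imK ^ 2, 2 * (q.imI * q.imJ - q.re * q.imK),
      2 * (q.imI * q.imK + q.re * q.imJ);
    2 * (q.imI * q.imJ + q.re * q.imK), q.re ^ 2 - q.imI ^ 2 + q.imJ ^ 2 - q.imK ^ 2,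
      2 * (q.imJ * q.imK - q.re * q.imI);
    2 * (q.imI * q.imK - q.re * q.imJ), 2 * (q.imJ * q.imK + q.re * q.imI),
      q.re ^ 2 - q.imI ^ 2 - q.imJ ^ 2 + q.imK ^ 2]

theorem rotMat_mul (p q : ℍ[ℝ]) : rotMat (p * q) = rotMat p * rotMat q := by
  ext i j
  fin_cases i <;> fin_cases j <;>
    simp [rotMat, Matrix.mul_apply, Fin.sum_univ_three] <;> ring

theorem rotMat_one : rotMat 1 = 1 := by
  ext i j
  fin_cases i <;> fin_cases j <;> simp [rotMat]

theorem rotMat_mul_transpose (q : ℍ[ℝ]) :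
    rotMat q * (rotMat q).transpose =
      (q.re ^ 2 + q.imI ^ 2 + q.imJ ^ 2 + q.imK ^ 2) ^ 2 • (1 : Matrix (Fin 3) (Fin 3) ℝ) := by
  ext i j
  fin_cases i <;> fin_cases j <;>
    simp [rotMat, Matrix.mul_apply, Fin.sum_univ_three] <;> ring

theorem rotMat_det (q : ℍ[ℝ]) :
    (rotMat q).det = (q.re ^ 2 + q.imI ^ 2 + q.imJ ^ 2 + q.imK ^ 2) ^ 3 := by
  simp [rotMat, Matrix.det_fin_three]
  ring

theorem rotMat_mem (q : S3) : rotMat q.1 ∈ Matrix.specialOrthogonalGroup (Fin 3) ℝ := by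
  rw [Matrix.mem_specialOrthogonalGroup_iff, Matrix.mem_orthogonalGroup_iff]
  refine ⟨?_, ?_⟩
  · have h := rotMat_mul_transpose q.1
    rw [S3.normSq_eq] at h
    simpa using h
  · rw [rotMat_det, S3.normSq_eq, one_pow]

/-- The double cover `S³ → SO(3)`. -/
noncomputable def rot : S3 →* SO3 where
  toFun q := ⟨rotMat q.1, rotMat_mem q⟩
  map_one' := Subtype.ext rotMat_one
  map_mul' p q := Subtype.ext (rotMat_mul p.1 q.1)

theorem coe_rot (q : S3) : (rot q : Matrix (Fin 3) (Fin 3) ℝ) = rotMat q.1 := rfl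

theorem continuous_quat {X : Type*} [TopologicalSpace X] {a b c d : X → ℝ} (ha : Continuous a)
    (hb : Continuous b) (hc : Continuous c) (hd : Continuous d) :
    Continuous fun x => quat (a x) (b x) (c x) (d x) := by
  have h : (fun x => quat (a x) (b x) (c x) (d x)) = fun x =>
      a x • quat 1 0 0 0 + b x • quat 0 1 0 0 + c x • quat 0 0 1 0 + d x • quat 0 0 0 1 := by
    funext x
    ext <;> simp
  rw [h]
  fun_prop

theorem continuous_rot : Continuous rot := by
  refine Continuous.subtype_mk (continuous_matrix fun i j => ?_) _
  have h0 : Continuous fun q : S3 => q.1.re := continuous_re.comp continuous_subtype_val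
  have h1 : Continuous fun q : S3 => q.1.imI := continuous_imI.comp continuous_subtype_val
  have h2 : Continuous fun q : S3 => q.1.imJ := continuous_imJ.comp continuous_subtype_val
  have h3 : Continuous fun q : S3 => q.1.imK := continuous_imK.comp continuous_subtype_val
  fin_cases i <;> fin_cases j <;> simp [rotMat] <;> fun_prop

/-- For a quaternion of norm one, unit diagonal entries of the rotation matrix force the imaginary
parts to vanish. -/
theorem rot_eq_one_iff (q : S3) : rot q = 1 ↔ q = 1 ∨ q = -1 := by
  constructor
  · intro h
    have h' : rotMat q.1 = 1 := congrArg Subtype.val h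
    have hn := S3.normSq_eq q
    have e00 := congrFun (congrFun h' 0) 0
    have e11 := congrFun (congrFun h' 1) 1
    have e22 := congrFun (congrFun h' 2) 2
    simp [rotMat] at e00 e11 e22
    have hb : q.1.imI = 0 := by nlinarith
    have hc : q.1.imJ = 0 := by nlinarith
    have hd : q.1.imK = 0 := by nlinarith
    have ha : (q.1.re - 1) * (q.1.re + 1) = 0 := by nlinarith
    rcases mul_eq_zero.1 ha with ha | ha
    · left
      refine Subtype.ext (Quaternion.ext _ _ ?_ ?_ ?_ ?_) <;> simp [hb, hc, hd]; linarith
    · right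
      refine Subtype.ext (Quaternion.ext _ _ ?_ ?_ ?_ ?_) <;> simp [hb, hc, hd]; linarith
  · rintro (rfl | rfl)
    · simp
    · refine Subtype.ext ?_
      ext i j
      fin_cases i <;> fin_cases j <;> simp [rot, rotMat]

theorem rot_eq_rot_iff (p q : S3) : rot p = rot q ↔ p = q ∨ p = -q := by
  have h : rot p = rot q ↔ rot (p * q⁻¹) = 1 := by rw [map_mul, map_inv, mul_inv_eq_one]
  have h' : -q = -1 * q := Subtype.ext (by simp)
  rw [h, rot_eq_one_iff, mul_inv_eq_one, mul_inv_eq_iff_eq_mul, h']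

theorem SO3.mul_transpose (R : SO3) : R.1 * R.1.transpose = 1 :=
  (Matrix.mem_orthogonalGroup_iff _ _).1 (Matrix.mem_specialOrthogonalGroup_iff.1 R.2).1

theorem SO3.transpose_mul (R : SO3) : R.1.transpose * R.1 = 1 :=
  mul_eq_one_comm.1 R.mul_transpose

theorem SO3.det_eq (R : SO3) : R.1.det = 1 :=
  (Matrix.mem_specialOrthogonalGroup_iff.1 R.2).2

theorem SO3.adjugate_eq (R : SO3) : R.1.adjugate = R.1.transpose := by
  have h : R.1.adjugate = (R.1.adjugate * R.1) * R.1.transpose := by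
    rw [mul_assoc, R.mul_transpose, mul_one]
  rw [h, Matrix.adjugate_mul, R.det_eq, one_smul, one_mul]

/-- If `R` comes from `q`, then `1 + tr R = 4 (re q)²` and the differences of opposite off-diagonal
entries are `4 re q` times the imaginary parts; solving for `q` gives `Q`. That `Q` works uses the
orthogonality relations and the fact that each entry of `R` is its own cofactor. -/
theorem exists_rot_eq_of_trace (R : SO3) (hR : 0 < 1 + R.1 0 0 + R.1 1 1 + R.1 2 2) :
    ∃ q, rot q = R := by
  have h1 := R.mul_transpose
  have h2 := R.transpose_mul
  have h3 := R.adjugate_eq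
  rw [Matrix.adjugate_fin_three] at h3
  have a1 := fun i j => congrFun (congrFun h1 i) j
  have a2 := fun i j => congrFun (congrFun h2 i) j
  have a3 := fun i j => congrFun (congrFun h3 i) j
  have a100 := a1 0 0
  have a111 := a1 1 1
  have a122 := a1 2 2
  have a101 := a1 0 1
  have a102 := a1 0 2
  have a112 := a1 1 2
  have a200 := a2 0 0
  have a211 := a2 1 1
  have a222 := a2 2 2
  have a201 := a2 0 1
  have a202 := a2 0 2
  have a212 := a2 1 2
  have a300 := a3 0 0
  have a301 := a3 0 1
  have a302 := a3 0 2
  have a310 := a3 1 0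
  have a311 := a3 1 1
  have a312 := a3 1 2
  have a320 := a3 2 0
  have a321 := a3 2 1
  have a322 := a3 2 2
  clear a1 a2 a3 h1 h2 h3
  simp [Matrix.mul_apply, Fin.sum_univ_three] at a100 a111 a122 a101 a102 a112 a200 a211
  simp [Matrix.mul_apply, Fin.sum_univ_three] at a222 a201 a202 a212 a300 a301 a302 a310 a311 a312 a320 a321 a322
  obtain ⟨R, hRm⟩ := R
  simp only at *
  set T := 1 + R 0 0 + R 1 1 + R 2 2 with hT
  have hs : √T * √T = T := Real.mul_self_sqrt hR.le
  have hs0 : √T ≠ 0 := (Real.sqrt_pos.2 hR).ne'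
  set s := √T
  let Q : ℍ[ℝ] := quat (T / (2 * s)) ((R 2 1 - R 1 2) / (2 * s)) ((R 0 2 - R 2 0) / (2 * s))
    ((R 1 0 - R 0 1) / (2 * s))
  have hQ : Q.re ^ 2 + Q.imI ^ 2 + Q.imJ ^ 2 + Q.imK ^ 2 = 1 := by
    simp only [Q, quat_re, quat_imI, quat_imJ, quat_imK]
    field_simp
    rw [pow_two s, hs, hT]
    linarith
  refine ⟨⟨Q, (mem_S3_iff _).2 hQ⟩, Subtype.ext ?_⟩
  ext i j
  fin_cases i <;> fin_cases j <;> simp [coe_rot, rotMat, Q] <;> field_simp <;>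
    rw [pow_two s, hs, hT] <;> linarith

theorem rot_surjective : Function.Surjective rot := by
  intro R
  have key : ∀ p : S3, (∃ q, rot q = R * rot p) → ∃ q, rot q = R := by
    rintro p ⟨q, hq⟩
    exact ⟨q * p⁻¹, by rw [map_mul, hq, map_inv, mul_inv_cancel_right]⟩
  -- The four sign combinations add up to 4, so one of them is positive. Multiplication by the
  -- half-turn about a coordinate axis turns the other three into one plus the trace.
  by_cases h0 : 0 < 1 + R.1 0 0 + R.1 1 1 + R.1 2 2
  · exact exists_rot_eq_of_trace R h0
  by_cases h1 : 0 < 1 + R.1 0 0 - R.1 1 1 - R.1 2 2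
  · refine key ⟨quat 0 1 0 0, (mem_S3_iff _).2 (by simp)⟩ (exists_rot_eq_of_trace _ ?_)
    simpa [coe_rot, rotMat, Matrix.mul_apply, Fin.sum_univ_three, sub_eq_add_neg] using h1
  by_cases h2 : 0 < 1 - R.1 0 0 + R.1 1 1 - R.1 2 2
  · refine key ⟨quat 0 0 1 0, (mem_S3_iff _).2 (by simp)⟩ (exists_rot_eq_of_trace _ ?_)
    simpa [coe_rot, rotMat, Matrix.mul_apply, Fin.sum_univ_three, sub_eq_add_neg] using h2
  · refine key ⟨quat 0 0 0 1, (mem_S3_iff _).2 (by simp)⟩ (exists_rot_eq_of_trace _ ?_)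
    have h3 : 0 < 1 - R.1 0 0 - R.1 1 1 + R.1 2 2 := by linarith
    simpa [coe_rot, rotMat, Matrix.mul_apply, Fin.sum_univ_three, sub_eq_add_neg] using h3

instance SO3.compactSpace : CompactSpace SO3 :=
  rot_surjective.compactSpace continuous_rot

instance SO3.isTopologicalGroup : IsTopologicalGroup SO3 where
  continuous_mul := continuous_mul
  continuous_inv := by
    refine Continuous.subtype_mk (f := fun R : SO3 => R.1.transpose) ?_ _
    exact continuous_subtype_val.matrix_transpose

theorem isQuotientMap_rot : Topology.IsQuotientMap rot :=
  continuous_rot.isClosedMap.isQuotientMap continuous_rot rot_surjective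

/-- The kernel is finite, hence discrete, and a quotient by a discrete subgroup is a covering. -/
theorem isCoveringMap_rot : IsCoveringMap rot := by
  have hfin : (rot.ker : Set S3).Finite := by
    refine (Set.toFinite {1, -1}).subset fun q hq => ?_
    simpa using (rot_eq_one_iff q).1 hq
  have hd : IsDiscrete (rot.ker : Set S3) := hfin.isDiscrete
  exact (isQuotientMap_rot.isQuotientCoveringMap_of_isDiscrete_ker_monoidHom hd).isCoveringMap

instance S3.pathConnectedSpace : PathConnectedSpace S3 := by
  rw [← isPathConnected_iff_pathConnectedSpace]
  refine isPathConnected_sphere ?_ _ zero_le_one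
  rw [← Module.finrank_eq_rank, Quaternion.finrank_eq_four]
  norm_num

end Quaternions

/-! ### Loops in the three-sphere bound discs -/

section LoopExtension

open Quaternion

/-- Going radially inwards, `G` moves on segments from `g` to its approximation `p` and then to the
constant `v`. The first segment misses 0 because `‖p - g‖ < 1 = ‖g‖`, the second because `v` is on
no real line through 0 and a value of `p` on the circle. -/
theorem exists_continuous_extension_nonvanishing {g p : ℂ → ℍ[ℝ]} (hg : Continuous g)
    (hp : Continuous p) {v : ℍ[ℝ]} (hgn : ∀ z : ℂ, ‖z‖ = 1 → ‖g z‖ = 1)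
    (hpg : ∀ z : ℂ, ‖z‖ = 1 → ‖p z - g z‖ < 1)
    (hv : ∀ z : ℂ, ‖z‖ = 1 → ∀ s : ℝ, s • p z ≠ v) :
    ∃ G : ℂ → ℍ[ℝ], Continuous G ∧ (∀ z, G z ≠ 0) ∧ ∀ z : ℂ, ‖z‖ = 1 → G z = g z := by
  -- The weights of `g` and of `v`: `a` vanishes for `‖z‖ ≤ 2/3` and `c` for `‖z‖ ≥ 2/3`. For `‖z‖ <
  -- 1/3` only `v` remains, so that the singularity of the direction `w` at 0 does no harm.
  let a : ℂ → ℝ := fun z => max 0 (min 1 (3 * ‖z‖ - 2))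
  let c : ℂ → ℝ := fun z => max 0 (min 1 (2 - 3 * ‖z‖))
  have ha : Continuous a := by fun_prop
  have hc : Continuous c := by fun_prop
  have hac : ∀ z, a z = 0 ∨ c z = 0 := fun z => by
    rcases le_total (3 * ‖z‖) 2 with h | h
    · left
      exact max_eq_left ((min_le_right _ _).trans (by linarith))
    · right
      exact max_eq_left ((min_le_right _ _).trans (by linarith))
  have ha0 : ∀ z, 0 ≤ a z := fun z => le_max_left _ _
  have ha1 : ∀ z, a z ≤ 1 := fun z => max_le zero_le_one (min_le_left _ _)
  have hc0 : ∀ z, 0 ≤ c z := fun z => le_max_left _ _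
  have hc1 : ∀ z, c z ≤ 1 := fun z => max_le zero_le_one (min_le_left _ _)
  let w : ℂ → ℂ := fun z => (‖z‖ : ℂ)⁻¹ * z
  have hw : ∀ z, z ≠ 0 → ‖w z‖ = 1 := fun z hz => by
    have : ‖z‖ ≠ 0 := by simpa using hz
    simp [w, this]
  have hwc : ContinuousOn w {0}ᶜ := by
    refine ContinuousOn.mul (ContinuousOn.inv₀ (by fun_prop) ?_) continuousOn_id
    intro z hz
    simpa using hz
  have hv0 : v ≠ 0 := fun h => hv 1 (by simp) 0 (by rw [zero_smul, h])
  let G : ℂ → ℍ[ℝ] := fun z => a z • g (w z) + (1 - a z - c z) • p (w z) + c z • v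
  have hG0 : ∀ z : ℂ, ‖z‖ < 1 / 3 → G z = v := fun z hz => by
    have h1 : a z = 0 := max_eq_left ((min_le_right _ _).trans (by linarith))
    have h2 : c z = 1 := by
      simp only [c]
      rw [min_eq_left (by linarith), max_eq_right zero_le_one]
    simp [G, h1, h2]
  refine ⟨G, continuous_iff_continuousAt.2 fun z => ?_, fun z hz => ?_, fun z hz => ?_⟩
  · by_cases hz : z = 0
    · refine ContinuousAt.congr (f := fun _ => v) continuousAt_const ?_
      filter_upwards [Metric.ball_mem_nhds z (by norm_num : (0 : ℝ) < 1 / 3)] with x hx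
      exact (hG0 x (by simpa [hz] using hx)).symm
    · have hwz : ContinuousAt w z := hwc.continuousAt (isOpen_compl_singleton.mem_nhds hz)
      have h1 : ContinuousAt (fun z => g (w z)) z := hg.continuousAt.comp hwz
      have h2 : ContinuousAt (fun z => p (w z)) z := hp.continuousAt.comp hwz
      exact ((ha.continuousAt.smul h1).add
        (((continuousAt_const.sub ha.continuousAt).sub hc.continuousAt).smul h2)).add
        (hc.continuousAt.smul continuousAt_const)
  · have hz0 : z ≠ 0 := by
      rintro rfl
      exact hv0 ((hG0 0 (by simp)).symm.trans hz)
    have hn := hw z hz0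
    rcases hac z with h | h
    · have h3 : (1 - c z) • p (w z) + c z • v = 0 := by simpa [G, h] using hz
      by_cases hcz : c z = 0
      · have h4 : p (w z) = 0 := by simpa [hcz] using h3
        have h5 := hpg _ hn
        rw [h4, zero_sub, norm_neg, hgn _ hn] at h5
        exact lt_irrefl _ h5
      · refine hv _ hn (-((c z)⁻¹ * (1 - c z))) ?_
        rw [neg_smul, mul_smul, eq_neg_of_add_eq_zero_left h3, smul_neg, neg_neg, smul_smul,
          inv_mul_cancel₀ hcz, one_smul]
    · have h3 : g (w z) = -((1 - a z) • (p (w z) - g (w z))) := by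
        have h4 : a z • g (w z) + (1 - a z) • p (w z) = 0 := by simpa [G, h] using hz
        have h5 : g (w z) + (1 - a z) • (p (w z) - g (w z)) = 0 := by
          rw [← h4]; module
        exact eq_neg_of_add_eq_zero_left h5
      have h4 : ‖g (w z)‖ < 1 := by
        rw [h3, norm_neg, norm_smul, Real.norm_of_nonneg (by linarith [ha1 z])]
        have := hpg _ hn
        nlinarith [norm_nonneg (p (w z) - g (w z)), ha0 z, ha1 z]
      rw [hgn _ hn] at h4
      exact lt_irrefl _ h4
  · have h1 : a z = 1 := by simp only [a, hz]; norm_num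
    have h2 : c z = 0 := by simp only [c, hz]; norm_num
    have h3 : w z = z := by simp [w, hz]
    simp [G, h1, h2, h3]

/-- Every loop in the three-sphere extends to the disc. -/
theorem exists_extension_of_circle_to_S3 (f : C(Circle, S3)) :
    ∃ F : C(ℂ, S3), ∀ x : Circle, F x = f x := by
  have hcl : IsClosed (Submonoid.unitSphere ℂ : Set ℂ) := Metric.isClosed_sphere
  have : TietzeExtension ℍ[ℝ] := .of_tvs ℝ
  obtain ⟨g, hg⟩ := ContinuousMap.exists_restrict_eq hcl
    (⟨fun x => (f x : ℍ[ℝ]), by fun_prop⟩ : C(Circle, ℍ[ℝ]))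
  have hgf : ∀ x : Circle, g x = f x := fun x => congrArg (fun φ => φ x) hg
  have hgn : ∀ z : ℂ, ‖z‖ = 1 → ‖g z‖ = 1 := fun z hz => by
    have := hgf ⟨z, mem_sphere_zero_iff_norm.2 hz⟩
    simp only at this
    rw [this]
    simp
  obtain ⟨p, hp, hpg, -⟩ := g.continuous.exists_contDiff_approx (ε := fun _ => 1) 1
    continuous_const (fun _ => one_pos)
  -- The real cone over a `C¹` loop is a `C¹` image of `ℝ²`, so it cannot fill the four-dimensional
  -- space. This is why the continuous loop is first approximated.
  have hcone : ContDiff ℝ 1 fun y : ℝ × ℝ => y.1 • p (Complex.exp (y.2 * Complex.I)) := by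
    refine contDiff_fst.smul (hp.comp ?_)
    refine Complex.contDiff_exp.comp (ContDiff.mul (Complex.ofRealCLM.contDiff.comp contDiff_snd)
      contDiff_const)
  have hd := hcone.dense_compl_range_of_finrank_lt_finrank (by
    rw [Quaternion.finrank_eq_four, Module.finrank_prod]; simp)
  obtain ⟨v, hv⟩ := hd.nonempty
  obtain ⟨G, hG, hG0, hGg⟩ := exists_continuous_extension_nonvanishing g.continuous hp.continuous
    (v := v) hgn (fun z _ => by simpa [dist_eq_norm] using hpg z) (fun z hz s h => by
      refine hv ⟨(s, z.arg), ?_⟩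
      have : Complex.exp (z.arg * Complex.I) = z := by
        simpa [hz] using Complex.norm_mul_exp_arg_mul_I z
      simpa [this] using h)
  refine ⟨⟨fun z => ⟨‖G z‖⁻¹ • G z, ?_⟩, ?_⟩, fun x => Subtype.ext ?_⟩
  · have : ‖G z‖ ≠ 0 := by simpa using hG0 z
    simp [norm_smul, this]
  · refine Continuous.subtype_mk ((hG.norm.inv₀ fun z => ?_).smul hG) _
    simpa using hG0 z
  · have h : G x = f x := by rw [hGg _ (mem_sphere_zero_iff_norm.1 x.2), hgf]
    simp [h]

end LoopExtension

/-! ### Lifts and isomorphisms for principal bundles -/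

section PrincipalBundles

variable {G B P P' : Type*} [Group G] [TopologicalSpace G] [TopologicalSpace B]
  [TopologicalSpace P] [MulAction G P] [TopologicalSpace P'] [MulAction G P']
  {proj : P → B} {proj' : P' → B}

namespace IsPrincipalBundle

theorem exists_smul_eq (hP : IsPrincipalBundle G proj) {p p' : P} (h : proj p = proj p') :
    ∃ g : G, p' = g • p := by
  obtain ⟨e, he, heq⟩ := hP.locally_trivial (proj p)
  have hp : p ∈ e.source := e.mem_source.2 he
  have hp' : p' ∈ e.source := e.mem_source.2 (h ▸ he)
  refine ⟨(e p').2 * (e p).2⁻¹, e.injOn hp' (e.mem_source.2 (by rwa [hP.proj_smul])) ?_⟩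
  refine Prod.ext ?_ ?_
  · change (e p').1 = (e _).1
    rw [e.coe_fst hp', e.coe_fst (e.mem_source.2 (by rwa [hP.proj_smul])), hP.proj_smul, h]
  · change (e p').2 = (e _).2
    rw [heq p hp, inv_mul_cancel_right]

theorem smul_right_injective (hP : IsPrincipalBundle G proj) (p : P) :
    Function.Injective fun g : G => g • p := by
  intro g g' h
  obtain ⟨e, he, heq⟩ := hP.locally_trivial (proj p)
  have hp : p ∈ e.source := e.mem_source.2 he
  have h' := congrArg (fun p => (e p).2) h
  simp only at h'
  rw [heq p hp, heq p hp] at h'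
  exact mul_right_cancel h'

theorem continuous_proj (hP : IsPrincipalBundle G proj) : Continuous proj := by
  refine continuous_iff_continuousAt.2 fun p => ?_
  obtain ⟨e, he, -⟩ := hP.locally_trivial (proj p)
  exact e.continuousAt_proj (e.mem_source.2 he)

theorem t2Space [T2Space B] [T2Space G] (hP : IsPrincipalBundle G proj) : T2Space P := by
  rw [t2Space_iff_disjoint_nhds]
  intro p p' hne
  by_cases h : proj p = proj p'
  · obtain ⟨e, he, -⟩ := hP.locally_trivial (proj p)
    have hp : p ∈ e.source := e.mem_source.2 he
    have hp' : p' ∈ e.source := e.mem_source.2 (h ▸ he)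
    exact (e.continuousAt hp).tendsto.disjoint
      (disjoint_nhds_nhds.2 fun h => hne (e.injOn hp hp' h)) (e.continuousAt hp').tendsto
  · exact hP.continuous_proj.continuousAt.tendsto.disjoint (disjoint_nhds_nhds.2 h)
      hP.continuous_proj.continuousAt.tendsto

/-- Two lifts of the same map differ by a continuous function with values in the group. -/
theorem exists_div [IsTopologicalGroup G] (hP : IsPrincipalBundle G proj) {X : Type*}
    [TopologicalSpace X] {S : Set X} {a b : X → P} (ha : ContinuousOn a S) (hb : ContinuousOn b S)
    (hab : ∀ x ∈ S, proj (a x) = proj (b x)) :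
    ∃ g : X → G, ContinuousOn g S ∧ ∀ x ∈ S, b x = g x • a x := by
  classical
  have hex : ∀ x, ∃ g : G, x ∈ S → b x = g • a x := fun x => by
    by_cases hx : x ∈ S
    · obtain ⟨g, hg⟩ := hP.exists_smul_eq (hab x hx)
      exact ⟨g, fun _ => hg⟩
    · exact ⟨1, fun h => absurd h hx⟩
  choose g hg using hex
  refine ⟨g, fun x hx => ?_, hg⟩
  obtain ⟨e, he, heq⟩ := hP.locally_trivial (proj (a x))
  have hax : a x ∈ e.source := e.mem_source.2 he
  have hbx : b x ∈ e.source := e.mem_source.2 (hab x hx ▸ he)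
  -- In a trivialization the dividing element is the quotient of the fibre coordinates.
  have h1 : ContinuousWithinAt (fun y => (e (b y)).2 * (e (a y)).2⁻¹) S x :=
    (continuous_snd.continuousAt.comp_continuousWithinAt
      ((e.continuousAt hbx).comp_continuousWithinAt (hb x hx))).mul
    (continuous_snd.continuousAt.comp_continuousWithinAt
      ((e.continuousAt hax).comp_continuousWithinAt (ha x hx))).inv
  refine h1.congr_of_eventuallyEq ?_ ?_
  · filter_upwards [self_mem_nhdsWithin, (ha x hx) (e.open_source.mem_nhds hax)] with y hy hay
    rw [hg y hy, heq _ hay, mul_inv_cancel_right]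
  · rw [hg x hx, heq _ hax, mul_inv_cancel_right]

/-- `f` lifts to the total space over the set `S`. -/
def LiftsOn (proj : P → B) (f : ℝ × ℝ → B) (S : Set (ℝ × ℝ)) : Prop :=
  ∃ s : ℝ × ℝ → P, ContinuousOn s S ∧ ∀ x ∈ S, proj (s x) = f x

/-- On the overlap the two lifts differ by a map into the group. Composed with the retraction `r` of
`T` onto `S ∩ T`, this map extends to `T` and corrects the second lift so that the two agree. -/
theorem LiftsOn.union [IsTopologicalGroup G] (hP : IsPrincipalBundle G proj) {f : ℝ × ℝ → B}
    {S T : Set (ℝ × ℝ)} (hS : IsClosed S) (hT : IsClosed T) {r : ℝ × ℝ → ℝ × ℝ}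
    (hr : Continuous r) (hrT : Set.MapsTo r T (S ∩ T)) (hrid : ∀ x ∈ S ∩ T, r x = x)
    (h : LiftsOn proj f S) (h' : LiftsOn proj f T) : LiftsOn proj f (S ∪ T) := by
  classical
  obtain ⟨s, hs, hsf⟩ := h
  obtain ⟨t, ht, htf⟩ := h'
  obtain ⟨g, hg, hgst⟩ := hP.exists_div (ht.mono Set.inter_subset_right)
    (hs.mono Set.inter_subset_left)
    (fun x (hx : x ∈ S ∩ T) => (htf x hx.2).trans (hsf x hx.1).symm)
  have hT' : ∀ x ∈ T, (if x ∈ S then s x else g (r x) • t x) = g (r x) • t x := fun x hx => by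
    split_ifs with hxS
    · rw [hrid x ⟨hxS, hx⟩, hgst x ⟨hxS, hx⟩]
    · rfl
  refine ⟨fun x => if x ∈ S then s x else g (r x) • t x, ?_, ?_⟩
  · refine ContinuousOn.union_of_isClosed ?_ ?_ hS hT
    · exact hs.congr fun x hx => if_pos hx
    · refine ContinuousOn.congr ?_ hT'
      exact hP.continuous_smul.comp_continuousOn ((hg.comp hr.continuousOn hrT).prodMk ht)
  · rintro x (hx | hx)
    · simp only [if_pos hx, hsf x hx]
    · simp only
      rw [hT' x hx, hP.proj_smul, htf x hx]

/-- By the Lebesgue number lemma the square is a grid of cells, each lying over a trivializing set.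
Cells are glued into rows and rows into the square, each time along an edge onto which the
projection is a retraction. -/
theorem liftsOn_unitSquare [IsTopologicalGroup G] (hP : IsPrincipalBundle G proj)
    {f : ℝ × ℝ → B} (hf : Continuous f) :
    LiftsOn proj f (Set.Icc 0 1 ×ˢ Set.Icc 0 1) := by
  choose e he heq using hP.locally_trivial
  obtain ⟨δ, hδ, hL⟩ := lebesgue_number_lemma_of_metric
    (c := fun b => f ⁻¹' (e b).baseSet)
    ((isCompact_Icc (a := (0 : ℝ)) (b := 1)).prod (isCompact_Icc (a := (0 : ℝ)) (b := 1)))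
    (fun b => (e b).open_baseSet.preimage hf)
    (fun x _ => Set.mem_iUnion.2 ⟨f x, he (f x)⟩)
  obtain ⟨N, hN⟩ := exists_nat_one_div_lt hδ
  have hN0 : (0 : ℝ) < N + 1 := by positivity
  set d : ℝ := 1 / ((N : ℝ) + 1) with hd
  have hd0 : 0 < d := by positivity
  have hNd : ((N : ℝ) + 1) * d = 1 := by rw [hd]; field_simp
  have hcell : ∀ i ≤ N, ∀ j ≤ N, LiftsOn proj f
      (Set.Icc (i * d) ((i + 1) * d) ×ˢ Set.Icc (j * d) ((j + 1) * d)) := by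
    intro i hi j hj
    have hle : ∀ k : ℕ, k ≤ N → (k : ℝ) * d ≤ 1 := fun k hk => by
      have : (k : ℝ) ≤ N := by exact_mod_cast hk
      nlinarith
    obtain ⟨b, hb⟩ := hL (i * d, j * d)
      ⟨⟨by positivity, hle i hi⟩, ⟨by positivity, hle j hj⟩⟩
    have hsub : ∀ x ∈ Set.Icc (i * d) ((i + 1) * d) ×ˢ Set.Icc (j * d) ((j + 1) * d),
        f x ∈ (e b).baseSet := by
      rintro ⟨x, y⟩ ⟨⟨h1, h2⟩, ⟨h3, h4⟩⟩
      refine hb ?_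
      simp only at h1 h2 h3 h4
      rw [Metric.mem_ball, Prod.dist_eq, Real.dist_eq, Real.dist_eq, max_lt_iff, abs_lt, abs_lt]
      refine ⟨⟨?_, ?_⟩, ⟨?_, ?_⟩⟩ <;> simp only <;> linarith
    refine ⟨fun x => (e b).toOpenPartialHomeomorph.symm (f x, 1), ?_, fun x hx => ?_⟩
    · refine (e b).toOpenPartialHomeomorph.continuousOn_symm.comp
        (hf.continuousOn.prodMk continuousOn_const) fun x hx => ?_
      rw [(e b).target_eq] at *
      exact ⟨hsub x hx, trivial⟩
    · exact (e b).proj_symm_apply ((e b).mem_target.2 (hsub x hx))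
  have hrow : ∀ j ≤ N, ∀ i ≤ N, LiftsOn proj f
      (Set.Icc 0 ((i + 1) * d) ×ˢ Set.Icc (j * d) ((j + 1) * d)) := by
    intro j hj i
    induction i with
    | zero => intro hi; simpa using hcell 0 hi j hj
    | succ i ih =>
      intro hi
      have h1 := ih (by omega)
      have h2 := hcell (i + 1) hi j hj
      push_cast at h2 ⊢
      have h3 := LiftsOn.union hP (isClosed_Icc.prod isClosed_Icc)
        (isClosed_Icc.prod isClosed_Icc) (r := fun x => (((i : ℝ) + 1) * d, x.2)) (by fun_prop)
        (by
          rintro ⟨x, y⟩ ⟨⟨a1, a2⟩, a3⟩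
          exact ⟨⟨⟨by positivity, le_rfl⟩, a3⟩, ⟨⟨le_rfl, by nlinarith⟩, a3⟩⟩)
        (by
          rintro ⟨x, y⟩ ⟨⟨⟨a1, a2⟩, a3⟩, ⟨⟨a4, a5⟩, a6⟩⟩
          exact Prod.ext (le_antisymm a4 a2) rfl) h1 h2
      rw [← Set.union_prod, Set.Icc_union_Icc_eq_Icc (by positivity) (by nlinarith)] at h3
      exact h3
  have hall : ∀ j ≤ N, LiftsOn proj f (Set.Icc 0 1 ×ˢ Set.Icc 0 ((j + 1) * d)) := by
    intro j
    induction j with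
    | zero =>
      intro hj
      have := hrow 0 hj N le_rfl
      rw [hNd] at this
      simpa using this
    | succ j ih =>
      intro hj
      have h1 := ih (by omega)
      have h2 := hrow (j + 1) hj N le_rfl
      rw [hNd] at h2
      push_cast at h2 ⊢
      have h3 := LiftsOn.union hP (isClosed_Icc.prod isClosed_Icc)
        (isClosed_Icc.prod isClosed_Icc) (r := fun x => (x.1, ((j : ℝ) + 1) * d)) (by fun_prop)
        (by
          rintro ⟨x, y⟩ ⟨a3, ⟨a1, a2⟩⟩
          exact ⟨⟨a3, ⟨by positivity, le_rfl⟩⟩, ⟨a3, ⟨le_rfl, by nlinarith⟩⟩⟩)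
        (by
          rintro ⟨x, y⟩ ⟨⟨a3, ⟨a1, a2⟩⟩, ⟨a6, ⟨a4, a5⟩⟩⟩
          exact Prod.ext rfl (le_antisymm a4 a2)) h1 h2
      rw [← Set.prod_union, Set.Icc_union_Icc_eq_Icc (by positivity) (by nlinarith)] at h3
      exact h3
  have := hall N le_rfl
  rwa [hNd] at this

/-- Compatible families of points indexed by a compact space determine an isomorphism of principal
bundles. -/
theorem iso_of_compatible_lifts [T2Space B] [T2Space G] [CompactSpace G]
    (hP : IsPrincipalBundle G proj) (hP' : IsPrincipalBundle G proj')
    {K : Type*} [TopologicalSpace K] [CompactSpace K] {q : K → B} (hq : Function.Surjective q)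
    {s : K → P} {s' : K → P'} (hs : Continuous s) (hs' : Continuous s')
    (hsq : ∀ z, proj (s z) = q z) (hsq' : ∀ z, proj' (s' z) = q z)
    (hcomp : ∀ z w, ∀ g : G, s w = g • s z → s' w = g • s' z) :
    PrincipalBundleIso G proj proj' := by
  have := hP.t2Space
  have := hP'.t2Space
  -- The map `m` is a continuous surjection from a compact space to a Hausdorff one, hence a
  -- quotient map, and `hcomp` makes `m'` constant on its fibres. The induced map of total spaces is
  -- the isomorphism.
  let m : G × K → P := fun x => x.1 • s x.2
  let m' : G × K → P' := fun x => x.1 • s' x.2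
  have hm : Continuous m := hP.continuous_smul.comp (continuous_fst.prodMk (hs.comp continuous_snd))
  have hm' : Continuous m' :=
    hP'.continuous_smul.comp (continuous_fst.prodMk (hs'.comp continuous_snd))
  have hsurj : Function.Surjective m := fun p => by
    obtain ⟨z, hz⟩ := hq (proj p)
    obtain ⟨g, hg⟩ := hP.exists_smul_eq ((hsq z).trans hz)
    exact ⟨(g, z), hg.symm⟩
  have hquot : Topology.IsQuotientMap m := hm.isClosedMap.isQuotientMap hm hsurj
  have : CompactSpace P := hsurj.compactSpace hm
  have hmm : ∀ x y, m x = m y → m' x = m' y := by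
    rintro ⟨g, z⟩ ⟨h, w⟩ e
    have e1 : s w = (h⁻¹ * g) • s z := by
      rw [mul_smul, show g • s z = h • s w from e, inv_smul_smul]
    change g • s' z = h • s' w
    rw [hcomp z w _ e1, mul_smul, smul_inv_smul]
  let Φ : C(P, P') := Topology.IsQuotientMap.lift (f := ⟨m, hm⟩) hquot ⟨m', hm'⟩
    fun {x y} h => hmm x y h
  have hΦ : ∀ x, Φ (m x) = m' x := fun x =>
    congrArg (fun φ : C(G × K, P') => φ x)
      (Topology.IsQuotientMap.lift_comp (f := ⟨m, hm⟩) hquot ⟨m', hm'⟩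
        fun {x y} h => hmm x y h)
  have hΦs : ∀ (g : G) (p : P), Φ (g • p) = g • Φ p := fun g p => by
    obtain ⟨⟨h, z⟩, rfl⟩ := hsurj p
    have : g • m (h, z) = m (g * h, z) := (mul_smul g h (s z)).symm
    rw [this, hΦ, hΦ]
    exact mul_smul g h (s' z)
  have hΦp : ∀ p, proj' (Φ p) = proj p := fun p => by
    obtain ⟨⟨h, z⟩, rfl⟩ := hsurj p
    rw [hΦ]
    simp only [m, m', hP.proj_smul, hP'.proj_smul, hsq, hsq']
  have hinj : Function.Injective Φ := fun p p' h => by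
    have h1 : proj p = proj p' := by rw [← hΦp, ← hΦp, h]
    obtain ⟨g, rfl⟩ := hP.exists_smul_eq h1
    rw [hΦs] at h
    have := hP'.smul_right_injective (Φ p) ((one_smul G (Φ p)).trans h)
    rw [← this, one_smul]
  have hsur : Function.Surjective Φ := fun p' => by
    obtain ⟨z, hz⟩ := hq (proj' p')
    obtain ⟨g, hg⟩ := hP'.exists_smul_eq ((hsq' z).trans hz)
    exact ⟨m (g, z), (hΦ (g, z)).trans hg.symm⟩
  exact ⟨Continuous.homeoOfEquivCompactToT2 (f := Equiv.ofBijective Φ ⟨hinj, hsur⟩) Φ.continuous,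
    hΦp, hΦs⟩

end IsPrincipalBundle

end PrincipalBundles

/-! ### Classification of SO(3)-bundles over the projective plane -/

section Clutching

theorem discVec_ne_zero (z : ℂ) : ![z.re, z.im, √(1 - ‖z‖ ^ 2)] ≠ 0 := by
  intro h
  have h0 : z.re = 0 := congrFun h 0
  have h1 : z.im = 0 := congrFun h 1
  have h2 : √(1 - ‖z‖ ^ 2) = 0 := congrFun h 2
  have hz : z = 0 := Complex.ext h0 h1
  simp [hz] at h2

/-- The projection of the closed unit disc onto the projective plane, extended to the plane. -/
noncomputable def discToRP2 (z : ℂ) : RP2 := Projectivization.mk ℝ _ (discVec_ne_zero z)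

theorem discVec_sq_sum {z : ℂ} (hz : ‖z‖ ≤ 1) :
    z.re ^ 2 + z.im ^ 2 + √(1 - ‖z‖ ^ 2) ^ 2 = 1 := by
  have nz : ‖z‖ ^ 2 = z.re ^ 2 + z.im ^ 2 := by
    rw [← Complex.normSq_eq_norm_sq, Complex.normSq_apply]; ring
  rw [Real.sq_sqrt (by nlinarith [norm_nonneg z]), nz]
  ring

theorem continuous_discToRP2 : Continuous discToRP2 := by
  have h : Continuous fun z : ℂ => ![z.re, z.im, √(1 - ‖z‖ ^ 2)] := by
    refine continuous_pi fun i => ?_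
    fin_cases i
    · exact Complex.continuous_re
    · exact Complex.continuous_im
    · change Continuous fun z : ℂ => √(1 - ‖z‖ ^ 2)
      fun_prop
  exact continuous_projMk.comp (h.subtype_mk discVec_ne_zero)

/-- Outside the disc the radicand is negative, its `Real.sqrt` is 0, and only the direction of `z`
counts. -/
theorem discToRP2_clamp (z : ℂ) : discToRP2 ((max 1 ‖z‖)⁻¹ • z) = discToRP2 z := by
  rcases le_total ‖z‖ 1 with h | h
  · rw [max_eq_left h, inv_one, one_smul]
  · have hz : 0 < ‖z‖ := one_pos.trans_le h
    have h1 : ‖‖z‖⁻¹ • z‖ = 1 := by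
      rw [norm_smul, norm_inv, norm_norm, inv_mul_cancel₀ hz.ne']
    rw [max_eq_right h]
    refine (Projectivization.mk_eq_mk_iff' ℝ _ _ _ _).2 ⟨‖z‖⁻¹, ?_⟩
    have h2 : √(1 - ‖z‖ ^ 2) = 0 := Real.sqrt_eq_zero_of_nonpos (by nlinarith)
    rw [h1, h2]
    ext i
    fin_cases i <;> simp

theorem discToRP2_neg {z : ℂ} (hz : ‖z‖ = 1) : discToRP2 (-z) = discToRP2 z := by
  refine (Projectivization.mk_eq_mk_iff' ℝ _ _ _ _).2 ⟨-1, ?_⟩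
  ext i
  fin_cases i <;> simp [hz]

/-- Points of the disc correspond to unit vectors of the upper hemisphere, so two on the same line
differ by a sign. The sign -1 forces both heights, which are nonnegative, to vanish. -/
theorem eq_or_eq_neg_of_discToRP2_eq {z w : ℂ} (hz : ‖z‖ ≤ 1) (hw : ‖w‖ ≤ 1)
    (h : discToRP2 z = discToRP2 w) : w = z ∨ (w = -z ∧ ‖z‖ = 1) := by
  obtain ⟨a, ha⟩ := (Projectivization.mk_eq_mk_iff' ℝ _ _ _ _).1 h
  have h0 : a * w.re = z.re := congrFun ha 0
  have h1 : a * w.im = z.im := congrFun ha 1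
  have h2 : a * √(1 - ‖w‖ ^ 2) = √(1 - ‖z‖ ^ 2) := congrFun ha 2
  have hsz : √(1 - ‖z‖ ^ 2) ^ 2 = 1 - ‖z‖ ^ 2 := Real.sq_sqrt (by nlinarith [norm_nonneg z])
  have hsw : √(1 - ‖w‖ ^ 2) ^ 2 = 1 - ‖w‖ ^ 2 := Real.sq_sqrt (by nlinarith [norm_nonneg w])
  have nz : ‖z‖ ^ 2 = z.re ^ 2 + z.im ^ 2 := by
    rw [← Complex.normSq_eq_norm_sq, Complex.normSq_apply]; ring
  have nw : ‖w‖ ^ 2 = w.re ^ 2 + w.im ^ 2 := by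
    rw [← Complex.normSq_eq_norm_sq, Complex.normSq_apply]; ring
  have ha2 : (a - 1) * (a + 1) = 0 := by
    have : a ^ 2 * (w.re ^ 2 + w.im ^ 2 + √(1 - ‖w‖ ^ 2) ^ 2) =
        z.re ^ 2 + z.im ^ 2 + √(1 - ‖z‖ ^ 2) ^ 2 := by
      rw [← h0, ← h1, ← h2]; ring
    rw [hsz, hsw, nz, nw] at this
    linarith
  rcases mul_eq_zero.1 ha2 with ha | ha
  · left
    have : a = 1 := by linarith
    subst this
    exact Complex.ext (by linarith) (by linarith)
  · right
    have : a = -1 := by linarith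
    subst this
    refine ⟨Complex.ext (by simp; linarith) (by simp; linarith), ?_⟩
    have h3 : √(1 - ‖z‖ ^ 2) = 0 :=
      le_antisymm (by linarith [Real.sqrt_nonneg (1 - ‖w‖ ^ 2)]) (Real.sqrt_nonneg _)
    rw [h3] at hsz
    nlinarith [norm_nonneg z]

theorem exists_discToRP2_eq (x : RP2) : ∃ z : ℂ, ‖z‖ ≤ 1 ∧ discToRP2 z = x := by
  induction x using Projectivization.ind with
  | h v hv =>
  wlog h2 : 0 ≤ v 2 generalizing v
  · obtain ⟨z, hz, h⟩ := this (-v) (neg_ne_zero.2 hv) (by simp; linarith)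
    refine ⟨z, hz, h.trans ?_⟩
    exact (Projectivization.mk_eq_mk_iff' ℝ _ _ _ _).2 ⟨-1, by simp⟩
  have hpos : 0 < v 0 ^ 2 + v 1 ^ 2 + v 2 ^ 2 := by
    by_contra hle
    refine hv (funext fun i => ?_)
    have h0 : v 0 = 0 := by nlinarith [sq_nonneg (v 0), sq_nonneg (v 1), sq_nonneg (v 2)]
    have h1 : v 1 = 0 := by nlinarith [sq_nonneg (v 0), sq_nonneg (v 1), sq_nonneg (v 2)]
    have h2 : v 2 = 0 := by nlinarith [sq_nonneg (v 0), sq_nonneg (v 1), sq_nonneg (v 2)]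
    fin_cases i <;> assumption
  set r := √(v 0 ^ 2 + v 1 ^ 2 + v 2 ^ 2) with hr
  have hr0 : 0 < r := Real.sqrt_pos.2 hpos
  have hr2 : r ^ 2 = v 0 ^ 2 + v 1 ^ 2 + v 2 ^ 2 := Real.sq_sqrt hpos.le
  have hn : ‖(⟨v 0 / r, v 1 / r⟩ : ℂ)‖ ^ 2 = 1 - (v 2 / r) ^ 2 := by
    rw [← Complex.normSq_eq_norm_sq, Complex.normSq_mk]
    field_simp
    rw [hr2]; ring
  refine ⟨⟨v 0 / r, v 1 / r⟩, ?_, ?_⟩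
  · nlinarith [norm_nonneg (⟨v 0 / r, v 1 / r⟩ : ℂ), sq_nonneg (v 2 / r)]
  · refine (Projectivization.mk_eq_mk_iff' ℝ _ _ _ _).2 ⟨r⁻¹, ?_⟩
    rw [hn, sub_sub_cancel, Real.sqrt_sq (by positivity)]
    ext i
    fin_cases i <;> simp [div_eq_inv_mul]

variable {P : Type*} [TopologicalSpace P] [MulAction SO3 P] {proj : P → RP2}
  {P' : Type*} [TopologicalSpace P'] [MulAction SO3 P'] {proj' : P' → RP2}

/-- The bundle has a section over the disc whose values at antipodal boundary points differ by a
path in `SO(3)`; `ε` is the obstruction to closing up a lift of that path to the three-sphere. -/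
def HasClutching (proj : P → RP2) (ε : S3) : Prop :=
  ∃ (s : C(ℂ, P)) (g : C(ℝ, S3)), (∀ z, proj (s z) = discToRP2 z) ∧
    (∀ θ : ℝ, s (-(Circle.exp θ : ℂ)) = rot (g θ) • s (Circle.exp θ : ℂ)) ∧
    g Real.pi * g 0 = ε

/-- The radial retraction of the plane onto the closed unit disc. -/
noncomputable def clampDisc (z : ℂ) : ℂ := (max 1 ‖z‖)⁻¹ • z

theorem continuous_clampDisc : Continuous clampDisc := by
  refine Continuous.smul ((continuous_const.max continuous_norm).inv₀ fun z => ?_) continuous_id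
  exact (one_pos.trans_le (le_max_left _ _)).ne'

theorem norm_clampDisc_le (z : ℂ) : ‖clampDisc z‖ ≤ 1 := by
  have : 0 < max 1 ‖z‖ := one_pos.trans_le (le_max_left _ _)
  rw [clampDisc, norm_smul, norm_inv, Real.norm_of_nonneg this.le, inv_mul_le_iff₀ this, mul_one]
  exact le_max_right _ _

theorem clampDisc_of_norm_eq_one {z : ℂ} (hz : ‖z‖ = 1) : clampDisc z = z := by
  simp [clampDisc, hz]

/-- The disc lies in the square `[-1, 1]²`, over which lifts exist; composing with `clampDisc` gives
a section on the whole plane. -/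
theorem exists_disc_section (hP : IsPrincipalBundle SO3 proj) :
    ∃ s : C(ℂ, P), ∀ z, proj (s z) = discToRP2 z := by
  obtain ⟨s, hs, hsf⟩ := hP.liftsOn_unitSquare
    (f := fun x => discToRP2 ⟨2 * x.1 - 1, 2 * x.2 - 1⟩)
    (continuous_discToRP2.comp (Complex.equivRealProdCLM.symm.continuous.comp
      (by fun_prop : Continuous fun x : ℝ × ℝ => (2 * x.1 - 1, 2 * x.2 - 1))))
  let a : ℂ → ℝ × ℝ := fun z => (((clampDisc z).re + 1) / 2, ((clampDisc z).im + 1) / 2)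
  have hac : Continuous a := by
    have h1 := Complex.continuous_re.comp continuous_clampDisc
    have h2 := Complex.continuous_im.comp continuous_clampDisc
    exact ((h1.add continuous_const).div_const 2).prodMk ((h2.add continuous_const).div_const 2)
  have ha : ∀ z, a z ∈ Set.Icc (0 : ℝ) 1 ×ˢ Set.Icc (0 : ℝ) 1 := fun z => by
    have h1 := abs_le.1 ((Complex.abs_re_le_norm (clampDisc z)).trans (norm_clampDisc_le z))
    have h2 := abs_le.1 ((Complex.abs_im_le_norm (clampDisc z)).trans (norm_clampDisc_le z))
    refine ⟨⟨?_, ?_⟩, ⟨?_, ?_⟩⟩ <;> simp only [a] <;> linarith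
  refine ⟨⟨fun z => s (a z), hs.comp_continuous hac ha⟩, fun z => ?_⟩
  change proj (s (a z)) = _
  rw [hsf _ (ha z), ← discToRP2_clamp z]
  refine congrArg discToRP2 (Complex.ext ?_ ?_) <;> simp only [a, clampDisc] <;> ring

theorem exists_lift_S3 {X : Type*} [TopologicalSpace X] [SimplyConnectedSpace X]
    [LocallyPathConnectedSpace X] {f : X → SO3} (hf : Continuous f) :
    ∃ F : C(X, S3), ∀ x, rot (F x) = f x := by
  obtain ⟨x₀⟩ : Nonempty X := inferInstance
  obtain ⟨e₀, he⟩ := rot_surjective (f x₀)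
  obtain ⟨F, ⟨-, hF⟩, -⟩ :=
    isCoveringMap_rot.existsUnique_continuousMap_lifts ⟨f, hf⟩ x₀ e₀ he
  exact ⟨F, fun x => congrFun hF x⟩

theorem norm_circleExp (θ : ℝ) : ‖(Circle.exp θ : ℂ)‖ = 1 := by
  rw [Circle.coe_exp, Complex.norm_exp_ofReal_mul_I]

theorem circleExp_pi : (Circle.exp Real.pi : ℂ) = -(Circle.exp 0 : ℂ) := by
  simp [Circle.coe_exp]

theorem circleExp_add_pi (θ : ℝ) :
    (Circle.exp (θ + Real.pi) : ℂ) = -(Circle.exp θ : ℂ) := by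
  simp [Circle.coe_exp]

/-- Passing to the antipode twice returns to the starting point, so `g π * g 0` is in the kernel of
the double cover. -/
theorem exists_hasClutching (hP : IsPrincipalBundle SO3 proj) :
    HasClutching proj 1 ∨ HasClutching proj (-1) := by
  obtain ⟨s, hs⟩ := exists_disc_section hP
  obtain ⟨g, hg, hgs⟩ := hP.exists_div (S := Set.univ)
    (a := fun θ : ℝ => s (Circle.exp θ : ℂ)) (b := fun θ : ℝ => s (-(Circle.exp θ : ℂ)))
    (by fun_prop) (by fun_prop)
    (fun θ _ => by rw [hs, hs, discToRP2_neg (norm_circleExp θ)])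
  obtain ⟨γ, hγ⟩ := exists_lift_S3 (continuousOn_univ.1 hg)
  have h1 : ∀ θ : ℝ, s (-(Circle.exp θ : ℂ)) = rot (γ θ) • s (Circle.exp θ : ℂ) := fun θ => by
    rw [hγ]; exact hgs θ trivial
  have h2 : rot (γ Real.pi * γ 0) = 1 := by
    refine hP.smul_right_injective (s (Circle.exp 0 : ℂ)) ?_
    simp only
    rw [map_mul, mul_smul, ← h1, ← circleExp_pi, ← h1, circleExp_pi, neg_neg, one_smul]
  rcases (rot_eq_one_iff _).1 h2 with h | h
  · exact .inl ⟨s, γ, hs, h1, h⟩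
  · exact .inr ⟨s, γ, hs, h1, h⟩

theorem exists_circle_map {κ : ℝ → S3} (hκ : Continuous κ) (h : κ 0 = κ (2 * Real.pi)) :
    ∃ f : C(Circle, S3), ∀ θ ∈ Set.Icc 0 (2 * Real.pi), f (Circle.exp θ) = κ θ := by
  have : Fact (0 < 2 * Real.pi) := ⟨Real.two_pi_pos⟩
  have hc : Continuous (AddCircle.liftIco (2 * Real.pi) 0 κ) :=
    AddCircle.liftIco_continuous (by simpa using h) hκ.continuousOn
  have key : ∀ θ ∈ Set.Ico 0 (2 * Real.pi), AddCircle.liftIco (2 * Real.pi) 0 κ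
      (AddCircle.homeomorphCircle'.symm (Circle.exp θ)) = κ θ := fun θ hθ => by
    rw [← AddCircle.homeomorphCircle'_apply_mk, Homeomorph.symm_apply_apply]
    exact AddCircle.liftIco_coe_apply (by simpa using hθ)
  refine ⟨⟨_, hc.comp AddCircle.homeomorphCircle'.symm.continuous⟩, fun θ hθ => ?_⟩
  rcases hθ.2.lt_or_eq with h' | h'
  · exact key θ ⟨hθ.1, h'⟩
  · subst h'
    rw [← h, ← key 0 ⟨le_rfl, Real.two_pi_pos⟩, Circle.exp_two_pi, Circle.exp_zero]
    rfl

/-- Bundles with the same obstruction are isomorphic. -/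
theorem HasClutching.iso (hP : IsPrincipalBundle SO3 proj) (hP' : IsPrincipalBundle SO3 proj')
    {ε : S3} (h : HasClutching proj ε) (h' : HasClutching proj' ε) :
    PrincipalBundleIso SO3 proj proj' := by
  obtain ⟨s, g, hs, hsg, hg⟩ := h
  obtain ⟨s', g', hs', hsg', hg'⟩ := h'
  have hπ := Real.pi_pos
  -- For `s` and `F • s'` to have the same clutching path, `F` has to satisfy `F(-e^{iθ}) = g θ *
  -- F(e^{iθ}) * (g' θ)⁻¹` for `θ` in `[0, π]`. So `κ` is any path from 1 to `g 0 * (g' 0)⁻¹` on the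
  -- first half circle and is given by this rule on the second. Equality of the obstructions is what
  -- makes it close up at `2π`.
  let γ : Path (1 : S3) (g 0 * (g' 0)⁻¹) := PathConnectedSpace.somePath _ _
  let κ : ℝ → S3 := fun θ => if θ ≤ Real.pi then γ.extend (θ / Real.pi) else
    g (θ - Real.pi) * γ.extend (θ / Real.pi - 1) * (g' (θ - Real.pi))⁻¹
  have hκ : Continuous κ := by
    refine Continuous.if_le ?_ ?_ continuous_id continuous_const ?_
    · exact γ.continuous_extend.comp (continuous_id.div_const _)
    · refine ((g.continuous.comp (by fun_prop)).mul
        (γ.continuous_extend.comp (by fun_prop))).mul (g'.continuous.comp (by fun_prop)).inv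
    · rintro x rfl
      simp [hπ.ne']
  have hκ1 : ∀ θ ∈ Set.Icc 0 Real.pi, κ (θ + Real.pi) = g θ * κ θ * (g' θ)⁻¹ := by
    rintro θ ⟨h0, h1⟩
    have e1 : κ θ = γ.extend (θ / Real.pi) := if_pos h1
    rcases h0.eq_or_lt with rfl | h0
    · have e2 : κ (0 + Real.pi) = γ.extend ((0 + Real.pi) / Real.pi) := if_pos (by simp)
      rw [e1, e2]
      simp [hπ.ne']
    · have e2 : κ (θ + Real.pi) = _ := if_neg (by linarith)
      rw [e1, e2, add_sub_cancel_right]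
      congr 3
      field_simp
      ring
  have hκ2 : κ 0 = κ (2 * Real.pi) := by
    have h1 : κ 0 = 1 := by
      have : κ 0 = γ.extend (0 / Real.pi) := if_pos hπ.le
      simpa using this
    have h2 := hκ1 Real.pi ⟨hπ.le, le_rfl⟩
    have h3 := hκ1 0 ⟨le_rfl, hπ.le⟩
    rw [zero_add] at h3
    rw [two_mul, h2, h3, h1, mul_one, ← mul_assoc, hg, mul_assoc, ← mul_inv_rev, hg',
      mul_inv_cancel]
  obtain ⟨f, hf⟩ := exists_circle_map hκ hκ2
  obtain ⟨F, hF⟩ := exists_extension_of_circle_to_S3 f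
  have hFκ : ∀ θ ∈ Set.Icc 0 (2 * Real.pi), F (Circle.exp θ : ℂ) = κ θ := fun θ hθ => by
    rw [hF, hf θ hθ]
  let t : ℂ → P' := fun z => rot (F z) • s' z
  have ht : Continuous t := hP'.continuous_smul.comp
    ((continuous_rot.comp F.continuous).prodMk s'.continuous)
  have htg : ∀ θ ∈ Set.Icc 0 Real.pi,
      t (-(Circle.exp θ : ℂ)) = rot (g θ) • t (Circle.exp θ : ℂ) := by
    rintro θ ⟨h0, h1⟩
    simp only [t]
    rw [← circleExp_add_pi, hFκ _ ⟨by linarith, by linarith⟩, hκ1 θ ⟨h0, h1⟩, circleExp_add_pi,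
      hsg', hFκ _ ⟨by linarith, by linarith⟩, ← mul_smul, ← mul_smul, ← map_mul, ← map_mul,
      inv_mul_cancel_right]
  refine hP.iso_of_compatible_lifts hP' (K := Metric.closedBall (0 : ℂ) 1)
    (q := fun z => discToRP2 z) (s := fun z => s z) (s' := fun z => t z) ?_ (by fun_prop)
    (by fun_prop) (fun z => hs z) (fun z => by simp only [t]; rw [hP'.proj_smul, hs']) ?_
  · intro x
    obtain ⟨z, hz, rfl⟩ := exists_discToRP2_eq x
    exact ⟨⟨z, by simpa using hz⟩, rfl⟩
  · have key : ∀ θ ∈ Set.Icc 0 Real.pi, ∀ h : SO3,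
        s (-(Circle.exp θ : ℂ)) = h • s (Circle.exp θ : ℂ) →
        t (-(Circle.exp θ : ℂ)) = h • t (Circle.exp θ : ℂ) := fun θ hθ h hh => by
      rw [htg θ hθ]
      congr 1
      exact hP.smul_right_injective (s (Circle.exp θ : ℂ)) ((hsg θ).symm.trans hh)
    rintro ⟨z, hz⟩ ⟨w, hw⟩ h hh
    simp only at hh ⊢
    have hqq : discToRP2 z = discToRP2 w := by rw [← hs, ← hs, hh, hP.proj_smul]
    rcases eq_or_eq_neg_of_discToRP2_eq (by simpa using hz) (by simpa using hw) hqq with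
      rfl | ⟨rfl, hz1⟩
    · have : h = 1 := hP.smul_right_injective (s w) (hh.symm.trans (one_smul _ _).symm)
      rw [this, one_smul]
    · have hzarg : (Circle.exp z.arg : ℂ) = z := by
        rw [Circle.coe_exp]
        simpa [hz1] using Complex.norm_mul_exp_arg_mul_I z
      rcases le_or_gt 0 z.arg with ha | ha
      · have := key z.arg ⟨ha, Complex.arg_le_pi z⟩ h
        rw [hzarg] at this
        exact this hh
      · have := key (z.arg + Real.pi) ⟨by linarith [Complex.neg_pi_lt_arg z], by linarith⟩ h⁻¹
        rw [circleExp_add_pi, hzarg, neg_neg, hh, inv_smul_smul] at this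
        rw [this rfl, smul_inv_smul]

/-- A trivialization turns the section over the disc into a map to `SO(3)`, which lifts to a map `F`
to `S³`. The element `F(-x) * F(x)⁻¹ * (g θ)⁻¹`, with `x = e^{iθ}`, lies in the kernel of the double
cover and is therefore constant. Comparing `θ = 0` with `θ = π`, where `x` and `-x` are exchanged,
would give `g π * g 0 = 1`. -/
theorem HasClutching.not_trivial (h : HasClutching proj (-1)) :
    ¬ IsTrivialPrincipalBundle SO3 proj := by
  rintro ⟨φ, -, hφ⟩
  obtain ⟨s, g, -, hsg, hg⟩ := h
  obtain ⟨F, hF⟩ := exists_lift_S3 (f := fun z : ℂ => (φ (s z)).2) (by fun_prop)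
  have h1 : ∀ θ : ℝ, rot (F (-(Circle.exp θ : ℂ))) = rot (g θ * F (Circle.exp θ : ℂ)) :=
    fun θ => by rw [map_mul, hF, hF, hsg, hφ]
  let u : ℝ → S3 := fun θ => F (-(Circle.exp θ : ℂ)) * (F (Circle.exp θ : ℂ))⁻¹ * (g θ)⁻¹
  have hu : Continuous u := by fun_prop
  have hu1 : u Real.pi = u 0 := by
    refine isCoveringMap_rot.const_of_comp hu (fun a a' => ?_) _ _
    simp only [u, map_mul, h1, map_inv]
    group
  simp only [u, circleExp_pi, neg_neg] at hu1
  set A := F (-(Circle.exp 0 : ℂ))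
  set C := F (Circle.exp 0 : ℂ)
  have hA : A * C⁻¹ * (g 0)⁻¹ = 1 ∨ A * C⁻¹ * (g 0)⁻¹ = -1 := by
    refine (rot_eq_one_iff _).1 ?_
    rw [map_mul, map_mul, map_inv, map_inv, h1, map_mul, mul_inv_cancel_right, mul_inv_cancel]
  have hne : (-1 : S3) ≠ 1 := fun h => by
    have h1 : -(1 : ℝ) = 1 := congrArg (fun q : S3 => q.1.re) h
    norm_num at h1
  have h2 : C * A⁻¹ = (A * C⁻¹ * (g 0)⁻¹) * g Real.pi := by
    rw [← hu1, inv_mul_cancel_right]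
  have h3 : A * C⁻¹ = (A * C⁻¹ * (g 0)⁻¹) * g 0 := by rw [inv_mul_cancel_right]
  have h4 : (A * C⁻¹ * (g 0)⁻¹) * g Real.pi * ((A * C⁻¹ * (g 0)⁻¹) * g 0) = 1 := by
    rw [← h2, ← h3]; group
  rcases hA with hA | hA
  · rw [hA, one_mul, one_mul, hg] at h4
    exact hne h4
  · rw [hA] at h4
    refine hne (hg.symm.trans (Eq.trans (Subtype.ext ?_) h4))
    simp

/-- The left translation action on a product. -/
abbrev prodAction (B G : Type*) [Group G] : MulAction G (B × G) where
  smul g x := (x.1, g * x.2)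
  one_smul _ := Prod.ext rfl (one_mul _)
  mul_smul _ _ _ := Prod.ext rfl (mul_assoc _ _ _)

/-- The constant section of the product bundle has constant clutching path 1. -/
theorem HasClutching.trivial (hP : IsPrincipalBundle SO3 proj) (h : HasClutching proj 1) :
    IsTrivialPrincipalBundle SO3 proj := by
  let _ := prodAction RP2 SO3
  have hprod : IsPrincipalBundle SO3 (Prod.fst : RP2 × SO3 → RP2) := by
    refine ⟨?_, fun g p => rfl, fun b => ⟨⟨OpenPartialHomeomorph.refl _, Set.univ, isOpen_univ,
      rfl, (by simp), fun p _ => rfl⟩, Set.mem_univ b, fun p _ g => rfl⟩⟩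
    exact (continuous_fst.comp continuous_snd).prodMk
      (continuous_fst.mul (continuous_snd.comp continuous_snd))
  have hc : HasClutching (Prod.fst : RP2 × SO3 → RP2) 1 := by
    refine ⟨⟨fun z => (discToRP2 z, 1), continuous_discToRP2.prodMk continuous_const⟩,
      .const _ 1, fun z => rfl, fun θ => ?_, mul_one _⟩
    refine Prod.ext (discToRP2_neg (norm_circleExp θ)) ?_
    change (1 : SO3) = rot 1 * 1
    simp
  obtain ⟨φ, h1, h2⟩ := h.iso hP hprod hc
  exact ⟨φ, h1, h2⟩

end Clutching

/-! ### Frames of complexified real planes -/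

section Frames

open Quaternion Matrix

/-- Pairs of vectors of `ℂ³`, as the rows of a matrix. -/
abbrev Mat23 : Type := Matrix (Fin 2) (Fin 3) ℂ

/-- The complex `2 × 2` matrix of a quaternion; unit quaternions give `SU(2)`. -/
def quatMat (q : ℍ[ℝ]) : Matrix (Fin 2) (Fin 2) ℂ :=
  !![⟨q.re, q.imI⟩, ⟨q.imJ, q.imK⟩; ⟨-q.imJ, q.imK⟩, ⟨q.re, -q.imI⟩]

theorem quatMat_mul (p q : ℍ[ℝ]) : quatMat (p * q) = quatMat p * quatMat q := by
  ext i j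
  fin_cases i <;> fin_cases j <;> apply Complex.ext <;>
    simp [quatMat, Matrix.mul_apply, Fin.sum_univ_two] <;> ring

theorem quatMat_one : quatMat 1 = 1 := by
  ext i j
  fin_cases i <;> fin_cases j <;> apply Complex.ext <;> simp [quatMat]

theorem quatMat_neg (q : ℍ[ℝ]) : quatMat (-q) = -quatMat q := by
  ext i j
  fin_cases i <;> fin_cases j <;> apply Complex.ext <;> simp [quatMat]

theorem quatMat_injective : Function.Injective quatMat := fun p q h => by
  have h0 := congrFun (congrFun h 0) 0
  have h1 := congrFun (congrFun h 0) 1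
  exact Quaternion.ext _ _ (congrArg Complex.re h0) (congrArg Complex.im h0)
    (congrArg Complex.re h1) (congrArg Complex.im h1)

theorem quatMat_mul_conjTranspose (q : ℍ[ℝ]) :
    quatMat q * (quatMat q)ᴴ =
      ((q.re ^ 2 + q.imI ^ 2 + q.imJ ^ 2 + q.imK ^ 2 : ℝ) : ℂ) •
        (1 : Matrix (Fin 2) (Fin 2) ℂ) := by
  ext i j
  fin_cases i <;> fin_cases j <;> apply Complex.ext <;>
    simp [quatMat, Matrix.mul_apply, Fin.sum_univ_two, pow_two] <;> ring

theorem quatMat_det (q : ℍ[ℝ]) :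
    (quatMat q).det = ((q.re ^ 2 + q.imI ^ 2 + q.imJ ^ 2 + q.imK ^ 2 : ℝ) : ℂ) := by
  apply Complex.ext <;> simp [quatMat, Matrix.det_fin_two, pow_two] <;> ring

theorem quatMat_S3_det (q : S3) : (quatMat q.1).det = 1 := by
  rw [quatMat_det, S3.normSq_eq, Complex.ofReal_one]

theorem continuous_quatMat : Continuous quatMat := by
  have h : ∀ a b : ℍ[ℝ] → ℝ, Continuous a → Continuous b →
      Continuous fun q => (⟨a q, b q⟩ : ℂ) := fun a b ha hb =>
    Complex.equivRealProdCLM.symm.continuous.comp (ha.prodMk hb)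
  refine continuous_matrix fun i j => ?_
  fin_cases i <;> fin_cases j
  · exact h _ _ continuous_re continuous_imI
  · exact h _ _ continuous_imJ continuous_imK
  · exact h _ _ continuous_imJ.neg continuous_imK
  · exact h _ _ continuous_re continuous_imI.neg

/-- A multiple of a unitary `2 × 2` matrix is a multiple of a unit quaternion. -/
theorem exists_eq_smul_quatMat {B : Matrix (Fin 2) (Fin 2) ℂ} {r : ℝ} (hr : 0 < r)
    (hB : B * Bᴴ = (r : ℂ) • 1) : ∃ (l : ℂ) (q : S3), l ≠ 0 ∧ B = l • quatMat q.1 := by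
  have hdet : B.det * star B.det = (r : ℂ) ^ 2 := by
    have := congrArg Matrix.det hB
    simpa [Matrix.det_mul, Matrix.det_conjTranspose, Matrix.det_smul] using this
  -- Dividing by a square root of the determinant gives a matrix in `SU(2)`. There the adjugate is
  -- the conjugate transpose, which forces the shape of `quatMat`.
  obtain ⟨l, hl⟩ := IsAlgClosed.exists_pow_nat_eq B.det (n := 2) two_pos
  have hnl : ‖l‖ ^ 2 = r := by
    have h1 : ‖B.det‖ ^ 2 = r ^ 2 := by
      have := congrArg norm hdet
      simpa [pow_two, abs_of_pos hr] using this
    have h2 : ‖B.det‖ = ‖l‖ ^ 2 := by rw [← hl, norm_pow]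
    rw [h2] at h1
    exact (pow_left_inj₀ (by positivity) hr.le two_ne_zero).1 h1
  have hl0 : l ≠ 0 := by
    rintro rfl
    simp at hnl
    exact hr.ne hnl
  have hll : l * star l = r := by
    have : l * star l = ((Complex.normSq l : ℝ) : ℂ) := Complex.mul_conj l
    rw [this, Complex.normSq_eq_norm_sq, hnl]
  have hsl0 : star l ≠ 0 := by simpa using hl0
  set C := l⁻¹ • B with hC
  have hBC : B = l • C := by rw [hC, smul_smul, mul_inv_cancel₀ hl0, one_smul]
  have hCC : C * Cᴴ = 1 := by
    rw [hC, Matrix.conjTranspose_smul, Matrix.smul_mul, Matrix.mul_smul, hB, smul_smul, smul_smul,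
      star_inv₀, ← mul_inv, hll, inv_mul_cancel₀ (by exact_mod_cast hr.ne'), one_smul]
  have hCd : C.det = 1 := by
    rw [hC, Matrix.det_smul, Fintype.card_fin, ← hl, inv_pow, inv_mul_cancel₀ (pow_ne_zero 2 hl0)]
  have hadj : C.adjugate = Cᴴ := by
    have h : C.adjugate = (C.adjugate * C) * Cᴴ := by rw [mul_assoc, hCC, mul_one]
    rw [h, Matrix.adjugate_mul, hCd, one_smul, one_mul]
  rw [Matrix.adjugate_fin_two] at hadj
  have h00 : C 1 1 = star (C 0 0) := congrFun (congrFun hadj 0) 0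
  have h01 : -C 0 1 = star (C 1 0) := congrFun (congrFun hadj 0) 1
  have h10 : C 1 0 = -star (C 0 1) := by rw [← star_star (C 1 0), ← h01, star_neg]
  have hq : quatMat (quat (C 0 0).re (C 0 0).im (C 0 1).re (C 0 1).im) = C := by
    ext i j
    fin_cases i <;> fin_cases j <;> simp [quatMat, h00, h10] <;> apply Complex.ext <;> simp
  have hn : quat (C 0 0).re (C 0 0).im (C 0 1).re (C 0 1).im ∈ Metric.sphere (0 : ℍ[ℝ]) 1 := by
    rw [mem_S3_iff]
    have := quatMat_det (quat (C 0 0).re (C 0 0).im (C 0 1).re (C 0 1).im)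
    rw [hq, hCd] at this
    exact_mod_cast this.symm
  exact ⟨l, ⟨_, hn⟩, hl0, by rw [hq, hBC]⟩

/-- Both determinants are 1, so the scalar has square 1. -/
theorem eq_or_eq_neg_of_quatMat_eq_smul {p q : S3} {l : ℂ} (h : quatMat p.1 = l • quatMat q.1) :
    p = q ∨ p = -q := by
  have hd := congrArg Matrix.det h
  rw [Matrix.det_smul, quatMat_S3_det, quatMat_S3_det, Fintype.card_fin, mul_one] at hd
  have hl : (l - 1) * (l + 1) = 0 := by linear_combination -hd
  rcases mul_eq_zero.1 hl with hl | hl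
  · left
    rw [sub_eq_zero.1 hl, one_smul] at h
    exact Subtype.ext (quatMat_injective h)
  · right
    rw [eq_neg_of_add_eq_zero_left hl, neg_smul, one_smul, ← quatMat_neg] at h
    exact Subtype.ext (quatMat_injective h)

/-- The complexification of a real vector. -/
def cvec (n : Fin 3 → ℝ) : Fin 3 → ℂ := fun i => (n i : ℂ)

/-- The rows of `X` are orthogonal, of the same positive length, and span the complexification of
the real plane orthogonal to `n`. -/
def IsFrameOf (X : Mat23) (n : Fin 3 → ℝ) : Prop :=
  n ≠ 0 ∧ X *ᵥ cvec n = 0 ∧ ∃ r : ℝ, 0 < r ∧ X * Xᴴ = (r : ℂ) • 1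

theorem sum_sq_pos {n : Fin 3 → ℝ} (hn : n ≠ 0) : 0 < n 0 ^ 2 + n 1 ^ 2 + n 2 ^ 2 := by
  by_contra hle
  refine hn (funext fun i => ?_)
  have h0 : n 0 = 0 := by nlinarith [sq_nonneg (n 0), sq_nonneg (n 1), sq_nonneg (n 2)]
  have h1 : n 1 = 0 := by nlinarith [sq_nonneg (n 0), sq_nonneg (n 1), sq_nonneg (n 2)]
  have h2 : n 2 = 0 := by nlinarith [sq_nonneg (n 0), sq_nonneg (n 1), sq_nonneg (n 2)]
  fin_cases i <;> assumption

/-- Adding the normal, scaled to length `√r`, as a third row gives a square matrix `Z` with `Z Zᴴ =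
r`. Then `Zᴴ Z = r` as well, and the contribution of the third row is the rank-one term. -/
theorem IsFrameOf.conjTranspose_mul {X : Mat23} {n : Fin 3 → ℝ} {r : ℝ} (hn : n ≠ 0)
    (hXn : X *ᵥ cvec n = 0) (hr : 0 < r) (hX : X * Xᴴ = (r : ℂ) • 1) :
    Xᴴ * X = (r : ℂ) • (1 : Matrix (Fin 3) (Fin 3) ℂ) -
      ((r / (n 0 ^ 2 + n 1 ^ 2 + n 2 ^ 2) : ℝ) : ℂ) • vecMulVec (cvec n) (cvec n) := by
  have hN := sum_sq_pos hn
  set N := n 0 ^ 2 + n 1 ^ 2 + n 2 ^ 2 with hNdef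
  set s := √(r / N) with hs
  have hs2 : s * s = r / N := Real.mul_self_sqrt (by positivity)
  let Z : Matrix (Fin 3) (Fin 3) ℂ := Matrix.of ![X 0, X 1, (s : ℂ) • cvec n]
  have e0 := congrFun hXn 0
  have e1 := congrFun hXn 1
  simp only [Matrix.mulVec, dotProduct, Fin.sum_univ_three, cvec, Pi.zero_apply] at e0 e1
  have f00 := congrFun (congrFun hX 0) 0
  have f01 := congrFun (congrFun hX 0) 1
  have f10 := congrFun (congrFun hX 1) 0
  have f11 := congrFun (congrFun hX 1) 1
  simp [Matrix.mul_apply, Fin.sum_univ_three] at f00 f01 f10 f11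
  have e0' := congrArg (starRingEnd ℂ) e0
  have e1' := congrArg (starRingEnd ℂ) e1
  simp only [map_add, map_mul, Complex.conj_ofReal, map_zero] at e0' e1'
  have hsN : (s : ℂ) * s * (n 0 ^ 2 + n 1 ^ 2 + n 2 ^ 2) = r := by
    have : s * s * N = r := by rw [hs2]; field_simp
    rw [hNdef] at this
    exact_mod_cast this
  have hZ : Z * Zᴴ = (r : ℂ) • 1 := by
    ext i j
    fin_cases i <;> fin_cases j <;>
      simp [Z, Matrix.mul_apply, Fin.sum_univ_three, cvec, f00, f01, f10, f11]
    · linear_combination (s : ℂ) * e0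
    · linear_combination (s : ℂ) * e1
    · linear_combination (s : ℂ) * e0'
    · linear_combination (s : ℂ) * e1'
    · linear_combination hsN
  have hrC : (r : ℂ) ≠ 0 := by exact_mod_cast hr.ne'
  have hZ' : Zᴴ * Z = (r : ℂ) • 1 := by
    have h1 : Z * ((r : ℂ)⁻¹ • Zᴴ) = 1 := by
      rw [Matrix.mul_smul, hZ, smul_smul, inv_mul_cancel₀ hrC, one_smul]
    have h2 := mul_eq_one_comm.1 h1
    rw [Matrix.smul_mul] at h2
    rw [← h2, smul_smul, mul_inv_cancel₀ hrC, one_smul]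
  rw [← hZ', ← hs2]
  ext i j
  simp [Z, Matrix.mul_apply, Fin.sum_univ_three, Fin.sum_univ_two, vecMulVec_apply, cvec]
  ring

/-- The change of frame is `Y Xᴴ / r`, a multiple of a unitary matrix. Hence `SO(3)` is transitive
on the frames of a fixed plane modulo scalars. -/
theorem IsFrameOf.exists_eq_smul {X Y : Mat23} {n : Fin 3 → ℝ} (hX : IsFrameOf X n)
    (hY : IsFrameOf Y n) : ∃ (l : ℂ) (q : S3), l ≠ 0 ∧ Y = l • (quatMat q.1 * X) := by
  obtain ⟨hn, hXn, r, hr, hXr⟩ := hX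
  obtain ⟨-, hYn, t, ht, hYt⟩ := hY
  have hXX := IsFrameOf.conjTranspose_mul hn hXn hr hXr
  have hrC : (r : ℂ) ≠ 0 := by exact_mod_cast hr.ne'
  set B := (r : ℂ)⁻¹ • (Y * Xᴴ) with hB
  have hBX : B * X = Y := by
    rw [hB, Matrix.smul_mul, Matrix.mul_assoc, hXX, Matrix.mul_sub, Matrix.mul_smul, Matrix.mul_one,
      Matrix.mul_smul, Matrix.mul_vecMulVec, hYn, Matrix.zero_vecMulVec, smul_zero, sub_zero,
      smul_smul, inv_mul_cancel₀ hrC, one_smul]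
  have hBB : B * Bᴴ = ((t / r : ℝ) : ℂ) • 1 := by
    have h1 : B * Bᴴ = (r : ℂ)⁻¹ • (B * X * Yᴴ) := by
      rw [hB, Matrix.conjTranspose_smul, Matrix.conjTranspose_mul,
        Matrix.conjTranspose_conjTranspose,
        Matrix.mul_smul, Matrix.mul_assoc]
      simp
    rw [h1, hBX, hYt, smul_smul]
    push_cast
    rw [div_eq_inv_mul]
  obtain ⟨l, q, hl, h⟩ := exists_eq_smul_quatMat (by positivity) hBB
  exact ⟨l, q, hl, by rw [← hBX, h, Matrix.smul_mul]⟩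

/-- By `IsFrameOf.conjTranspose_mul`, `Xᴴ X` is a multiple of the projection along `n`, so its real
kernel is the line of `n`. -/
theorem IsFrameOf.normal_unique {X : Mat23} {n m : Fin 3 → ℝ} (hX : IsFrameOf X n)
    (hm : X *ᵥ cvec m = 0) : ∃ a : ℝ, a • n = m := by
  obtain ⟨hn, hXn, r, hr, hXr⟩ := hX
  have hXX := IsFrameOf.conjTranspose_mul hn hXn hr hXr
  have h := congrArg (fun A => A *ᵥ cvec m) hXX
  beta_reduce at h
  rw [← Matrix.mulVec_mulVec, hm, Matrix.mulVec_zero, Matrix.sub_mulVec, Matrix.smul_mulVec,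
    Matrix.one_mulVec, Matrix.smul_mulVec, Matrix.vecMulVec_mulVec] at h
  have hN := sum_sq_pos hn
  refine ⟨(n 0 * m 0 + n 1 * m 1 + n 2 * m 2) / (n 0 ^ 2 + n 1 ^ 2 + n 2 ^ 2), funext fun i => ?_⟩
  have hi := congrFun h i
  simp [cvec, dotProduct, Fin.sum_univ_three] at hi
  have hi' : 0 = r * m i - r / (n 0 ^ 2 + n 1 ^ 2 + n 2 ^ 2) *
      (n i * (n 0 * m 0 + n 1 * m 1 + n 2 * m 2)) := by exact_mod_cast hi
  simp only [Pi.smul_apply, smul_eq_mul]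
  field_simp at hi' ⊢
  rw [zero_mul] at hi'
  rcases mul_eq_zero.1 hi'.symm with h | h
  · exact absurd h hr.ne'
  · linarith

end Frames

/-! ### Rational maps as nondegenerate pairs of vectors, and the action of pairs of rotations -/

section FrameSpace

open Quaternion Matrix

/-- The cross product of the two rows. -/
def normalVec (X : Mat23) : Fin 3 → ℂ :=
  ![X 0 1 * X 1 2 - X 0 2 * X 1 1, X 0 2 * X 1 0 - X 0 0 * X 1 2, X 0 0 * X 1 1 - X 0 1 * X 1 0]

/-- The determinant of the (bilinear) Gram matrix of the two rows. -/
def gramDet (X : Mat23) : ℂ := normalVec X ⬝ᵥ normalVec X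

theorem gramDet_eq (X : Mat23) : gramDet X = (X 0 1 * X 1 2 - X 0 2 * X 1 1) ^ 2 +
    (X 0 2 * X 1 0 - X 0 0 * X 1 2) ^ 2 + (X 0 0 * X 1 1 - X 0 1 * X 1 0) ^ 2 := by
  simp [gramDet, normalVec, dotProduct, Fin.sum_univ_three]
  ring

/-- The pair of quadratic polynomials whose coefficient vectors, in the basis of `ℂ³` in which the
discriminant is the sum of the squares of the coordinates, are the rows of a matrix. -/
noncomputable def coeffs : Mat23 ≃ₗ[ℂ] (Fin 6 → ℂ) where
  toFun X := ![(X 0 1 - Complex.I * X 0 2) / 2, X 0 0, (-X 0 1 - Complex.I * X 0 2) / 2,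
    (X 1 1 - Complex.I * X 1 2) / 2, X 1 0, (-X 1 1 - Complex.I * X 1 2) / 2]
  invFun c := !![c 1, c 0 - c 2, Complex.I * (c 0 + c 2);
    c 4, c 3 - c 5, Complex.I * (c 3 + c 5)]
  map_add' X Y := by ext i; fin_cases i <;> simp <;> ring
  map_smul' a X := by ext i; fin_cases i <;> simp <;> ring
  left_inv X := by
    have hI : Complex.I * Complex.I = -1 := Complex.I_mul_I
    ext i j
    fin_cases i <;> fin_cases j <;> simp <;> ring_nf <;> simp
  right_inv c := by
    have hI : Complex.I * Complex.I = -1 := Complex.I_mul_I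
    ext i
    fin_cases i <;> simp
    · linear_combination -((c 0 + c 2) / 2) * hI
    · linear_combination -((c 0 + c 2) / 2) * hI
    · linear_combination -((c 3 + c 5) / 2) * hI
    · linear_combination -((c 3 + c 5) / 2) * hI

theorem coeffs_apply (X : Mat23) : coeffs X =
    ![(X 0 1 - Complex.I * X 0 2) / 2, X 0 0, (-X 0 1 - Complex.I * X 0 2) / 2,
    (X 1 1 - Complex.I * X 1 2) / 2, X 1 0, (-X 1 1 - Complex.I * X 1 2) / 2] := rfl

theorem coeffs_symm_apply (c : Fin 6 → ℂ) : coeffs.symm c =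
    !![c 1, c 0 - c 2, Complex.I * (c 0 + c 2); c 4, c 3 - c 5, Complex.I * (c 3 + c 5)] := rfl

theorem continuous_coeffs : Continuous coeffs :=
  LinearMap.continuous_of_finiteDimensional coeffs.toLinearMap

theorem continuous_coeffs_symm : Continuous coeffs.symm :=
  LinearMap.continuous_of_finiteDimensional coeffs.symm.toLinearMap

/-- Two quadratic polynomials have a common root exactly when the discriminant form degenerates on
their span; this is the quantitative version. -/
theorem quadResultant_coeffs (X : Mat23) : quadResultant (coeffs X) = -(gramDet X) / 4 := by
  have hI : Complex.I ^ 2 = -1 := Complex.I_sq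
  rw [gramDet_eq]
  simp [quadResultant, coeffs_apply, Matrix.det_succ_row_zero, Fin.sum_univ_succ, Fin.succAbove]
  ring_nf
  simp [hI]
  ring

theorem gramDet_smul (a : ℂ) (X : Mat23) : gramDet (a • X) = a ^ 4 * gramDet X := by
  simp [gramDet_eq]; ring

theorem gramDet_mul_left (A : Matrix (Fin 2) (Fin 2) ℂ) (X : Mat23) :
    gramDet (A * X) = A.det ^ 2 * gramDet X := by
  simp [gramDet_eq, Matrix.det_fin_two, Matrix.mul_apply, Fin.sum_univ_two]; ring

theorem gramDet_eq_det (X : Mat23) : gramDet X = (X * Xᵀ).det := by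
  simp [gramDet_eq, Matrix.det_fin_two, Matrix.mul_apply, Fin.sum_univ_three]; ring

theorem continuous_gramDet : Continuous gramDet := by
  have : gramDet = fun X : Mat23 => (X * Xᵀ).det := funext gramDet_eq_det
  rw [this]
  fun_prop

/-- Pairs of rows spanning a plane on which the standard bilinear form is nondegenerate. -/
abbrev NondegPair : Type := {X : Mat23 // gramDet X ≠ 0}

theorem coeffs_ne_zero (X : NondegPair) : coeffs X.1 ≠ 0 := by
  intro h
  have h0 : X.1 = 0 := (LinearEquiv.map_eq_zero_iff coeffs).1 h
  refine X.2 ?_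
  rw [h0]
  simp [gramDet_eq]

/-- The quadratic rational map with the given pair of coefficient vectors. -/
noncomputable def ratMk (X : NondegPair) : Rat2 :=
  ⟨Projectivization.mk ℂ (coeffs X.1) (coeffs_ne_zero X), by
    rw [mk_mem_rat2Set_iff, quadResultant_coeffs]
    simpa using X.2⟩

theorem ratMk_eq_iff (X Y : NondegPair) : ratMk X = ratMk Y ↔ ∃ a : ℂ, a ≠ 0 ∧ Y.1 = a • X.1 := by
  rw [Subtype.ext_iff, eq_comm]
  change Projectivization.mk ℂ _ _ = Projectivization.mk ℂ _ _ ↔ _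
  rw [Projectivization.mk_eq_mk_iff']
  constructor
  · rintro ⟨a, ha⟩
    have h : Y.1 = a • X.1 := coeffs.injective (by rw [map_smul, ha])
    refine ⟨a, ?_, h⟩
    rintro rfl
    exact Y.2 (by rw [h]; simp [gramDet_eq])
  · rintro ⟨a, -, ha⟩
    exact ⟨a, by rw [ha, map_smul]⟩

/-- `coeffs` identifies nondegenerate pairs with an open set of nonzero vectors, and the projection
of nonzero vectors to projective space is open. -/
theorem isOpenQuotientMap_ratMk : IsOpenQuotientMap ratMk := by
  let ι : NondegPair → {v : Fin 6 → ℂ // v ≠ 0} := fun X => ⟨coeffs X.1, coeffs_ne_zero X⟩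
  have hι : Continuous ι := (continuous_coeffs.comp continuous_subtype_val).subtype_mk _
  have hopen : IsOpenMap ι := by
    intro U hU
    obtain ⟨V, hV, rfl⟩ := isOpen_induced_iff.1 hU
    have : ι '' (Subtype.val ⁻¹' V) =
        (fun v : {v : Fin 6 → ℂ // v ≠ 0} => coeffs.symm v.1) ⁻¹' (V ∩ {X | gramDet X ≠ 0}) := by
      ext v
      constructor
      · rintro ⟨X, hX, rfl⟩
        exact ⟨by simpa [ι] using hX, by simp [ι]⟩
      · rintro ⟨h1, h2⟩
        exact ⟨⟨_, h2⟩, h1, Subtype.ext (by simp [ι])⟩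
    rw [this]
    refine (hV.inter (isOpen_ne_fun continuous_gramDet continuous_const)).preimage ?_
    exact continuous_coeffs_symm.comp continuous_subtype_val
  refine ⟨?_, ?_, ?_⟩
  · rintro ⟨x, hx⟩
    induction x using Projectivization.ind with
    | h v hv =>
    have h : gramDet (coeffs.symm v) ≠ 0 := by
      have h1 := (mk_mem_rat2Set_iff v hv).1 hx
      rw [← coeffs.apply_symm_apply v, quadResultant_coeffs] at h1
      simpa using h1
    refine ⟨⟨coeffs.symm v, h⟩, Subtype.ext ?_⟩
    change Projectivization.mk ℂ _ _ = _
    simp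
  · exact (continuous_projMk.comp hι).subtype_mk _
  · intro U hU
    have h1 := isOpenQuotientMap_projMk.isOpenMap _ (hopen U hU)
    convert! h1.preimage (continuous_subtype_val (p := fun x => x ∈ rat2Set)) using 1
    ext x
    constructor
    · rintro ⟨X, hX, rfl⟩
      exact ⟨ι X, ⟨X, hX, rfl⟩, rfl⟩
    · rintro ⟨_, ⟨X, hX, rfl⟩, h⟩
      exact ⟨X, hX, Subtype.ext h⟩

theorem IsFrameOf.smul {X : Mat23} {n : Fin 3 → ℝ} (h : IsFrameOf X n) {a : ℂ} (ha : a ≠ 0) :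
    IsFrameOf (a • X) n := by
  obtain ⟨hn, hXn, r, hr, hXr⟩ := h
  refine ⟨hn, by rw [Matrix.smul_mulVec, hXn, smul_zero], ‖a‖ ^ 2 * r, by positivity, ?_⟩
  rw [Matrix.conjTranspose_smul, Matrix.smul_mul, Matrix.mul_smul, hXr, smul_smul, smul_smul]
  congr 1
  have : a * star a = ((Complex.normSq a : ℝ) : ℂ) := Complex.mul_conj a
  rw [this, Complex.normSq_eq_norm_sq]
  push_cast
  rfl

theorem IsFrameOf.quatMat_mul {X : Mat23} {n : Fin 3 → ℝ} (h : IsFrameOf X n) (q : S3) :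
    IsFrameOf (quatMat q.1 * X) n := by
  obtain ⟨hn, hXn, r, hr, hXr⟩ := h
  refine ⟨hn, by rw [← Matrix.mulVec_mulVec, hXn, Matrix.mulVec_zero], r, hr, ?_⟩
  rw [Matrix.conjTranspose_mul, Matrix.mul_assoc, ← Matrix.mul_assoc X, hXr, Matrix.smul_mul,
    Matrix.one_mul, Matrix.mul_smul, quatMat_mul_conjTranspose, S3.normSq_eq]
  simp

/-- A rotation as a complex matrix. -/
def cmat (R : SO3) : Matrix (Fin 3) (Fin 3) ℂ := R.1.map Complex.ofReal

theorem cmat_mul (R S : SO3) : cmat (R * S) = cmat R * cmat S :=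
  Matrix.map_mul (f := Complex.ofRealHom)

theorem cmat_one : cmat 1 = 1 := by
  simp [cmat]

theorem cmat_transpose_mul (R : SO3) : (cmat R)ᵀ * cmat R = 1 := by
  have h := congrArg (fun A => A.map Complex.ofRealHom) R.transpose_mul
  beta_reduce at h
  rw [Matrix.map_mul] at h
  exact h.trans (Matrix.map_one _ (map_zero _) (map_one _))

theorem cmat_transpose_conjTranspose (R : SO3) : (cmat R)ᵀᴴ = cmat R := by
  ext i j
  simp [cmat]

theorem cmat_mulVec (R : SO3) (n : Fin 3 → ℝ) : cmat R *ᵥ cvec n = cvec (R.1 *ᵥ n) := by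
  ext i
  simp [cmat, cvec, Matrix.mulVec, dotProduct]

theorem continuous_cmat : Continuous cmat :=
  Continuous.matrix_map continuous_subtype_val Complex.continuous_ofReal

/-- Post-composition with the rotation of a unit quaternion and pre-composition with a rotation. -/
def frameAct (k : S3 × SO3) (X : Mat23) : Mat23 := quatMat k.1.1 * X * (cmat k.2)ᵀ

theorem frameAct_mul (k l : S3 × SO3) (X : Mat23) :
    frameAct (k * l) X = frameAct k (frameAct l X) := by
  have : quatMat (k * l).1.1 = quatMat k.1.1 * quatMat l.1.1 := quatMat_mul _ _
  rw [frameAct, this, Prod.snd_mul, cmat_mul, Matrix.transpose_mul]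
  simp only [frameAct, Matrix.mul_assoc]

theorem frameAct_one (X : Mat23) : frameAct 1 X = X := by
  have : quatMat (1 : S3 × SO3).1.1 = 1 := quatMat_one
  rw [frameAct, this, Prod.snd_one, cmat_one, Matrix.transpose_one, Matrix.mul_one, Matrix.one_mul]

theorem frameAct_smul (k : S3 × SO3) (a : ℂ) (X : Mat23) :
    frameAct k (a • X) = a • frameAct k X := by
  simp [frameAct]

theorem gramDet_frameAct (k : S3 × SO3) (X : Mat23) : gramDet (frameAct k X) = gramDet X := by
  have h : gramDet (X * (cmat k.2)ᵀ) = gramDet X := by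
    rw [gramDet_eq_det, gramDet_eq_det, Matrix.transpose_mul, Matrix.transpose_transpose,
      Matrix.mul_assoc, ← Matrix.mul_assoc _ _ Xᵀ, cmat_transpose_mul, Matrix.one_mul]
  rw [frameAct, Matrix.mul_assoc, gramDet_mul_left, quatMat_S3_det, h]
  simp

theorem continuous_frameAct : Continuous fun x : (S3 × SO3) × Mat23 => frameAct x.1 x.2 := by
  have h1 : Continuous fun x : (S3 × SO3) × Mat23 => quatMat x.1.1.1 :=
    continuous_quatMat.comp (by fun_prop)
  have h2 : Continuous fun x : (S3 × SO3) × Mat23 => cmat x.1.2 :=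
    continuous_cmat.comp (by fun_prop)
  exact (h1.matrix_mul continuous_snd).matrix_mul h2.matrix_transpose

theorem IsFrameOf.frameAct {X : Mat23} {n : Fin 3 → ℝ} (h : IsFrameOf X n) (k : S3 × SO3) :
    IsFrameOf (frameAct k X) (k.2.1 *ᵥ n) := by
  have h1 : IsFrameOf (X * (cmat k.2)ᵀ) (k.2.1 *ᵥ n) := by
    obtain ⟨hn, hXn, r, hr, hXr⟩ := h
    refine ⟨fun h0 => hn ?_, ?_, r, hr, ?_⟩
    · rw [← Matrix.one_mulVec n, ← k.2.transpose_mul, ← Matrix.mulVec_mulVec, h0,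
        Matrix.mulVec_zero]
    · rw [← cmat_mulVec, Matrix.mulVec_mulVec, Matrix.mul_assoc, cmat_transpose_mul,
        Matrix.mul_one, hXn]
    · rw [Matrix.conjTranspose_mul, cmat_transpose_conjTranspose, Matrix.mul_assoc,
        ← Matrix.mul_assoc _ _ Xᴴ,
        cmat_transpose_mul, Matrix.one_mul, hXr]
  rw [_root_.frameAct, Matrix.mul_assoc]
  exact h1.quatMat_mul k.1

/-- The coordinate frame of the plane orthogonal to the third axis. -/
def baseFrame : Mat23 := !![1, 0, 0; 0, 1, 0]

theorem isFrameOf_baseFrame : IsFrameOf baseFrame ![0, 0, 1] := by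
  refine ⟨fun h => one_ne_zero (congrFun h 2), ?_, 1, one_pos, ?_⟩
  · ext i
    fin_cases i <;> simp [baseFrame, cvec, Matrix.mulVec, dotProduct, Fin.sum_univ_three]
  · ext i j
    fin_cases i <;> fin_cases j <;> simp [baseFrame, Matrix.mul_apply, Fin.sum_univ_three]

theorem gramDet_baseFrame : gramDet baseFrame = 1 := by
  simp [gramDet_eq, baseFrame]

/-- The quaternion of the shortest rotation taking the third axis to the unit vector `n`. -/
noncomputable def tilt (n : Fin 3 → ℝ) : ℍ[ℝ] :=
  quat ((1 + n 2) / √(2 * (1 + n 2))) (-n 1 / √(2 * (1 + n 2))) (n 0 / √(2 * (1 + n 2))) 0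

theorem tilt_mem {n : Fin 3 → ℝ} (hn : n 0 ^ 2 + n 1 ^ 2 + n 2 ^ 2 = 1) (h2 : 0 ≤ n 2) :
    tilt n ∈ Metric.sphere (0 : ℍ[ℝ]) 1 := by
  have hpos : 0 < 2 * (1 + n 2) := by linarith
  have hs2 : √(2 * (1 + n 2)) ^ 2 = 2 * (1 + n 2) := Real.sq_sqrt hpos.le
  have hs0 : √(2 * (1 + n 2)) ≠ 0 := (Real.sqrt_pos.2 hpos).ne'
  rw [mem_S3_iff, tilt]
  generalize √(2 * (1 + n 2)) = s at hs2 hs0 ⊢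
  simp only [quat_re, quat_imI, quat_imJ, quat_imK]
  field_simp
  rw [hs2]
  linarith

theorem rotMat_tilt_mulVec {n : Fin 3 → ℝ} (hn : n 0 ^ 2 + n 1 ^ 2 + n 2 ^ 2 = 1)
    (h2 : 0 ≤ n 2) : rotMat (tilt n) *ᵥ ![0, 0, 1] = n := by
  have hpos : 0 < 2 * (1 + n 2) := by linarith
  have hs2 : √(2 * (1 + n 2)) ^ 2 = 2 * (1 + n 2) := Real.sq_sqrt hpos.le
  have hs0 : √(2 * (1 + n 2)) ≠ 0 := (Real.sqrt_pos.2 hpos).ne'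
  rw [tilt]
  generalize √(2 * (1 + n 2)) = s at hs2 hs0 ⊢
  ext i
  fin_cases i <;> simp [rotMat, Matrix.mulVec, dotProduct, Fin.sum_univ_three] <;>
    field_simp <;> rw [hs2] <;> linarith

theorem exists_rotation_of_unit {n : Fin 3 → ℝ} (hn : n 0 ^ 2 + n 1 ^ 2 + n 2 ^ 2 = 1)
    (h2 : 0 ≤ n 2) : ∃ R : SO3, R.1 *ᵥ ![0, 0, 1] = n :=
  ⟨rot ⟨_, tilt_mem hn h2⟩, rotMat_tilt_mulVec hn h2⟩

theorem IsFrameOf.smul_normal {X : Mat23} {n : Fin 3 → ℝ} (h : IsFrameOf X n) {a : ℝ}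
    (ha : a ≠ 0) : IsFrameOf X (a • n) := by
  refine ⟨smul_ne_zero ha h.1, ?_, h.2.2⟩
  have : cvec (a • n) = (a : ℂ) • cvec n := by ext i; simp [cvec]
  rw [this, Matrix.mulVec_smul, h.2.1, smul_zero]

/-- A rotation takes the third axis to the unit normal, and frames with the same normal differ by a
scalar and a unit quaternion. The sign of `n` is chosen so that `tilt`, singular at the south pole,
applies. -/
theorem IsFrameOf.exists_frameAct {X : Mat23} {n : Fin 3 → ℝ} (h : IsFrameOf X n) :
    ∃ (k : S3 × SO3) (a : ℂ), a ≠ 0 ∧ X = a • _root_.frameAct k baseFrame := by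
  wlog h2 : 0 ≤ n 2 generalizing n
  · exact this (h.smul_normal (neg_ne_zero.2 one_ne_zero)) (by simp; linarith)
  have hN := sum_sq_pos h.1
  set N := n 0 ^ 2 + n 1 ^ 2 + n 2 ^ 2 with hNdef
  have hs0 : 0 < √N := Real.sqrt_pos.2 hN
  have hs2 : √N ^ 2 = N := Real.sq_sqrt hN.le
  obtain ⟨R, hR⟩ := exists_rotation_of_unit (n := (√N)⁻¹ • n) (by
    simp only [Pi.smul_apply, smul_eq_mul]
    field_simp
    rw [hs2]) (by simp; positivity)
  have h3 := isFrameOf_baseFrame.frameAct (1, R)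
  simp only [hR] at h3
  obtain ⟨l, q, hl, e⟩ := h3.exists_eq_smul (h.smul_normal (inv_ne_zero hs0.ne'))
  refine ⟨(q, R), l, hl, ?_⟩
  have : quatMat (1 : S3).1 = 1 := quatMat_one
  rw [e, _root_.frameAct, _root_.frameAct, this, Matrix.one_mul, Matrix.mul_assoc]

theorem IsFrameOf.gramDet_ne_zero {X : Mat23} {n : Fin 3 → ℝ} (h : IsFrameOf X n) :
    gramDet X ≠ 0 := by
  obtain ⟨k, a, ha, rfl⟩ := h.exists_frameAct
  rw [gramDet_smul, gramDet_frameAct, gramDet_baseFrame, mul_one]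
  exact pow_ne_zero 4 ha

end FrameSpace

/-! ### The compact space of frames and its projection to the projective plane -/

section FrameManifold

open Quaternion Matrix

/-- The rational maps `A ∘ (z ↦ z²) ∘ B` with `A` and `B` rotations of the sphere: those given by
pairs of orthogonal vectors of equal length spanning the complexification of a real plane. -/
def frameSet : Set Rat2 := {x | ∃ X : NondegPair, ratMk X = x ∧ ∃ n, IsFrameOf X.1 n}

/-- Matrices whose rows are a frame of the complexification of some real plane. -/
abbrev Frame : Type := {X : Mat23 // ∃ n, IsFrameOf X n}

theorem Frame.gramDet_ne_zero (X : Frame) : gramDet X.1 ≠ 0 :=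
  X.2.choose_spec.gramDet_ne_zero

/-- The rational map of a frame. -/
noncomputable def frameMk (X : Frame) : frameSet :=
  ⟨ratMk ⟨X.1, X.gramDet_ne_zero⟩, _, rfl, X.2⟩

theorem frameMk_eq_iff (X Y : Frame) : frameMk X = frameMk Y ↔ ∃ a : ℂ, a ≠ 0 ∧ Y.1 = a • X.1 := by
  rw [Subtype.ext_iff]
  exact ratMk_eq_iff _ _

theorem ratMk_mem_frameSet_iff (X : NondegPair) :
    ratMk X ∈ frameSet ↔ ∃ n, IsFrameOf X.1 n := by
  refine ⟨?_, fun h => ⟨X, rfl, h⟩⟩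
  rintro ⟨Y, h, n, hn⟩
  obtain ⟨a, ha, e⟩ := (ratMk_eq_iff _ _).1 h
  exact ⟨n, e ▸ hn.smul ha⟩

theorem isOpenQuotientMap_frameMk : IsOpenQuotientMap frameMk := by
  have hι : Continuous fun X : Frame => (⟨X.1, X.gramDet_ne_zero⟩ : NondegPair) :=
    continuous_subtype_val.subtype_mk _
  refine ⟨?_, ?_, ?_⟩
  · rintro ⟨_, X, rfl, h⟩
    exact ⟨⟨X.1, h⟩, rfl⟩
  · exact (isOpenQuotientMap_ratMk.continuous.comp hι).subtype_mk _
  · intro U hU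
    obtain ⟨V, hV, rfl⟩ := isOpen_induced_iff.1 hU
    have h1 := isOpenQuotientMap_ratMk.isOpenMap _ (hV.preimage continuous_subtype_val)
    convert! h1.preimage (continuous_subtype_val (p := fun x => x ∈ frameSet)) using 1
    ext x
    constructor
    · rintro ⟨X, hX, rfl⟩
      exact ⟨⟨X.1, X.gramDet_ne_zero⟩, hX, rfl⟩
    · rintro ⟨X, hX, h⟩
      exact ⟨⟨X.1, (ratMk_mem_frameSet_iff X).1 (h ▸ x.2)⟩, hX, Subtype.ext h⟩

theorem frameMk_surjective : Function.Surjective frameMk := isOpenQuotientMap_frameMk.surjective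

/-- The action of pairs of rotations on frames. -/
def Frame.act (k : S3 × SO3) (X : Frame) : Frame :=
  ⟨frameAct k X.1, _, X.2.choose_spec.frameAct k⟩

/-- The action of pairs of rotations on rational maps. -/
noncomputable def pairAct (k : S3 × SO3) (m : frameSet) : frameSet :=
  frameMk ((Function.surjInv frameMk_surjective m).act k)

theorem pairAct_frameMk (k : S3 × SO3) (X : Frame) : pairAct k (frameMk X) = frameMk (X.act k) := by
  obtain ⟨a, ha, e⟩ := (frameMk_eq_iff _ _).1
    (Function.surjInv_eq frameMk_surjective (frameMk X))
  refine (frameMk_eq_iff _ _).2 ⟨a, ha, ?_⟩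
  change frameAct k X.1 = a • frameAct k _
  rw [e, frameAct_smul]

theorem pairAct_mul (k l : S3 × SO3) (m : frameSet) :
    pairAct (k * l) m = pairAct k (pairAct l m) := by
  obtain ⟨X, rfl⟩ := frameMk_surjective m
  rw [pairAct_frameMk, pairAct_frameMk, pairAct_frameMk]
  exact congrArg frameMk (Subtype.ext (frameAct_mul k l X.1))

theorem pairAct_one (m : frameSet) : pairAct 1 m = m := by
  obtain ⟨X, rfl⟩ := frameMk_surjective m
  rw [pairAct_frameMk]
  exact congrArg frameMk (Subtype.ext (frameAct_one X.1))

theorem continuous_pairAct : Continuous fun x : (S3 × SO3) × frameSet => pairAct x.1 x.2 := by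
  refine (IsOpenQuotientMap.id.prodMap isOpenQuotientMap_frameMk).isQuotientMap.continuous_iff.2 ?_
  have : (fun x : (S3 × SO3) × frameSet => pairAct x.1 x.2) ∘ Prod.map id frameMk =
      fun x : (S3 × SO3) × Frame => frameMk (x.2.act x.1) := by
    funext x
    exact pairAct_frameMk _ _
  rw [this]
  have h1 : Continuous fun x : (S3 × SO3) × Frame => (x.1, x.2.1) := by fun_prop
  have h2 := continuous_frameAct.comp h1
  have h3 := isOpenQuotientMap_frameMk.continuous.comp (h2.subtype_mk fun x => (x.2.act x.1).2)
  exact h3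

theorem pairAct_neg (q : S3) (m : frameSet) : pairAct (-q, 1) m = pairAct (q, 1) m := by
  obtain ⟨X, rfl⟩ := frameMk_surjective m
  rw [pairAct_frameMk, pairAct_frameMk, eq_comm]
  refine (frameMk_eq_iff _ _).2 ⟨-1, by simp, ?_⟩
  have : quatMat (-q : S3).1 = -quatMat q.1 := quatMat_neg q.1
  change quatMat (-q : S3).1 * X.1 * _ = -1 • (quatMat q.1 * X.1 * _)
  rw [this]
  simp

/-- A unit quaternion lifting a rotation. -/
noncomputable def liftRot (R : SO3) : S3 := Function.surjInv rot_surjective R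

/-- Since `q` and `-q` act in the same way on projective classes, the chosen lift is irrelevant and
the action of `S³` descends to `SO(3)`. -/
theorem pairAct_liftRot_rot (q : S3) (m : frameSet) :
    pairAct (liftRot (rot q), 1) m = pairAct (q, 1) m := by
  rcases (rot_eq_rot_iff _ _).1 (Function.surjInv_eq rot_surjective (rot q)) with h | h
  · rw [liftRot, h]
  · rw [liftRot, h, pairAct_neg]

/-- Post-composition with rotations of the sphere. -/
noncomputable instance frameAction : MulAction SO3 frameSet where
  smul R m := pairAct (liftRot R, 1) m
  one_smul m := by
    change pairAct (liftRot 1, 1) m = m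
    have h := pairAct_liftRot_rot 1 m
    rw [map_one] at h
    exact h.trans (pairAct_one m)
  mul_smul R S m := by
    obtain ⟨p, rfl⟩ := rot_surjective R
    obtain ⟨q, rfl⟩ := rot_surjective S
    change pairAct (liftRot (rot p * rot q), 1) m = pairAct _ (pairAct _ m)
    rw [← map_mul, pairAct_liftRot_rot, pairAct_liftRot_rot, pairAct_liftRot_rot, ← pairAct_mul]
    simp

theorem rot_smul (q : S3) (m : frameSet) : rot q • m = pairAct (q, 1) m :=
  pairAct_liftRot_rot q m

theorem continuous_frame_smul : Continuous fun x : SO3 × frameSet => x.1 • x.2 := by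
  have hq : IsOpenQuotientMap rot :=
    ⟨rot_surjective, continuous_rot, isCoveringMap_rot.isOpenMap⟩
  refine (hq.prodMap IsOpenQuotientMap.id).isQuotientMap.continuous_iff.2 ?_
  have : (fun x : SO3 × frameSet => x.1 • x.2) ∘ Prod.map rot id =
      fun x : S3 × frameSet => pairAct (x.1, 1) x.2 := by
    funext x
    exact rot_smul _ _
  rw [this]
  have h : Continuous fun x : S3 × frameSet => ((x.1, (1 : SO3)), x.2) := by fun_prop
  have h' := continuous_pairAct.comp h
  exact h'

/-- The base frame, as a frame. -/
def Frame.base : Frame := ⟨baseFrame, _, isFrameOf_baseFrame⟩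

theorem exists_pairAct_base (m : frameSet) : ∃ k, pairAct k (frameMk .base) = m := by
  obtain ⟨X, rfl⟩ := frameMk_surjective m
  obtain ⟨n, hn⟩ := X.2
  obtain ⟨k, a, ha, h⟩ := hn.exists_frameAct
  exact ⟨k, by rw [pairAct_frameMk]; exact (frameMk_eq_iff _ _).2 ⟨a, ha, h⟩⟩

theorem continuous_orbit (m : frameSet) : Continuous fun k : S3 × SO3 => pairAct k m := by
  have h : Continuous fun k : S3 × SO3 => (k, m) := by fun_prop
  have h' := continuous_pairAct.comp h
  exact h'

instance frameSet.compactSpace : CompactSpace frameSet :=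
  Function.Surjective.compactSpace (f := fun k => pairAct k (frameMk .base))
    (continuous_orbit _) exists_pairAct_base

/-- The plane spanned by a frame, given by its real normal line. -/
noncomputable def frameProj (m : frameSet) : RP2 :=
  Projectivization.mk ℝ (Function.surjInv frameMk_surjective m).2.choose
    (Function.surjInv frameMk_surjective m).2.choose_spec.1

theorem frameProj_frameMk (X : Frame) {n : Fin 3 → ℝ} (hX : IsFrameOf X.1 n) :
    frameProj (frameMk X) = Projectivization.mk ℝ n hX.1 := by
  obtain ⟨a, ha, e⟩ := (frameMk_eq_iff _ _).1
    (Function.surjInv_eq frameMk_surjective (frameMk X))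
  set Y := Function.surjInv frameMk_surjective (frameMk X) with hY
  have h1 : IsFrameOf X.1 Y.2.choose := e ▸ Y.2.choose_spec.smul ha
  obtain ⟨c, hc⟩ := hX.normal_unique h1.2.1
  exact (Projectivization.mk_eq_mk_iff' ℝ _ _ _ _).2 ⟨c, hc⟩

theorem rotate_axis_ne_zero (R : SO3) : R.1 *ᵥ ![0, 0, 1] ≠ 0 := fun h => by
  have h1 := congrArg (fun v => R.1ᵀ *ᵥ v) h
  beta_reduce at h1
  rw [Matrix.mulVec_mulVec, R.transpose_mul, Matrix.one_mulVec, Matrix.mulVec_zero] at h1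
  exact one_ne_zero (congrFun h1 2)

theorem frameProj_pairAct_base (k : S3 × SO3) : frameProj (pairAct k (frameMk .base)) =
    Projectivization.mk ℝ (k.2.1 *ᵥ ![0, 0, 1]) (rotate_axis_ne_zero k.2) := by
  rw [pairAct_frameMk]
  exact frameProj_frameMk _ (isFrameOf_baseFrame.frameAct k)

/-- The definition involves choices, so continuity is tested after composing with the orbit map of
the base point. That map is a quotient map, by compactness, and the composite is explicit. -/
theorem continuous_frameProj : Continuous frameProj := by
  have hq : Topology.IsQuotientMap fun k : S3 × SO3 => pairAct k (frameMk .base) :=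
    (continuous_orbit _).isClosedMap.isQuotientMap (continuous_orbit _) exists_pairAct_base
  refine hq.continuous_iff.2 ?_
  have : frameProj ∘ (fun k : S3 × SO3 => pairAct k (frameMk .base)) = fun k =>
      Projectivization.mk ℝ (k.2.1 *ᵥ ![0, 0, 1]) (rotate_axis_ne_zero k.2) :=
    funext frameProj_pairAct_base
  rw [this]
  have h : Continuous fun k : S3 × SO3 => k.2.1 *ᵥ ![0, 0, 1] := by fun_prop
  exact continuous_projMk.comp (h.subtype_mk fun k => rotate_axis_ne_zero k.2)

theorem frameProj_smul (R : SO3) (m : frameSet) : frameProj (R • m) = frameProj m := by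
  obtain ⟨q, rfl⟩ := rot_surjective R
  obtain ⟨k, rfl⟩ := exists_pairAct_base m
  rw [rot_smul, ← pairAct_mul, frameProj_pairAct_base, frameProj_pairAct_base]
  simp

theorem exists_smul_eq_of_frameProj_eq {m m' : frameSet} (h : frameProj m = frameProj m') :
    ∃ R : SO3, m' = R • m := by
  obtain ⟨X, rfl⟩ := frameMk_surjective m
  obtain ⟨Y, rfl⟩ := frameMk_surjective m'
  obtain ⟨n, hn⟩ := X.2
  obtain ⟨n', hn'⟩ := Y.2
  rw [frameProj_frameMk _ hn, frameProj_frameMk _ hn'] at h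
  obtain ⟨c, rfl⟩ := (Projectivization.mk_eq_mk_iff' ℝ _ _ _ _).1 h
  have hc : c ≠ 0 := by
    rintro rfl
    exact hn.1 (zero_smul _ _)
  have hX : IsFrameOf X.1 n' := by
    have := hn.smul_normal (inv_ne_zero hc)
    rwa [smul_smul, inv_mul_cancel₀ hc, one_smul] at this
  obtain ⟨l, q, hl, e⟩ := hX.exists_eq_smul hn'
  refine ⟨rot q, ?_⟩
  rw [rot_smul, pairAct_frameMk, eq_comm]
  refine (frameMk_eq_iff _ _).2 ⟨l, hl, ?_⟩
  change Y.1 = l • (quatMat q.1 * X.1 * (cmat 1)ᵀ)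
  rw [e, cmat_one, Matrix.transpose_one, Matrix.mul_one]

/-- Right multiplication by `Xᴴ` turns `q X = a X` into the statement that `quatMat q` is the scalar
`a`, so that `q = ±1`. -/
theorem frame_smul_free {R : SO3} {m : frameSet} (h : R • m = m) : R = 1 := by
  obtain ⟨q, rfl⟩ := rot_surjective R
  obtain ⟨X, rfl⟩ := frameMk_surjective m
  rw [rot_smul, pairAct_frameMk] at h
  obtain ⟨a, ha, e⟩ := (frameMk_eq_iff _ _).1 h.symm
  change quatMat q.1 * X.1 * (cmat 1)ᵀ = a • X.1 at e
  rw [cmat_one, Matrix.transpose_one, Matrix.mul_one] at e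
  obtain ⟨n, -, -, r, hr, hXr⟩ := X.2
  have hrC : (r : ℂ) ≠ 0 := by exact_mod_cast hr.ne'
  have e2 := congrArg (fun A => A * X.1ᴴ) e
  beta_reduce at e2
  rw [Matrix.mul_assoc, Matrix.smul_mul, hXr, Matrix.mul_smul, Matrix.mul_one, smul_comm] at e2
  have e3 : quatMat q.1 = a • quatMat (1 : S3).1 := by
    have := congrArg (fun A => (r : ℂ)⁻¹ • A) e2
    beta_reduce at this
    rw [smul_smul, smul_smul, inv_mul_cancel₀ hrC, one_smul, one_smul] at this
    rw [this]
    exact congrArg _ quatMat_one.symm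
  exact (rot_eq_one_iff q).2 (eq_or_eq_neg_of_quatMat_eq_smul e3)

end FrameManifold

/-! ### Principal bundles from free actions with local sections -/

section LocalSections

variable {G B P : Type*} [Group G] [TopologicalSpace G] [TopologicalSpace B]
  [TopologicalSpace P] [MulAction G P] {proj : P → B}

/-- A closed graph argument: by freeness the preimage of a closed set `C` under `g` is the
projection to `S` of a closed subset of `S × G`, and this projection is closed because `G` is
compact. -/
theorem continuousOn_of_smul_eq [CompactSpace G] [T2Space P]
    (hsmul : Continuous fun x : G × P => x.1 • x.2)
    (hfree : ∀ (g h : G) (p : P), g • p = h • p → g = h)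
    {X : Type*} [TopologicalSpace X] {S : Set X} {a b : X → P} {g : X → G}
    (ha : ContinuousOn a S) (hb : ContinuousOn b S) (hg : ∀ x ∈ S, b x = g x • a x) :
    ContinuousOn g S := by
  rw [continuousOn_iff_continuous_domRestrict] at *
  refine continuous_iff_isClosed.2 fun C hC => ?_
  have h1 : IsClosed {y : S × G | S.domRestrict b y.1 = y.2 • S.domRestrict a y.1 ∧ y.2 ∈ C} := by
    refine IsClosed.inter (isClosed_eq (hb.comp continuous_fst) ?_) (hC.preimage continuous_snd)
    have h2 := hsmul.comp (continuous_snd.prodMk (ha.comp (continuous_fst (X := S) (Y := G))))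
    exact h2
  have h2 := isClosedMap_fst_of_compactSpace _ h1
  convert h2 using 1
  ext x
  constructor
  · intro hx
    exact ⟨(x, g x), ⟨hg x x.2, hx⟩, rfl⟩
  · rintro ⟨⟨y, h⟩, ⟨h3, h4⟩, rfl⟩
    have : g y = h := hfree _ _ _ ((hg y y.2).symm.trans h3)
    change g y ∈ C
    rwa [this]

/-- Over the domain of a section `s`, the fibre coordinate of `p` is the unique `g` with `p = g • s
(proj p)`; its continuity is `continuousOn_of_smul_eq`. -/
theorem isPrincipalBundle_of_local_sections [CompactSpace G] [T2Space P]
    (hsmul : Continuous fun x : G × P => x.1 • x.2)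
    (hproj : Continuous proj) (hproj_smul : ∀ (g : G) (p : P), proj (g • p) = proj p)
    (hfree : ∀ (g h : G) (p : P), g • p = h • p → g = h)
    (htrans : ∀ p p' : P, proj p = proj p' → ∃ g : G, p' = g • p)
    (hsec : ∀ b : B, ∃ (U : Set B) (s : B → P), IsOpen U ∧ b ∈ U ∧ ContinuousOn s U ∧
      ∀ x ∈ U, proj (s x) = x) :
    IsPrincipalBundle G proj := by
  classical
  refine ⟨hsmul, hproj_smul, fun b => ?_⟩
  obtain ⟨U, s, hU, hbU, hs, hps⟩ := hsec b
  have hex : ∀ p : P, ∃ g : G, proj p ∈ U → p = g • s (proj p) := fun p => by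
    by_cases hp : proj p ∈ U
    · obtain ⟨g, hg⟩ := htrans (s (proj p)) p (hps _ hp)
      exact ⟨g, fun _ => hg⟩
    · exact ⟨1, fun h => absurd h hp⟩
  choose g hg using hex
  have hgc : ContinuousOn g (proj ⁻¹' U) :=
    continuousOn_of_smul_eq hsmul hfree (a := fun p => s (proj p)) (b := fun p => p)
      (hs.comp hproj.continuousOn fun _ h => h) continuousOn_id hg
  let e : OpenPartialHomeomorph P (B × G) :=
    { toFun := fun p => (proj p, g p)
      invFun := fun x => x.2 • s x.1
      source := proj ⁻¹' U
      target := U ×ˢ Set.univ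
      map_source' := fun p hp => ⟨hp, trivial⟩
      map_target' := fun x hx => by
        change proj (x.2 • s x.1) ∈ U
        rw [hproj_smul, hps _ hx.1]
        exact hx.1
      left_inv' := fun p hp => (hg p hp).symm
      right_inv' := fun x hx => by
        have h1 : proj (x.2 • s x.1) = x.1 := by rw [hproj_smul, hps _ hx.1]
        refine Prod.ext h1 ?_
        have h2 := hg (x.2 • s x.1) (by rw [h1]; exact hx.1)
        rw [h1] at h2
        exact (hfree _ _ _ h2).symm
      open_source := hU.preimage hproj
      open_target := hU.prod isOpen_univ
      continuousOn_toFun := hproj.continuousOn.prodMk hgc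
      continuousOn_invFun := by
        have h1 : ContinuousOn (fun x : B × G => (x.2, s x.1)) (U ×ˢ Set.univ) :=
          continuousOn_snd.prodMk (hs.comp continuousOn_fst fun x hx => hx.1)
        have h2 := hsmul.comp_continuousOn h1
        exact h2 }
  refine ⟨⟨e, U, hU, rfl, rfl, fun p _ => rfl⟩, hbU, fun p hp h => ?_⟩
  change g (h • p) = h * g p
  have hp' : proj p ∈ U := hp
  have h1 := hg (h • p) (by rwa [hproj_smul])
  rw [hproj_smul] at h1
  refine (hfree _ _ (s (proj p)) ?_).symm
  rw [← h1, mul_smul, ← hg p hp']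

end LocalSections

/-! ### The frame bundle and its clutching sign -/

section FrameBundle

open Quaternion Matrix

/-- A frame of the plane orthogonal to `(x, y, 1)`. -/
noncomputable def planeFrame (x y : ℝ) : Mat23 :=
  !![(√(1 + x ^ 2 + y ^ 2) : ℂ), 0, -(√(1 + x ^ 2 + y ^ 2) * x : ℂ);
    -(x * y : ℂ), (1 + x ^ 2 : ℂ), -(y : ℂ)]

theorem planeFrame_mul_conjTranspose (x y : ℝ) : planeFrame x y * (planeFrame x y)ᴴ =
    (((1 + x ^ 2 + y ^ 2) * (1 + x ^ 2) : ℝ) : ℂ) • 1 := by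
  have h : (√(1 + x ^ 2 + y ^ 2) : ℂ) ^ 2 = 1 + x ^ 2 + y ^ 2 := by
    have := Real.sq_sqrt (show 0 ≤ 1 + x ^ 2 + y ^ 2 by positivity)
    exact_mod_cast this
  ext i j
  fin_cases i <;> fin_cases j <;>
    simp [planeFrame, Matrix.mul_apply, Fin.sum_univ_three]
  · linear_combination (1 + (x : ℂ) ^ 2) * h
  · ring
  · ring
  · ring

theorem isFrameOf_planeFrame (x y : ℝ) : IsFrameOf (planeFrame x y) ![x, y, 1] := by
  refine ⟨fun h => one_ne_zero (congrFun h 2), ?_, _, ?_, planeFrame_mul_conjTranspose x y⟩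
  · ext i
    fin_cases i <;>
      simp [planeFrame, cvec, Matrix.mulVec, dotProduct, Fin.sum_univ_three] <;> ring
  · positivity

theorem continuous_planeFrame : Continuous fun t : ℝ × ℝ => planeFrame t.1 t.2 := by
  refine continuous_matrix fun i j => ?_
  fin_cases i <;> fin_cases j <;> simp [planeFrame] <;> fun_prop

/-- After a rotation `b` is the third axis. The lines outside the horizontal plane are spanned by
vectors `(x, y, 1)`, over which `planeFrame` is an explicit section. -/
theorem exists_local_section (b : RP2) : ∃ (U : Set RP2) (s : RP2 → frameSet), IsOpen U ∧ b ∈ U ∧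
    ContinuousOn s U ∧ ∀ x ∈ U, frameProj (s x) = x := by
  obtain ⟨R, hR⟩ : ∃ R : SO3, ∃ hR, b = Projectivization.mk ℝ (R.1 *ᵥ ![0, 0, 1]) hR := by
    obtain ⟨z, hz, rfl⟩ := exists_discToRP2_eq b
    obtain ⟨R, hR⟩ := exists_rotation_of_unit (n := ![z.re, z.im, √(1 - ‖z‖ ^ 2)])
      (by simpa using discVec_sq_sum hz) (Real.sqrt_nonneg _)
    exact ⟨R, rotate_axis_ne_zero R, (Projectivization.mk_eq_mk_iff' ℝ _ _ _ _).2
      ⟨1, by rw [hR, one_smul]⟩⟩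
  let c : RP2 → Fin 3 → ℝ := fun x => R.1ᵀ *ᵥ x.rep
  have hc : ∀ (v : Fin 3 → ℝ) (hv : v ≠ 0), ∃ a : ℝ, a ≠ 0 ∧
      c (Projectivization.mk ℝ v hv) = a • (R.1ᵀ *ᵥ v) := fun v hv => by
    obtain ⟨a, ha⟩ := Projectivization.exists_smul_eq_mk_rep ℝ v hv
    refine ⟨a, a.ne_zero, ?_⟩
    simp only [c]
    rw [← ha, ← Matrix.mulVec_smul]
    rfl
  let U : Set RP2 := {x | c x 2 ≠ 0}
  have hUv : ∀ (v : Fin 3 → ℝ) (hv : v ≠ 0),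
      Projectivization.mk ℝ v hv ∈ U ↔ (R.1ᵀ *ᵥ v) 2 ≠ 0 := fun v hv => by
    obtain ⟨a, ha, h⟩ := hc v hv
    change c _ 2 ≠ 0 ↔ _
    rw [h]
    simp [ha]
  have hU : IsOpen U := by
    rw [← isOpenQuotientMap_projMk.isQuotientMap.isOpen_preimage]
    have : (fun v : {v : Fin 3 → ℝ // v ≠ 0} => Projectivization.mk ℝ v.1 v.2) ⁻¹' U =
        {v | (R.1ᵀ *ᵥ v.1) 2 ≠ 0} := by
      ext v
      exact hUv v.1 v.2
    rw [this]
    exact isOpen_ne_fun (by fun_prop) continuous_const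
  let t : RP2 → ℝ × ℝ := fun x => (c x 0 / c x 2, c x 1 / c x 2)
  have ht : ContinuousOn t U := by
    intro x hx
    refine ContinuousAt.continuousWithinAt ?_
    obtain ⟨v, rfl⟩ := isOpenQuotientMap_projMk.surjective x
    rw [isOpenQuotientMap_projMk.continuousAt_comp_iff.symm]
    have h2 := (hUv v.1 v.2).1 hx
    have : t ∘ (fun v : {v : Fin 3 → ℝ // v ≠ 0} => Projectivization.mk ℝ v.1 v.2) =
        fun v => ((R.1ᵀ *ᵥ v.1) 0 / (R.1ᵀ *ᵥ v.1) 2, (R.1ᵀ *ᵥ v.1) 1 / (R.1ᵀ *ᵥ v.1) 2) := by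
      funext w
      obtain ⟨a, ha, h⟩ := hc w.1 w.2
      simp only [t, Function.comp_apply]
      rw [h]
      simp only [Pi.smul_apply, smul_eq_mul, mul_div_mul_left _ _ ha]
    rw [this]
    have hcoord : ∀ i, Continuous fun v : {v : Fin 3 → ℝ // v ≠ 0} => (R.1ᵀ *ᵥ v.1) i :=
      fun i => by fun_prop
    exact ((hcoord 0).continuousAt.div (hcoord 2).continuousAt h2).prodMk
      ((hcoord 1).continuousAt.div (hcoord 2).continuousAt h2)
  let f : ℝ × ℝ → frameSet := fun t => frameMk ⟨planeFrame t.1 t.2, _, isFrameOf_planeFrame t.1 t.2⟩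
  have hf : Continuous f := isOpenQuotientMap_frameMk.continuous.comp
    (continuous_planeFrame.subtype_mk _)
  have hact : Continuous fun m : frameSet => pairAct (1, R) m := by
    have h : Continuous fun m : frameSet => (((1 : S3), R), m) := by fun_prop
    have h' := continuous_pairAct.comp h
    exact h'
  refine ⟨U, fun x => pairAct (1, R) (f (t x)), hU, ?_, ?_, ?_⟩
  · obtain ⟨hR, rfl⟩ := hR
    rw [hUv, Matrix.mulVec_mulVec, R.transpose_mul, Matrix.one_mulVec]
    exact one_ne_zero
  · exact hact.comp_continuousOn (hf.comp_continuousOn ht)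
  · intro x hx
    have hx2 : c x 2 ≠ 0 := hx
    simp only [f]
    rw [pairAct_frameMk, frameProj_frameMk _ ((isFrameOf_planeFrame (t x).1 (t x).2).frameAct _)]
    conv_rhs => rw [← x.mk_rep]
    refine (Projectivization.mk_eq_mk_iff' ℝ _ _ _ _).2 ⟨(c x 2)⁻¹, ?_⟩
    have h1 : ![(t x).1, (t x).2, 1] = (c x 2)⁻¹ • c x := by
      ext i
      fin_cases i <;> simp [t, hx2] <;> field_simp
    change _ = R.1 *ᵥ ![(t x).1, (t x).2, 1]
    rw [h1, Matrix.mulVec_smul]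
    simp only [c]
    rw [Matrix.mulVec_mulVec, R.mul_transpose, Matrix.one_mulVec]

theorem isPrincipalBundle_frameProj : IsPrincipalBundle SO3 frameProj := by
  refine isPrincipalBundle_of_local_sections continuous_frame_smul continuous_frameProj
    frameProj_smul (fun g h p e => ?_) (fun p p' => exists_smul_eq_of_frameProj_eq)
    exists_local_section
  have : (h⁻¹ * g) • p = p := by rw [mul_smul, e, inv_smul_smul]
  exact (inv_mul_eq_one.1 (frame_smul_free this)).symm

/-- The half-turn about the horizontal axis `(sin θ, -cos θ, 0)` acts on the horizontal plane as a
reflection. A reflection has determinant -1; multiplied by `i` it lies in `SU(2)`, where it is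
`quatMat g`. The scalar `-i` is invisible projectively. -/
theorem pairAct_half_turn (θ : ℝ) (p g : S3) (hp : p.1 = quat 0 (Real.sin θ) (-Real.cos θ) 0)
    (hg : g.1 = quat 0 (-Real.cos (2 * θ)) 0 (-Real.sin (2 * θ))) :
    pairAct (1, rot p) (frameMk .base) = pairAct (g, 1) (frameMk .base) := by
  rw [pairAct_frameMk, pairAct_frameMk, eq_comm]
  refine (frameMk_eq_iff _ _).2 ⟨-Complex.I, by simp, ?_⟩
  change quatMat (1 : S3).1 * baseFrame * (cmat (rot p))ᵀ =
    -Complex.I • (quatMat g.1 * baseFrame * (cmat 1)ᵀ)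
  have h1 : quatMat (1 : S3).1 = 1 := quatMat_one
  rw [h1, cmat_one, Matrix.transpose_one, Matrix.mul_one, Matrix.one_mul, hg, cmat, coe_rot, hp]
  have hs := Real.sin_sq_add_cos_sq θ
  ext i j
  fin_cases i <;> fin_cases j <;> apply Complex.ext <;>
    simp [baseFrame, quatMat, rotMat, Matrix.mul_apply, Fin.sum_univ_three,
      Real.cos_two_mul, Real.sin_two_mul, -Complex.ofReal_sin, -Complex.ofReal_cos,
      -Complex.ofReal_pow] <;> nlinarith

/-- The bundle of frames is non-trivial. -/
theorem hasClutching_frameProj : HasClutching frameProj (-1) := by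
  let n : ℂ → Fin 3 → ℝ := fun z =>
    ![(clampDisc z).re, (clampDisc z).im, √(1 - ‖clampDisc z‖ ^ 2)]
  have hn : ∀ z, n z 0 ^ 2 + n z 1 ^ 2 + n z 2 ^ 2 = 1 := fun z => by
    simpa [n] using discVec_sq_sum (norm_clampDisc_le z)
  have hn2 : ∀ z, 0 ≤ n z 2 := fun z => Real.sqrt_nonneg _
  have hn0c : Continuous fun z => n z 0 := Complex.continuous_re.comp continuous_clampDisc
  have hn1c : Continuous fun z => n z 1 := Complex.continuous_im.comp continuous_clampDisc
  have hn2c : Continuous fun z => n z 2 := by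
    have h := continuous_clampDisc
    change Continuous fun z => √(1 - ‖clampDisc z‖ ^ 2)
    fun_prop
  let Q : ℂ → S3 := fun z => ⟨tilt (n z), tilt_mem (hn z) (hn2 z)⟩
  have hs : Continuous fun z => √(2 * (1 + n z 2)) := by fun_prop
  have hs0 : ∀ z, √(2 * (1 + n z 2)) ≠ 0 := fun z =>
    (Real.sqrt_pos.2 (by linarith [hn2 z])).ne'
  have hQ : Continuous Q := by
    refine Continuous.subtype_mk ?_ _
    exact continuous_quat ((continuous_const.add hn2c).div hs hs0) (hn1c.neg.div hs hs0)
      (hn0c.div hs hs0) continuous_const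
  let s : ℂ → frameSet := fun z => pairAct (1, rot (Q z)) (frameMk .base)
  have hsc : Continuous s := by
    have h1 : Continuous fun z => ((1 : S3), rot (Q z)) :=
      continuous_const.prodMk (continuous_rot.comp hQ)
    have h2 := (continuous_orbit (frameMk .base)).comp h1
    exact h2
  have hg : ∀ θ : ℝ, quat 0 (-Real.cos (2 * θ)) 0 (-Real.sin (2 * θ)) ∈
      Metric.sphere (0 : ℍ[ℝ]) 1 := fun θ => by
    rw [mem_S3_iff]
    simp
  let g : ℝ → S3 := fun θ => ⟨_, hg θ⟩
  have hgc : Continuous g := by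
    refine Continuous.subtype_mk ?_ _
    exact continuous_quat continuous_const (by fun_prop) continuous_const (by fun_prop)
  refine ⟨⟨s, hsc⟩, ⟨g, hgc⟩, fun z => ?_, fun θ => ?_, ?_⟩
  · change frameProj (s z) = _
    rw [frameProj_pairAct_base, ← discToRP2_clamp]
    refine (Projectivization.mk_eq_mk_iff' ℝ _ _ _ _).2 ⟨1, ?_⟩
    rw [one_smul]
    exact (rotMat_tilt_mulVec (hn z) (hn2 z)).symm
  · change s _ = rot (g θ) • s _
    have hp : quat 0 (Real.sin θ) (-Real.cos θ) 0 ∈ Metric.sphere (0 : ℍ[ℝ]) 1 := by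
      rw [mem_S3_iff]
      simp
    have hre : (Circle.exp θ : ℂ).re = Real.cos θ := by
      rw [Circle.coe_exp, Complex.exp_ofReal_mul_I_re]
    have him : (Circle.exp θ : ℂ).im = Real.sin θ := by
      rw [Circle.coe_exp, Complex.exp_ofReal_mul_I_im]
    have hc := Real.sin_sq_add_cos_sq θ
    have hnz : n (Circle.exp θ : ℂ) = ![Real.cos θ, Real.sin θ, 0] := by
      simp only [n]
      rw [clampDisc_of_norm_eq_one (norm_circleExp θ), norm_circleExp, hre, him]
      simp
    have hnz' : n (-(Circle.exp θ : ℂ)) = ![-Real.cos θ, -Real.sin θ, 0] := by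
      simp only [n]
      rw [clampDisc_of_norm_eq_one (by rw [norm_neg, norm_circleExp]), norm_neg, norm_circleExp,
        Complex.neg_re, Complex.neg_im, hre, him]
      simp
    -- On the equator `Q` takes the value `(1 - p)/√2` at `e^{iθ}`, where `p` is the quaternion of
    -- `hp`, and `(1 + p)/√2` at the antipode. Since `p² = -1`, the second is the first times `p`.
    have hQQ : Q (-(Circle.exp θ : ℂ)) = Q (Circle.exp θ : ℂ) * ⟨_, hp⟩ := by
      refine Subtype.ext ?_
      change tilt (n (-(Circle.exp θ : ℂ))) = tilt (n (Circle.exp θ : ℂ)) * quat _ _ _ _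
      rw [hnz, hnz']
      refine Quaternion.ext _ _ ?_ ?_ ?_ ?_ <;> simp [tilt] <;> field_simp <;> nlinarith
    simp only [s]
    rw [hQQ, rot_smul, ← pairAct_mul, map_mul]
    have h1 : ((1 : S3), rot (Q (Circle.exp θ : ℂ)) * rot ⟨_, hp⟩) =
        (1, rot (Q (Circle.exp θ : ℂ))) * (1, rot ⟨_, hp⟩) := by simp
    have h2 : (g θ, (1 : SO3)) * (1, rot (Q (Circle.exp θ : ℂ))) =
        (1, rot (Q (Circle.exp θ : ℂ))) * (g θ, 1) := by simp
    rw [h1, h2, pairAct_mul, pairAct_mul, pairAct_half_turn θ ⟨_, hp⟩ (g θ) rfl rfl]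
  -- The path `g` has period `π`, and `g 0` is an imaginary unit, with square -1.
  · refine Subtype.ext ?_
    change quat _ _ _ _ * quat _ _ _ _ = -1
    refine Quaternion.ext _ _ ?_ ?_ ?_ ?_ <;> simp

end FrameBundle

/-! ### The deformation retraction -/

section Retraction

open Matrix ComplexConjugate

/-- A first deformation of pairs of rows, which makes the plane spanned by the rows real: the unit
normal `w` of the plane is moved to `a • w + b • conj w`. -/
noncomputable def straighten (a b : ℝ) (X : Mat23) : Mat23 :=
  ((a ^ 2 + b ^ 2 : ℝ) +
      (2 * a * b : ℝ) * (normalVec X ⬝ᵥ star (normalVec X)) / ‖gramDet X‖ : ℂ) • X -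
    vecMulVec (X *ᵥ star (normalVec X))
      (((a * b : ℝ) / ‖gramDet X‖ : ℂ) • normalVec X +
        ((b ^ 2 : ℝ) / conj (gramDet X) : ℂ) • star (normalVec X))

theorem mulVec_normalVec (X : Mat23) : X *ᵥ normalVec X = 0 := by
  ext i
  fin_cases i <;> simp [normalVec, Matrix.mulVec, dotProduct, Fin.sum_univ_three] <;> ring

theorem normalVec_smul (c : ℂ) (X : Mat23) : normalVec (c • X) = c ^ 2 • normalVec X := by
  ext i
  fin_cases i <;> simp [normalVec] <;> ring

/-- The projection of the rows to the plane with normal `v`, up to a factor. -/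
def projectRows (X : Mat23) (v : Fin 3 → ℂ) : Mat23 := (v ⬝ᵥ v) • X - vecMulVec (X *ᵥ v) v

theorem projectRows_mulVec (X : Mat23) (v : Fin 3 → ℂ) : projectRows X v *ᵥ v = 0 := by
  rw [projectRows, Matrix.sub_mulVec, Matrix.smul_mulVec, Matrix.vecMulVec_mulVec]
  simp

/-- With `u` the cross product of the rows, that of the projected rows is `(v · v)(v · u) v`. -/
theorem gramDet_projectRows (X : Mat23) (v : Fin 3 → ℂ) :
    gramDet (projectRows X v) = (v ⬝ᵥ v) ^ 3 * (v ⬝ᵥ normalVec X) ^ 2 := by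
  simp [gramDet_eq, projectRows, normalVec, vecMulVec_apply, Matrix.mulVec, dotProduct,
    Fin.sum_univ_three]
  ring

theorem exists_unit_normal {X : Mat23} (hX : gramDet X ≠ 0) : ∃ (c : ℂ) (w : Fin 3 → ℂ), c ≠ 0 ∧
    normalVec X = c • w ∧ w ⬝ᵥ w = 1 := by
  obtain ⟨c, hc⟩ := IsAlgClosed.exists_pow_nat_eq (gramDet X) (n := 2) two_pos
  have hc0 : c ≠ 0 := by
    rintro rfl
    exact hX (by rw [← hc]; simp)
  refine ⟨c, c⁻¹ • normalVec X, hc0, by rw [smul_inv_smul₀ hc0], ?_⟩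
  rw [smul_dotProduct, dotProduct_smul, ← gramDet, ← hc]
  simp only [smul_eq_mul]
  field_simp

/-- The unit normal `w` is defined only up to sign. With `c² = gramDet X`, the numbers `|c|²` and
`(conj c)²` become `‖gramDet X‖` and `conj (gramDet X)`, which is how `straighten` avoids choosing a
square root. -/
theorem straighten_eq {X : Mat23} {c : ℂ} {w : Fin 3 → ℂ} (hc : c ≠ 0) (hu : normalVec X = c • w)
    (hw : w ⬝ᵥ w = 1) (a b : ℝ) :
    straighten a b X = projectRows X ((a : ℂ) • w + (b : ℂ) • star w) := by
  have hD : gramDet X = c ^ 2 := by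
    rw [gramDet, hu, smul_dotProduct, dotProduct_smul, hw]
    simp [sq]
  have hN : ((‖gramDet X‖ : ℝ) : ℂ) = c * conj c := by
    rw [hD, norm_pow, Complex.mul_conj, Complex.normSq_eq_norm_sq]
  have hc' : conj c ≠ 0 := by simpa using hc
  have hw' : star w ⬝ᵥ star w = 1 := by
    rw [star_dotProduct_star, hw, star_one]
  have hXw : X *ᵥ w = 0 := by
    have h := mulVec_normalVec X
    rw [hu, Matrix.mulVec_smul] at h
    exact (smul_eq_zero.1 h).resolve_left hc
  rw [straighten, projectRows, hN, hD, hu, star_smul]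
  simp only [Matrix.mulVec_add, Matrix.mulVec_smul, hXw, smul_zero, zero_add, add_dotProduct,
    dotProduct_add, smul_dotProduct, dotProduct_smul, hw, hw', dotProduct_comm (star w) w]
  congr 1
  · congr 1
    simp only [smul_eq_mul]
    push_cast
    simp only [Complex.star_def]
    field_simp
    ring
  · ext i j
    simp [vecMulVec_apply]
    field_simp

theorem dotProduct_star_eq (w : Fin 3 → ℂ) :
    w ⬝ᵥ star w = ((∑ i, Complex.normSq (w i) : ℝ) : ℂ) := by
  simp [dotProduct, Complex.mul_conj]

/-- For `v = a w + b conj w` and `N = ∑ |wᵢ|²` one has `v · v = a² + b² + 2abN` and `v · w = a +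
bN`, both positive. -/
theorem gramDet_straighten_ne_zero {X : Mat23} (hX : gramDet X ≠ 0) {a b : ℝ} (ha : 0 < a)
    (hb : 0 ≤ b) : gramDet (straighten a b X) ≠ 0 := by
  obtain ⟨c, w, hc, hu, hw⟩ := exists_unit_normal hX
  rw [straighten_eq hc hu hw, gramDet_projectRows, hu]
  have hw' : star w ⬝ᵥ star w = 1 := by
    rw [star_dotProduct_star, hw, star_one]
  simp only [add_dotProduct, dotProduct_add, smul_dotProduct, dotProduct_smul, hw, hw',
    dotProduct_comm (star w) w, dotProduct_star_eq, smul_eq_mul, mul_one]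
  have hN : 0 ≤ ∑ i, Complex.normSq (w i) := Finset.sum_nonneg fun i _ => Complex.normSq_nonneg _
  set N := ∑ i, Complex.normSq (w i)
  have h1 : 0 < a * a + a * (b * N) + (b * (a * N) + b * b) := by positivity
  have h2 : 0 < a + b * N := by positivity
  refine mul_ne_zero (pow_ne_zero _ ?_) (pow_ne_zero _ (mul_ne_zero hc ?_))
  · intro h
    apply h1.ne'
    have h' : ((a * a + a * (b * N) + (b * (a * N) + b * b) : ℝ) : ℂ) = 0 := by
      push_cast
      linear_combination h
    exact_mod_cast h'
  · exact_mod_cast h2.ne'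

theorem straighten_smul (a b : ℝ) {c : ℂ} (hc : c ≠ 0) {X : Mat23} (hX : gramDet X ≠ 0) :
    straighten a b (c • X) = c • straighten a b X := by
  have hN : ((‖c‖ : ℝ) : ℂ) ^ 2 = c * conj c := by
    rw [Complex.mul_conj, Complex.normSq_eq_norm_sq]
    push_cast
    rfl
  have hN' : ((‖c ^ 4 * gramDet X‖ : ℝ) : ℂ) = (c * conj c) ^ 2 * (‖gramDet X‖ : ℂ) := by
    rw [norm_mul, norm_pow, ← hN]
    push_cast
    ring
  have hc' : conj c ≠ 0 := by simpa using hc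
  have hX1 : ((‖gramDet X‖ : ℝ) : ℂ) ≠ 0 := by simpa using hX
  have hX2 : conj (gramDet X) ≠ 0 := by simpa using hX
  rw [straighten, straighten, gramDet_smul, normalVec_smul, hN']
  ext i j
  simp [vecMulVec_apply, Matrix.smul_mulVec, Matrix.mulVec_smul]
  field_simp

theorem continuous_straighten {T : Type*} [TopologicalSpace T] {a b : T → ℝ} {X : T → Mat23}
    (ha : Continuous a) (hb : Continuous b) (hX : Continuous X) (h0 : ∀ t, gramDet (X t) ≠ 0) :
    Continuous fun t => straighten (a t) (b t) (X t) := by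
  have hn : Continuous fun t => normalVec (X t) := by
    unfold normalVec
    fun_prop
  have hD : Continuous fun t => gramDet (X t) := continuous_gramDet.comp hX
  have h1 : ∀ t, ((‖gramDet (X t)‖ : ℝ) : ℂ) ≠ 0 := fun t => by simpa using h0 t
  have h2 : ∀ t, conj (gramDet (X t)) ≠ 0 := fun t => by simpa using h0 t
  unfold straighten
  fun_prop (disch := assumption)

theorem IsFrameOf.normalVec_eq {X : Mat23} {n : Fin 3 → ℝ} (h : IsFrameOf X n) :
    ∃ c : ℂ, normalVec X = c • cvec n := by
  have hX0 := congrFun h.2.1 0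
  have hX1 := congrFun h.2.1 1
  simp only [Matrix.mulVec, dotProduct, Fin.sum_univ_three, cvec, Pi.zero_apply] at hX0 hX1
  obtain ⟨j, hj⟩ := Function.ne_iff.1 h.1
  have hj' : (n j : ℂ) ≠ 0 := by exact_mod_cast hj
  refine ⟨normalVec X j / n j, ?_⟩
  ext i
  simp only [Pi.smul_apply, smul_eq_mul, cvec]
  field_simp
  fin_cases i <;> fin_cases j <;> simp [normalVec] <;> grind

/-- If the plane of the rows is real, straightening changes nothing up to a factor. -/
theorem straighten_of_real {X : Mat23} {n : Fin 3 → ℝ} (h : IsFrameOf X n) (a b : ℝ) :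
    ∃ c : ℂ, straighten a b X = c • X := by
  have h0 : X *ᵥ star (normalVec X) = 0 := by
    obtain ⟨c, hc⟩ := h.normalVec_eq
    have hstar : star (cvec n) = cvec n := by
      ext i
      simp [cvec]
    rw [hc, star_smul, hstar, Matrix.mulVec_smul, h.2.1, smul_zero]
  exact ⟨_, by rw [straighten, h0, Matrix.zero_vecMulVec, sub_zero]⟩

theorem straighten_one_zero (X : Mat23) : straighten 1 0 X = X := by
  ext i j
  simp [straighten, vecMulVec_apply]

/-- With equal weights 1/2 the new normal is the real part of `w`. It is not 0, because the Gram
determinant is still nonzero. -/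
theorem exists_straighten_half_mulVec {X : Mat23} (hX : gramDet X ≠ 0) :
    ∃ n : Fin 3 → ℝ, n ≠ 0 ∧ straighten (1 / 2) (1 / 2) X *ᵥ cvec n = 0 := by
  obtain ⟨c, w, hc, hu, hw⟩ := exists_unit_normal hX
  have hv : ((1 / 2 : ℝ) : ℂ) • w + ((1 / 2 : ℝ) : ℂ) • star w = cvec fun i => (w i).re := by
    ext i
    apply Complex.ext <;> simp [cvec] <;> ring
  have h1 := gramDet_straighten_ne_zero hX (a := 1 / 2) (b := 1 / 2) (by norm_num) (by norm_num)
  have h2 := straighten_eq hc hu hw (1 / 2) (1 / 2)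
  rw [hv] at h2
  refine ⟨_, fun h => h1 ?_, by rw [h2]; exact projectRows_mulVec _ _⟩
  rw [h2, gramDet_projectRows, h]
  simp [cvec, dotProduct]

/-- The square root of the determinant of the Hermitian Gram matrix of the rows. -/
noncomputable def area (X : Mat23) : ℝ := √(∑ i, Complex.normSq (normalVec X i))

/-- Lagrange's identity for the Hermitian Gram determinant. -/
theorem area_sq (X : Mat23) : ((area X : ℝ) : ℂ) ^ 2 = (X * Xᴴ).det := by
  have h : area X ^ 2 = ∑ i, Complex.normSq (normalVec X i) :=
    Real.sq_sqrt (Finset.sum_nonneg fun i _ => Complex.normSq_nonneg _)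
  rw [← Complex.ofReal_pow, h]
  simp [Complex.normSq_eq_conj_mul_self, normalVec, Fin.sum_univ_three, Matrix.det_fin_two,
    Matrix.mul_apply]
  ring

theorem area_pos {X : Mat23} (hX : gramDet X ≠ 0) : 0 < area X := by
  refine Real.sqrt_pos.2 ?_
  have h : normalVec X ≠ 0 := fun h => hX (by rw [gramDet, h, zero_dotProduct])
  obtain ⟨i, hi⟩ := Function.ne_iff.1 h
  exact Finset.sum_pos' (fun i _ => Complex.normSq_nonneg _)
    ⟨i, Finset.mem_univ _, Complex.normSq_pos.2 hi⟩

theorem area_smul (c : ℂ) (X : Mat23) : area (c • X) = ‖c‖ ^ 2 * area X := by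
  rw [area, area, normalVec_smul, ← Real.sqrt_sq (sq_nonneg ‖c‖), ← Real.sqrt_mul (by positivity),
    Finset.mul_sum]
  congr 1
  refine Finset.sum_congr rfl fun i _ => ?_
  simp [Complex.normSq_eq_norm_sq]
  ring

/-- The matrix by which a second deformation multiplies a pair of rows to make them orthogonal and
of equal length. -/
noncomputable def orthonormalizer (s : ℝ) (X : Mat23) : Matrix (Fin 2) (Fin 2) ℂ :=
  (((1 - s : ℝ) : ℂ) * (X * Xᴴ).trace + (s : ℂ) * area X) • 1 + (s : ℂ) • (X * Xᴴ).adjugate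

theorem trace_mul_conjTranspose (X : Mat23) :
    (X * Xᴴ).trace = ((∑ i, ∑ j, Complex.normSq (X i j) : ℝ) : ℂ) := by
  simp [Matrix.trace, Matrix.mul_apply, Complex.mul_conj]

theorem trace_mul_conjTranspose_pos {X : Mat23} (hX : gramDet X ≠ 0) :
    0 < ∑ i, ∑ j, Complex.normSq (X i j) := by
  have h : X ≠ 0 := by
    rintro rfl
    exact hX (by simp [gramDet_eq])
  obtain ⟨i, hi⟩ := Function.ne_iff.1 h
  obtain ⟨j, hj⟩ := Function.ne_iff.1 hi
  exact Finset.sum_pos' (fun i _ => Finset.sum_nonneg fun j _ => Complex.normSq_nonneg _)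
    ⟨i, Finset.mem_univ _, Finset.sum_pos' (fun i _ => Complex.normSq_nonneg _)
      ⟨j, Finset.mem_univ _, Complex.normSq_pos.2 hj⟩⟩

theorem det_smul_one_add_smul_adjugate (a b : ℂ) (H : Matrix (Fin 2) (Fin 2) ℂ) :
    (a • (1 : Matrix (Fin 2) (Fin 2) ℂ) + b • H.adjugate).det =
      a ^ 2 + a * b * H.trace + b ^ 2 * H.det := by
  simp [Matrix.det_fin_two, Matrix.adjugate_fin_two, Matrix.trace_fin_two]
  ring

/-- With `H = X Xᴴ` and `α` the scalar coefficient, the determinant is `α² + α s tr H + s² det H`, a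
sum of nonnegative terms with the first one positive. -/
theorem det_orthonormalizer_ne_zero {X : Mat23} (hX : gramDet X ≠ 0) {s : ℝ} (h0 : 0 ≤ s)
    (h1 : s ≤ 1) : (orthonormalizer s X).det ≠ 0 := by
  have hT := trace_mul_conjTranspose_pos hX
  have hA := area_pos hX
  rw [orthonormalizer, det_smul_one_add_smul_adjugate, ← area_sq, trace_mul_conjTranspose]
  set T := ∑ i, ∑ j, Complex.normSq (X i j)
  set A := area X
  have hα : 0 < (1 - s) * T + s * A := by
    rcases h0.eq_or_lt with rfl | h0
    · simpa using hT
    · have := mul_nonneg (sub_nonneg.2 h1) hT.le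
      positivity
  set α := (1 - s) * T + s * A with hαd
  have h : 0 < α ^ 2 + α * s * T + s ^ 2 * A ^ 2 := by positivity
  have e : ((1 - s : ℝ) : ℂ) * (T : ℂ) + (s : ℂ) * A = (α : ℂ) := by
    rw [hαd]
    push_cast
    rfl
  rw [e]
  exact_mod_cast h.ne'

theorem orthonormalizer_smul (s : ℝ) (c : ℂ) (X : Mat23) :
    orthonormalizer s (c • X) = ((‖c‖ ^ 2 : ℝ) : ℂ) • orthonormalizer s X := by
  have h : (c • X) * (c • X)ᴴ = ((‖c‖ ^ 2 : ℝ) : ℂ) • (X * Xᴴ) := by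
    rw [Matrix.conjTranspose_smul, Matrix.smul_mul, Matrix.mul_smul, smul_smul]
    congr 1
    rw [← Complex.normSq_eq_norm_sq]
    exact Complex.mul_conj c
  rw [orthonormalizer, orthonormalizer, h, area_smul, Matrix.trace_smul, Matrix.adjugate_smul]
  ext i j
  simp
  ring

theorem orthonormalizer_zero (X : Mat23) : orthonormalizer 0 X = (X * Xᴴ).trace • 1 := by
  simp [orthonormalizer]

/-- Let `H = X Xᴴ` and `A² = det H`. Then `A + adj H` is a multiple of the inverse square root of
`H` for nondegenerate `X`: from `H adj H = A²` and `H + adj H = tr H` one gets `(A + adj H) H (A +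
adj H) = A² (tr H + 2A)`. -/
theorem orthonormalizer_one_mul (X : Mat23) : ∃ r : ℝ, (gramDet X ≠ 0 → 0 < r) ∧
    (orthonormalizer 1 X * X) * (orthonormalizer 1 X * X)ᴴ = (r : ℂ) • 1 := by
  refine ⟨area X ^ 2 * ((∑ i, ∑ j, Complex.normSq (X i j)) + 2 * area X), fun hX => ?_, ?_⟩
  · have hT := trace_mul_conjTranspose_pos hX
    have hA := area_pos hX
    positivity
  · have hH : (X * Xᴴ)ᴴ = X * Xᴴ := by simp
    have hO : (orthonormalizer 1 X)ᴴ = orthonormalizer 1 X := by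
      simp [orthonormalizer]
      rw [Matrix.adjugate_conjTranspose, hH]
    have hd := area_sq X
    have hT := trace_mul_conjTranspose X
    rw [Matrix.conjTranspose_mul, hO, Matrix.mul_assoc, ← Matrix.mul_assoc X]
    have hO2 : orthonormalizer 1 X = (area X : ℂ) • 1 + (X * Xᴴ).adjugate := by
      simp [orthonormalizer]
    rw [hO2]
    push_cast at hT ⊢
    rw [← hT]
    generalize X * Xᴴ = H at *
    rw [Matrix.det_fin_two] at hd
    ext i j
    fin_cases i <;> fin_cases j <;>
      simp [Matrix.mul_apply, Fin.sum_univ_two, Matrix.adjugate_fin_two, Matrix.trace_fin_two] <;>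
      grind

theorem orthonormalizer_of_frame {X : Mat23} {n : Fin 3 → ℝ} (h : IsFrameOf X n) (s : ℝ) :
    ∃ c : ℂ, orthonormalizer s X = c • 1 := by
  obtain ⟨-, -, r, -, hr⟩ := h
  exact ⟨_, by
    rw [orthonormalizer, hr, Matrix.adjugate_smul, Matrix.adjugate_one, smul_smul, ← add_smul]⟩

theorem continuous_orthonormalizer :
    Continuous fun x : ℝ × Mat23 => orthonormalizer x.1 x.2 := by
  have hn : Continuous fun x : ℝ × Mat23 => area x.2 := by
    unfold area normalVec
    simp only [Complex.normSq_eq_norm_sq]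
    fun_prop
  unfold orthonormalizer
  fun_prop

/-- The deformation of pairs of rows into frames. -/
noncomputable def deform (s : ℝ) (X : Mat23) : Mat23 :=
  orthonormalizer s (straighten (1 - s / 2) (s / 2) X) * straighten (1 - s / 2) (s / 2) X

theorem gramDet_deform_ne_zero {X : Mat23} (hX : gramDet X ≠ 0) {s : ℝ} (h0 : 0 ≤ s)
    (h1 : s ≤ 1) : gramDet (deform s X) ≠ 0 := by
  have h := gramDet_straighten_ne_zero hX (a := 1 - s / 2) (b := s / 2) (by linarith) (by linarith)
  rw [deform, gramDet_mul_left]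
  exact mul_ne_zero (pow_ne_zero _ (det_orthonormalizer_ne_zero h h0 h1)) h

/-- This homogeneity lets the deformation descend to rational maps. -/
theorem deform_smul (s : ℝ) {c : ℂ} (hc : c ≠ 0) {X : Mat23} (hX : gramDet X ≠ 0) :
    ∃ b : ℂ, deform s (c • X) = b • deform s X := by
  refine ⟨((‖c‖ ^ 2 : ℝ) : ℂ) * c, ?_⟩
  rw [deform, deform, straighten_smul _ _ hc hX, orthonormalizer_smul, Matrix.smul_mul,
    Matrix.mul_smul, smul_smul]

theorem exists_deform_zero (X : Mat23) : ∃ b : ℂ, deform 0 X = b • X :=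
  ⟨_, by
    rw [deform, zero_div, sub_zero, straighten_one_zero X, orthonormalizer_zero, Matrix.smul_mul,
      Matrix.one_mul]⟩

theorem exists_isFrameOf_deform_one {X : Mat23} (hX : gramDet X ≠ 0) :
    ∃ n, IsFrameOf (deform 1 X) n := by
  obtain ⟨n, hn, h⟩ := exists_straighten_half_mulVec hX
  have e : (1 : ℝ) - 1 / 2 = 1 / 2 := by norm_num
  obtain ⟨r, hr, h'⟩ := orthonormalizer_one_mul (straighten (1 / 2) (1 / 2) X)
  refine ⟨n, hn, ?_, r, hr (gramDet_straighten_ne_zero hX (by norm_num) (by norm_num)), ?_⟩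
  · rw [deform, e, ← Matrix.mulVec_mulVec, h, Matrix.mulVec_zero]
  · rw [deform, e, h']

theorem exists_deform_of_frame {X : Mat23} {n : Fin 3 → ℝ} (h : IsFrameOf X n) {s : ℝ}
    (h0 : 0 ≤ s) (h1 : s ≤ 1) : ∃ b : ℂ, deform s X = b • X := by
  obtain ⟨c, hc⟩ := straighten_of_real h (1 - s / 2) (s / 2)
  have h2 := gramDet_straighten_ne_zero h.gramDet_ne_zero (a := 1 - s / 2) (b := s / 2)
    (by linarith) (by linarith)
  rw [hc, gramDet_smul] at h2
  have hc0 : c ≠ 0 := by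
    rintro rfl
    simp at h2
  obtain ⟨d, hd⟩ := orthonormalizer_of_frame (h.smul hc0) s
  exact ⟨d * c, by rw [deform, hc, hd, Matrix.smul_mul, Matrix.one_mul, smul_smul]⟩

theorem ratMk_eq_of_eq_smul {X Y : NondegPair} {b : ℂ} (h : Y.1 = b • X.1) : ratMk X = ratMk Y := by
  refine (ratMk_eq_iff _ _).2 ⟨b, ?_, h⟩
  rintro rfl
  exact Y.2 (by rw [h, gramDet_smul]; simp)

/-- The deformation on nondegenerate pairs. -/
noncomputable def deformPair (s : unitInterval) (X : NondegPair) : NondegPair :=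
  ⟨deform s X.1, gramDet_deform_ne_zero X.2 s.2.1 s.2.2⟩

/-- The deformation of rational maps. -/
noncomputable def deformRat (s : unitInterval) (x : Rat2) : Rat2 :=
  ratMk (deformPair s (Function.surjInv isOpenQuotientMap_ratMk.surjective x))

theorem deformRat_ratMk (s : unitInterval) (X : NondegPair) :
    deformRat s (ratMk X) = ratMk (deformPair s X) := by
  obtain ⟨a, ha, e⟩ := (ratMk_eq_iff _ _).1
    (Function.surjInv_eq isOpenQuotientMap_ratMk.surjective (ratMk X))
  obtain ⟨b, hb⟩ := deform_smul s ha
    (Function.surjInv isOpenQuotientMap_ratMk.surjective (ratMk X)).2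
  refine ratMk_eq_of_eq_smul (b := b) ?_
  rw [← e] at hb
  exact hb

theorem continuous_deformRat : Continuous fun x : unitInterval × Rat2 => deformRat x.1 x.2 := by
  refine (IsOpenQuotientMap.id.prodMap isOpenQuotientMap_ratMk).isQuotientMap.continuous_iff.2 ?_
  have : (fun x : unitInterval × Rat2 => deformRat x.1 x.2) ∘ Prod.map id ratMk =
      fun x : unitInterval × NondegPair => ratMk (deformPair x.1 x.2) := by
    funext x
    exact deformRat_ratMk _ _
  rw [this]
  have hs : Continuous fun x : unitInterval × NondegPair =>
      straighten (1 - (x.1 : ℝ) / 2) ((x.1 : ℝ) / 2) x.2.1 :=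
    continuous_straighten (by fun_prop) (by fun_prop) (by fun_prop) fun x => x.2.2
  have ho := continuous_orthonormalizer.comp
    ((show Continuous fun x : unitInterval × NondegPair => (x.1 : ℝ) by fun_prop).prodMk hs)
  have h := ho.matrix_mul hs
  have h3 := isOpenQuotientMap_ratMk.continuous.comp
    (h.subtype_mk fun x => (deformPair x.1 x.2).2)
  exact h3

theorem isDeformationRetract_frameSet : IsDeformationRetract frameSet := by
  have h1 := continuous_deformRat.comp (Continuous.prodMk_right 1)
  refine ⟨⟨deformRat 1, h1⟩, fun x => ?_, ⟨?_⟩⟩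
  · obtain ⟨X, rfl⟩ := isOpenQuotientMap_ratMk.surjective x
    change deformRat 1 (ratMk X) ∈ frameSet
    rw [deformRat_ratMk, ratMk_mem_frameSet_iff]
    exact exists_isFrameOf_deform_one X.2
  · refine ⟨⟨⟨fun x => deformRat x.1 x.2, continuous_deformRat⟩, fun x => ?_, fun x => rfl⟩, ?_⟩
    · obtain ⟨X, rfl⟩ := isOpenQuotientMap_ratMk.surjective x
      change deformRat 0 (ratMk X) = ratMk X
      rw [deformRat_ratMk]
      obtain ⟨b, hb⟩ := exists_deform_zero X.1
      exact (ratMk_eq_of_eq_smul hb).symm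
    · rintro s x ⟨X, rfl, n, hn⟩
      change deformRat s (ratMk X) = ratMk X
      rw [deformRat_ratMk]
      obtain ⟨b, hb⟩ := exists_deform_of_frame hn s.2.1 s.2.2
      exact (ratMk_eq_of_eq_smul hb).symm

end Retraction

/-! ### A chart around the base frame -/

section Chart

open Quaternion Matrix

/-- The inverse of a chart of the space of frames: a parametrization near the base frame. -/
noncomputable def chartFrame (y : EuclideanSpace ℝ (Fin 5)) : Mat23 :=
  quatMat (quat 1 (y 2) (y 3) (y 4)) * planeFrame (y 0) (y 1)

/-- The (affine) coordinates of the normal of the plane of the rows. -/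
noncomputable def normalSlope (X : Mat23) (i : Fin 3) : ℝ := (normalVec X i * (normalVec X 2)⁻¹).re

/-- The matrix of the rows of `X` with respect to a standard frame, up to a factor. -/
noncomputable def coframe (X : Mat23) : Matrix (Fin 2) (Fin 2) ℂ :=
  X * (planeFrame (normalSlope X 0) (normalSlope X 1))ᵀ

/-- The coordinates of a frame near the base frame. -/
noncomputable def chartCoord (X : Mat23) : EuclideanSpace ℝ (Fin 5) :=
  !₂[normalSlope X 0, normalSlope X 1, ((coframe X 0 0 - coframe X 1 1) * (coframe X).trace⁻¹).im,
    (2 * coframe X 0 1 * (coframe X).trace⁻¹).re, (2 * coframe X 0 1 * (coframe X).trace⁻¹).im]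

/-- The domain on which the coordinates are smooth. -/
def chartDomain : Set Mat23 := {X | normalVec X 2 ≠ 0 ∧ (coframe X).trace ≠ 0}

theorem normalSlope_smul {c : ℂ} (hc : c ≠ 0) (X : Mat23) (i : Fin 3) :
    normalSlope (c • X) i = normalSlope X i := by
  simp only [normalSlope, normalVec_smul, Pi.smul_apply, smul_eq_mul]
  congr 1
  rw [mul_inv]
  field_simp

theorem coframe_smul {c : ℂ} (hc : c ≠ 0) (X : Mat23) : coframe (c • X) = c • coframe X := by
  rw [coframe, coframe, normalSlope_smul hc, normalSlope_smul hc, Matrix.smul_mul]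

theorem chartCoord_smul {c : ℂ} (hc : c ≠ 0) (X : Mat23) : chartCoord (c • X) = chartCoord X := by
  have h : ∀ z t : ℂ, c * z * (c * t)⁻¹ = z * t⁻¹ := fun z t => by
    rw [mul_inv]
    field_simp
  simp only [chartCoord, normalSlope_smul hc, coframe_smul hc, Matrix.smul_apply, Matrix.trace_smul,
    smul_eq_mul, ← mul_sub, mul_left_comm 2 c, h]

theorem smul_mem_chartDomain {c : ℂ} (hc : c ≠ 0) {X : Mat23} :
    c • X ∈ chartDomain ↔ X ∈ chartDomain := by
  simp [chartDomain, normalVec_smul, coframe_smul hc, hc]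

theorem normalVec_mul_left (A : Matrix (Fin 2) (Fin 2) ℂ) (X : Mat23) :
    normalVec (A * X) = A.det • normalVec X := by
  ext i
  fin_cases i <;>
    simp [normalVec, Matrix.mul_apply, Fin.sum_univ_two, Matrix.det_fin_two] <;> ring

theorem normalVec_planeFrame (x y : ℝ) : normalVec (planeFrame x y) =
    ((√(1 + x ^ 2 + y ^ 2) * (1 + x ^ 2) : ℝ) : ℂ) • cvec ![x, y, 1] := by
  ext i
  fin_cases i <;> simp [normalVec, planeFrame, cvec] <;> ring

/-- The entries are real, so transpose and conjugate transpose agree. Hence right multiplication by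
the transpose, as in `coframe`, recovers a left factor up to a scalar. -/
theorem planeFrame_mul_transpose (x y : ℝ) : planeFrame x y * (planeFrame x y)ᵀ =
    (((1 + x ^ 2 + y ^ 2) * (1 + x ^ 2) : ℝ) : ℂ) • 1 := by
  rw [← planeFrame_mul_conjTranspose]
  congr 1
  ext i j
  fin_cases i <;> fin_cases j <;> simp [planeFrame]

theorem normalVec_quatMat_mul_planeFrame {q : ℍ[ℝ]} (hq : q ≠ 0) (x y : ℝ) :
    ∃ r : ℂ, r ≠ 0 ∧ normalVec (quatMat q * planeFrame x y) = r • cvec ![x, y, 1] := by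
  refine ⟨_, ?_, by rw [normalVec_mul_left, normalVec_planeFrame, smul_smul]⟩
  have h1 : 0 < √(1 + x ^ 2 + y ^ 2) * (1 + x ^ 2) := by positivity
  have h2 : (q.re ^ 2 + q.imI ^ 2 + q.imJ ^ 2 + q.imK ^ 2) ≠ 0 := by
    have := Quaternion.normSq_def' q
    rw [← this]
    exact Quaternion.normSq_ne_zero.2 hq
  rw [quatMat_det]
  exact mul_ne_zero (by exact_mod_cast h2) (by exact_mod_cast h1.ne')

theorem normalSlope_quatMat_mul_planeFrame {q : ℍ[ℝ]} (hq : q ≠ 0) (x y : ℝ) (i : Fin 3) :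
    normalSlope (quatMat q * planeFrame x y) i = ![x, y, 1] i := by
  obtain ⟨r, hr, h⟩ := normalVec_quatMat_mul_planeFrame hq x y
  rw [normalSlope, h]
  have : (r • cvec ![x, y, 1]) i * ((r • cvec ![x, y, 1]) 2)⁻¹ = (![x, y, 1] i : ℝ) := by
    simp [cvec]
    field_simp
  rw [this, Complex.ofReal_re]

theorem coframe_quatMat_mul_planeFrame {q : ℍ[ℝ]} (hq : q ≠ 0) (x y : ℝ) :
    coframe (quatMat q * planeFrame x y) =
      (((1 + x ^ 2 + y ^ 2) * (1 + x ^ 2) : ℝ) : ℂ) • quatMat q := by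
  rw [coframe, normalSlope_quatMat_mul_planeFrame hq, normalSlope_quatMat_mul_planeFrame hq,
    Matrix.mul_assoc]
  change _ * (planeFrame x y * (planeFrame x y)ᵀ) = _
  rw [planeFrame_mul_transpose, Matrix.mul_smul, Matrix.mul_one]

theorem quatMat_trace (q : ℍ[ℝ]) : (quatMat q).trace = ((2 * q.re : ℝ) : ℂ) := by
  apply Complex.ext <;> simp [quatMat, Matrix.trace_fin_two]
  ring

theorem quatMat_mul_planeFrame_mem_chartDomain {q : ℍ[ℝ]} (hq : q ≠ 0) (x y : ℝ) :
    quatMat q * planeFrame x y ∈ chartDomain ↔ q.re ≠ 0 := by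
  obtain ⟨r, hr, h⟩ := normalVec_quatMat_mul_planeFrame hq x y
  have h1 : 0 < (1 + x ^ 2 + y ^ 2) * (1 + x ^ 2) := by positivity
  have h2 : normalVec (quatMat q * planeFrame x y) 2 ≠ 0 := by
    rw [h]
    simpa [cvec] using hr
  have h3 : (coframe (quatMat q * planeFrame x y)).trace =
      (((1 + x ^ 2 + y ^ 2) * (1 + x ^ 2) * (2 * q.re) : ℝ) : ℂ) := by
    rw [coframe_quatMat_mul_planeFrame hq, Matrix.trace_smul, quatMat_trace]
    push_cast
    rfl
  change _ ∧ _ ↔ _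
  rw [h3, Complex.ofReal_ne_zero]
  simp [h2, h1.ne']

/-- The scalar produced by `planeFrame` cancels in the ratios with the trace `2 re q`. What is left
are affine coordinates of `q` in the projective space of quaternions, in which `SO(3)` is an open
chart plus a plane at infinity. -/
theorem chartCoord_quatMat_mul_planeFrame {q : ℍ[ℝ]} (hq : q.re ≠ 0) (x y : ℝ) :
    chartCoord (quatMat q * planeFrame x y) =
      !₂[x, y, q.imI / q.re, q.imJ / q.re, q.imK / q.re] := by
  have hq0 : q ≠ 0 := by
    rintro rfl
    exact hq rfl
  have h1 : ((((1 + x ^ 2 + y ^ 2) * (1 + x ^ 2) : ℝ)) : ℂ) ≠ 0 := by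
    have : 0 < (1 + x ^ 2 + y ^ 2) * (1 + x ^ 2) := by positivity
    exact_mod_cast this.ne'
  have h : ∀ z : ℂ, (((1 + x ^ 2 + y ^ 2) * (1 + x ^ 2) : ℝ) : ℂ) * z *
      ((((1 + x ^ 2 + y ^ 2) * (1 + x ^ 2) : ℝ) : ℂ) * ((2 * q.re : ℝ) : ℂ))⁻¹ =
      ((2 * q.re)⁻¹ : ℝ) * z := fun z => by
    rw [mul_inv, Complex.ofReal_inv, mul_mul_mul_comm, mul_inv_cancel₀ h1, one_mul, mul_comm]
  simp only [chartCoord, normalSlope_quatMat_mul_planeFrame hq0, coframe_quatMat_mul_planeFrame hq0,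
    Matrix.smul_apply, Matrix.trace_smul, quatMat_trace, smul_eq_mul, ← mul_sub,
    mul_left_comm 2 ((((1 + x ^ 2 + y ^ 2) * (1 + x ^ 2) : ℝ)) : ℂ), h]
  ext i
  fin_cases i <;> simp [quatMat, -Complex.ofReal_inv, -Complex.ofReal_mul] <;> field_simp <;> ring

theorem chartFrame_mem (y : EuclideanSpace ℝ (Fin 5)) : chartFrame y ∈ chartDomain := by
  have h : quat 1 (y 2) (y 3) (y 4) ≠ 0 := fun h => one_ne_zero (congrArg QuaternionAlgebra.re h)
  exact (quatMat_mul_planeFrame_mem_chartDomain h _ _).2 one_ne_zero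

theorem chartCoord_chartFrame (y : EuclideanSpace ℝ (Fin 5)) : chartCoord (chartFrame y) = y := by
  rw [chartFrame, chartCoord_quatMat_mul_planeFrame one_ne_zero]
  ext i
  fin_cases i <;> simp

theorem exists_isFrameOf_chartFrame (y : EuclideanSpace ℝ (Fin 5)) :
    ∃ n, IsFrameOf (chartFrame y) n := by
  obtain ⟨hn, hXn, r, hr, hXr⟩ := isFrameOf_planeFrame (y 0) (y 1)
  refine ⟨_, hn, by rw [chartFrame, ← Matrix.mulVec_mulVec, hXn, Matrix.mulVec_zero],
    r * (1 + y 2 ^ 2 + y 3 ^ 2 + y 4 ^ 2), by positivity, ?_⟩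
  rw [chartFrame, Matrix.conjTranspose_mul, Matrix.mul_assoc, ← Matrix.mul_assoc (planeFrame _ _),
    hXr, Matrix.smul_mul, Matrix.one_mul, Matrix.mul_smul, quatMat_mul_conjTranspose, smul_smul]
  simp

/-- With its normal scaled to `(x, y, 1)`, the frame is a scalar times a unit quaternion times
`planeFrame x y`. The domain condition says that the real part of the quaternion is nonzero, so it
can be scaled to 1. -/
theorem chartFrame_chartCoord {X : Mat23} {n : Fin 3 → ℝ} (hX : IsFrameOf X n)
    (hd : X ∈ chartDomain) : ∃ c : ℂ, c ≠ 0 ∧ X = c • chartFrame (chartCoord X) := by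
  obtain ⟨b, hb⟩ := hX.normalVec_eq
  have hn2 : n 2 ≠ 0 := by
    intro h
    apply hd.1
    rw [hb]
    simp [cvec, h]
  have h1 := hX.smul_normal (inv_ne_zero hn2)
  have e : (n 2)⁻¹ • n = ![n 0 / n 2, n 1 / n 2, 1] := by
    ext i
    fin_cases i <;> simp <;> field_simp
  rw [e] at h1
  obtain ⟨l, q, hl, rfl⟩ := (isFrameOf_planeFrame _ _).exists_eq_smul h1
  have hq : q.1 ≠ 0 := fun h => by
    have := S3.normSq_eq q
    simp [h] at this
  rw [smul_mem_chartDomain hl, quatMat_mul_planeFrame_mem_chartDomain hq] at hd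
  rw [chartCoord_smul hl, chartCoord_quatMat_mul_planeFrame hd]
  refine ⟨l * q.1.re, mul_ne_zero hl (by exact_mod_cast hd), ?_⟩
  have : quatMat q.1 = (q.1.re : ℂ) •
      quatMat (quat 1 (q.1.imI / q.1.re) (q.1.imJ / q.1.re) (q.1.imK / q.1.re)) := by
    have hd' : (q.1.re : ℂ) ≠ 0 := by exact_mod_cast hd
    ext i j
    fin_cases i <;> fin_cases j <;> apply Complex.ext <;> simp [quatMat] <;> field_simp
  rw [← smul_smul, chartFrame, this, Matrix.smul_mul]
  rfl

end Chart

/-! ### Smoothness of the parametrization and of the coordinates -/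

section SmoothStructure

open Quaternion Matrix

variable {T : Type*} [NormedAddCommGroup T] [NormedSpace ℝ T]

/-- A family of matrices all of whose entries are smooth functions. -/
def SmoothEntriesAt {m n : Type*} (X : T → Matrix m n ℂ) (t : T) : Prop :=
  ∀ i j, ContDiffAt ℝ ∞ (fun s => X s i j) t

theorem SmoothEntriesAt.mul {l m n : Type*} [Fintype m] {X : T → Matrix l m ℂ}
    {Y : T → Matrix m n ℂ} {t : T} (hX : SmoothEntriesAt X t) (hY : SmoothEntriesAt Y t) :
    SmoothEntriesAt (fun s => X s * Y s) t := fun i j => by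
  simp only [Matrix.mul_apply]
  exact ContDiffAt.sum fun k _ => (hX i k).mul (hY k j)

theorem SmoothEntriesAt.transpose {m n : Type*} {X : T → Matrix m n ℂ} {t : T}
    (hX : SmoothEntriesAt X t) : SmoothEntriesAt (fun s => (X s)ᵀ) t := fun i j => hX j i

theorem smoothEntriesAt_const {m n : Type*} (X : Matrix m n ℂ) (t : T) :
    SmoothEntriesAt (fun _ => X) t := fun _ _ => contDiffAt_const

theorem contDiffAt_ofReal {f : T → ℝ} {t : T} (hf : ContDiffAt ℝ ∞ f t) :
    ContDiffAt ℝ ∞ (fun s => (f s : ℂ)) t :=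
  Complex.ofRealCLM.contDiff.contDiffAt.comp t hf

theorem contDiffAt_re {f : T → ℂ} {t : T} (hf : ContDiffAt ℝ ∞ f t) :
    ContDiffAt ℝ ∞ (fun s => (f s).re) t :=
  Complex.reCLM.contDiff.contDiffAt.comp t hf

theorem contDiffAt_im {f : T → ℂ} {t : T} (hf : ContDiffAt ℝ ∞ f t) :
    ContDiffAt ℝ ∞ (fun s => (f s).im) t :=
  Complex.imCLM.contDiff.contDiffAt.comp t hf

theorem contDiffAt_complex_mk {f g : T → ℝ} {t : T} (hf : ContDiffAt ℝ ∞ f t)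
    (hg : ContDiffAt ℝ ∞ g t) : ContDiffAt ℝ ∞ (fun s => (⟨f s, g s⟩ : ℂ)) t := by
  simp only [Complex.mk_eq_add_mul_I]
  exact (contDiffAt_ofReal hf).add ((contDiffAt_ofReal hg).mul contDiffAt_const)

theorem smoothEntriesAt_quatMat {a b c d : T → ℝ} {t : T} (ha : ContDiffAt ℝ ∞ a t)
    (hb : ContDiffAt ℝ ∞ b t) (hc : ContDiffAt ℝ ∞ c t) (hd : ContDiffAt ℝ ∞ d t) :
    SmoothEntriesAt (fun s => quatMat (quat (a s) (b s) (c s) (d s))) t := fun i j => by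
  fin_cases i <;> fin_cases j
  · exact contDiffAt_complex_mk ha hb
  · exact contDiffAt_complex_mk hc hd
  · exact contDiffAt_complex_mk hc.neg hd
  · exact contDiffAt_complex_mk ha hb.neg

theorem smoothEntriesAt_planeFrame {a b : T → ℝ} {t : T} (ha : ContDiffAt ℝ ∞ a t)
    (hb : ContDiffAt ℝ ∞ b t) : SmoothEntriesAt (fun s => planeFrame (a s) (b s)) t := by
  have hr : ContDiffAt ℝ ∞ (fun s => √(1 + a s ^ 2 + b s ^ 2)) t :=
    ((contDiffAt_const.add (ha.pow 2)).add (hb.pow 2)).sqrt (by positivity)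
  have hr' := contDiffAt_ofReal hr
  have ha' := contDiffAt_ofReal ha
  have hb' := contDiffAt_ofReal hb
  intro i j
  fin_cases i <;> fin_cases j
  · exact hr'
  · exact contDiffAt_const
  · exact (hr'.mul ha').neg
  · exact (ha'.mul hb').neg
  · exact contDiffAt_const.add (ha'.pow 2)
  · exact hb'.neg

theorem smoothEntriesAt_chartFrame (y : EuclideanSpace ℝ (Fin 5)) :
    SmoothEntriesAt chartFrame y := by
  have h : ∀ i, ContDiffAt ℝ ∞ (fun y : EuclideanSpace ℝ (Fin 5) => y i) y := fun i => by fun_prop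
  exact (smoothEntriesAt_quatMat contDiffAt_const (h 2) (h 3) (h 4)).mul
    (smoothEntriesAt_planeFrame (h 0) (h 1))

theorem SmoothEntriesAt.frameAct {X : T → Mat23} {t : T} (hX : SmoothEntriesAt X t)
    (k : S3 × SO3) : SmoothEntriesAt (fun s => frameAct k (X s)) t :=
  ((smoothEntriesAt_const _ t).mul hX).mul (smoothEntriesAt_const _ t)

theorem SmoothEntriesAt.normalVec {X : T → Mat23} {t : T} (hX : SmoothEntriesAt X t) (i : Fin 3) :
    ContDiffAt ℝ ∞ (fun s => normalVec (X s) i) t := by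
  fin_cases i
  · exact ((hX 0 1).mul (hX 1 2)).sub ((hX 0 2).mul (hX 1 1))
  · exact ((hX 0 2).mul (hX 1 0)).sub ((hX 0 0).mul (hX 1 2))
  · exact ((hX 0 0).mul (hX 1 1)).sub ((hX 0 1).mul (hX 1 0))

theorem SmoothEntriesAt.normalSlope {X : T → Mat23} {t : T} (hX : SmoothEntriesAt X t)
    (h0 : _root_.normalVec (X t) 2 ≠ 0) (i : Fin 3) :
    ContDiffAt ℝ ∞ (fun s => normalSlope (X s) i) t :=
  contDiffAt_re ((hX.normalVec i).mul ((hX.normalVec 2).inv h0))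

theorem SmoothEntriesAt.coframe {X : T → Mat23} {t : T} (hX : SmoothEntriesAt X t)
    (h0 : _root_.normalVec (X t) 2 ≠ 0) : SmoothEntriesAt (fun s => coframe (X s)) t :=
  hX.mul (smoothEntriesAt_planeFrame (hX.normalSlope h0 0) (hX.normalSlope h0 1)).transpose

theorem SmoothEntriesAt.trace_coframe {X : T → Mat23} {t : T} (hX : SmoothEntriesAt X t)
    (h0 : _root_.normalVec (X t) 2 ≠ 0) :
    ContDiffAt ℝ ∞ (fun s => (_root_.coframe (X s)).trace) t := by
  simp only [Matrix.trace_fin_two]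
  exact (hX.coframe h0 0 0).add (hX.coframe h0 1 1)

/-- `X` ranges over arbitrary matrices near the point, not only over frames. This extension is what
the proof of immersivity differentiates. -/
theorem SmoothEntriesAt.chartCoord {X : T → Mat23} {t : T} (hX : SmoothEntriesAt X t)
    (h : X t ∈ chartDomain) : ContDiffAt ℝ ∞ (fun s => chartCoord (X s)) t := by
  have hB := hX.coframe h.1
  have hT := (hX.trace_coframe h.1).inv h.2
  refine contDiffAt_euclidean.2 fun i => ?_
  fin_cases i
  · exact hX.normalSlope h.1 0
  · exact hX.normalSlope h.1 1
  · exact contDiffAt_im (((hB 0 0).sub (hB 1 1)).mul hT)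
  · exact contDiffAt_re ((contDiffAt_const.mul (hB 0 1)).mul hT)
  · exact contDiffAt_im ((contDiffAt_const.mul (hB 0 1)).mul hT)

theorem SmoothEntriesAt.eventually_mem_chartDomain {X : T → Mat23} {t : T}
    (hX : SmoothEntriesAt X t) (h : X t ∈ chartDomain) : ∀ᶠ s in 𝓝 t, X s ∈ chartDomain :=
  ((hX.normalVec 2).continuousAt.eventually_ne h.1).and
    ((hX.trace_coframe h.1).continuousAt.eventually_ne h.2)

theorem smoothEntriesAt_coeffs_symm (c : Fin 6 → ℂ) :
    SmoothEntriesAt (fun c => coeffs.symm c) c := by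
  intro i j
  simp only [coeffs_symm_apply]
  fin_cases i <;> fin_cases j <;> simp <;> fun_prop

theorem SmoothEntriesAt.coeffs {X : T → Mat23} {t : T} (hX : SmoothEntriesAt X t) :
    ContDiffAt ℝ ∞ (fun s => coeffs (X s)) t := by
  refine contDiffAt_pi.2 fun i => ?_
  simp only [coeffs_apply, div_eq_mul_inv]
  fin_cases i
  · exact ((hX 0 1).sub (contDiffAt_const.mul (hX 0 2))).mul contDiffAt_const
  · exact hX 0 0
  · exact ((hX 0 1).neg.sub (contDiffAt_const.mul (hX 0 2))).mul contDiffAt_const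
  · exact ((hX 1 1).sub (contDiffAt_const.mul (hX 1 2))).mul contDiffAt_const
  · exact hX 1 0
  · exact ((hX 1 1).neg.sub (contDiffAt_const.mul (hX 1 2))).mul contDiffAt_const

theorem isOpen_chartDomain : IsOpen chartDomain := by
  have : chartDomain = coeffs ⁻¹' {c | coeffs.symm c ∈ chartDomain} := by
    ext X
    simp
  rw [this]
  refine IsOpen.preimage continuous_coeffs (isOpen_iff_mem_nhds.2 fun c hc => ?_)
  exact (smoothEntriesAt_coeffs_symm c).eventually_mem_chartDomain hc

theorem continuousOn_chartCoord : ContinuousOn chartCoord chartDomain := by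
  intro X hX
  have h : ContinuousAt (fun c => chartCoord (coeffs.symm c)) (coeffs X) :=
    ((smoothEntriesAt_coeffs_symm _).chartCoord (by simpa using hX)).continuousAt
  have h' := h.comp continuous_coeffs.continuousAt
  simp only [Function.comp_def, LinearEquiv.symm_apply_apply] at h'
  exact h'.continuousWithinAt

theorem continuous_chartFrame : Continuous chartFrame :=
  continuous_matrix fun i j => continuous_iff_continuousAt.2 fun y =>
    (smoothEntriesAt_chartFrame y i j).continuousAt

end SmoothStructure

/-! ### The atlas of translated charts and the immersion into projective space -/

section FrameAtlas

open Quaternion Matrix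

/-- The frame with the given coordinates. -/
noncomputable def Frame.param (y : EuclideanSpace ℝ (Fin 5)) : Frame :=
  ⟨chartFrame y, exists_isFrameOf_chartFrame y⟩

/-- The coordinates of a rational map near the base point. -/
noncomputable def frameCoord (m : frameSet) : EuclideanSpace ℝ (Fin 5) :=
  chartCoord (Function.surjInv frameMk_surjective m).1

theorem frameCoord_frameMk (X : Frame) : frameCoord (frameMk X) = chartCoord X.1 := by
  obtain ⟨a, ha, e⟩ := (frameMk_eq_iff _ _).1
    (Function.surjInv_eq frameMk_surjective (frameMk X))
  rw [frameCoord, e, chartCoord_smul ha]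

/-- The domain of the coordinates near the base point. -/
def frameDomain : Set frameSet := {m | (Function.surjInv frameMk_surjective m).1 ∈ chartDomain}

theorem frameMk_mem_frameDomain (X : Frame) : frameMk X ∈ frameDomain ↔ X.1 ∈ chartDomain := by
  obtain ⟨a, ha, e⟩ := (frameMk_eq_iff _ _).1
    (Function.surjInv_eq frameMk_surjective (frameMk X))
  rw [frameDomain, Set.mem_ofPred_eq, e, smul_mem_chartDomain ha]

theorem frameMk_preimage_frameDomain :
    frameMk ⁻¹' frameDomain = Subtype.val ⁻¹' chartDomain :=
  Set.ext frameMk_mem_frameDomain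

theorem isOpen_frameDomain : IsOpen frameDomain := by
  rw [← isOpenQuotientMap_frameMk.isQuotientMap.isOpen_preimage, frameMk_preimage_frameDomain]
  exact isOpen_chartDomain.preimage continuous_subtype_val

/-- The chart at the base point. -/
noncomputable def baseChart : OpenPartialHomeomorph frameSet (EuclideanSpace ℝ (Fin 5)) where
  toFun := frameCoord
  invFun y := frameMk (.param y)
  source := frameDomain
  target := Set.univ
  map_source' _ _ := Set.mem_univ _
  map_target' y _ := (frameMk_mem_frameDomain _).2 (chartFrame_mem y)
  left_inv' m hm := by
    obtain ⟨X, rfl⟩ := frameMk_surjective m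
    rw [frameCoord_frameMk]
    obtain ⟨c, hc, e⟩ := chartFrame_chartCoord X.2.choose_spec ((frameMk_mem_frameDomain X).1 hm)
    exact (frameMk_eq_iff _ _).2 ⟨c, hc, e⟩
  right_inv' y _ := by
    rw [frameCoord_frameMk]
    exact chartCoord_chartFrame y
  open_source := isOpen_frameDomain
  open_target := isOpen_univ
  continuousOn_toFun := by
    refine (isOpenQuotientMap_frameMk.isQuotientMap.continuousOn_isOpen_iff
      isOpen_frameDomain).2 ?_
    rw [frameMk_preimage_frameDomain, show frameCoord ∘ frameMk = fun X => chartCoord X.1 from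
      funext frameCoord_frameMk]
    exact continuousOn_chartCoord.comp continuous_subtype_val.continuousOn fun _ h => h
  continuousOn_invFun :=
    (isOpenQuotientMap_frameMk.continuous.comp
      (continuous_chartFrame.subtype_mk _)).continuousOn

/-- The homeomorphism of the space of frames given by a pair of rotations. -/
noncomputable def pairHomeomorph (k : S3 × SO3) : frameSet ≃ₜ frameSet where
  toFun := pairAct k
  invFun := pairAct k⁻¹
  left_inv m := by rw [← pairAct_mul, inv_mul_cancel, pairAct_one]
  right_inv m := by rw [← pairAct_mul, mul_inv_cancel, pairAct_one]
  continuous_toFun := by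
    have h := continuous_pairAct.comp (Continuous.prodMk_right k)
    exact h
  continuous_invFun := by
    have h := continuous_pairAct.comp (Continuous.prodMk_right k⁻¹)
    exact h

/-- The translate of the chart at the base point by a pair of rotations. -/
noncomputable def frameChart (k : S3 × SO3) :
    OpenPartialHomeomorph frameSet (EuclideanSpace ℝ (Fin 5)) :=
  (pairHomeomorph k).symm.transOpenPartialHomeomorph baseChart

theorem frameChart_apply (k : S3 × SO3) (m : frameSet) :
    frameChart k m = frameCoord (pairAct k⁻¹ m) := rfl

theorem frameChart_symm_apply (k : S3 × SO3) (y : EuclideanSpace ℝ (Fin 5)) :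
    (frameChart k).symm y = pairAct k (frameMk (.param y)) := rfl

theorem mem_frameChart_source (k : S3 × SO3) (m : frameSet) :
    m ∈ (frameChart k).source ↔ pairAct k⁻¹ m ∈ frameDomain := Iff.rfl

theorem frameChart_target (k : S3 × SO3) : (frameChart k).target = Set.univ := rfl

theorem pairAct_symm_apply (k l : S3 × SO3) (y : EuclideanSpace ℝ (Fin 5)) :
    pairAct l⁻¹ ((frameChart k).symm y) = frameMk ((Frame.param y).act (l⁻¹ * k)) := by
  rw [frameChart_symm_apply, ← pairAct_mul, pairAct_frameMk]

/-- Coordinate changes are the group action read in the single base chart, and depend only on `l⁻¹ *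
k`. -/
theorem frameChart_transition (k l : S3 × SO3) (y : EuclideanSpace ℝ (Fin 5)) :
    frameChart l ((frameChart k).symm y) = chartCoord (frameAct (l⁻¹ * k) (chartFrame y)) := by
  rw [frameChart_apply, pairAct_symm_apply, frameCoord_frameMk]
  rfl

theorem symm_mem_frameChart_source (k l : S3 × SO3) (y : EuclideanSpace ℝ (Fin 5)) :
    (frameChart k).symm y ∈ (frameChart l).source ↔
      frameAct (l⁻¹ * k) (chartFrame y) ∈ chartDomain := by
  rw [mem_frameChart_source, pairAct_symm_apply, frameMk_mem_frameDomain]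
  rfl

/-- A pair of rotations taking the base point to a given point. -/
noncomputable def chartIndex (m : frameSet) : S3 × SO3 := (exists_pairAct_base m).choose

theorem baseFrame_eq : baseFrame = chartFrame 0 := by
  ext i j
  fin_cases i <;> fin_cases j <;>
    simp [baseFrame, chartFrame, quatMat, planeFrame, Matrix.mul_apply, Complex.ext_iff]

theorem mem_frameChart_chartIndex (m : frameSet) : m ∈ (frameChart (chartIndex m)).source := by
  have h : pairAct (chartIndex m) (frameMk .base) = m := (exists_pairAct_base m).choose_spec
  rw [mem_frameChart_source]
  generalize chartIndex m = k at h ⊢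
  rw [← h, ← pairAct_mul, inv_mul_cancel, pairAct_one, frameMk_mem_frameDomain]
  change baseFrame ∈ _
  rw [baseFrame_eq]
  exact chartFrame_mem 0

noncomputable instance frameChartedSpace : ChartedSpace (EuclideanSpace ℝ (Fin 5)) frameSet where
  atlas := Set.range frameChart
  chartAt m := frameChart (chartIndex m)
  mem_chart_source := mem_frameChart_chartIndex
  chart_mem_atlas _ := ⟨_, rfl⟩

theorem contDiffAt_transition (k : S3 × SO3) {y : EuclideanSpace ℝ (Fin 5)}
    (h : frameAct k (chartFrame y) ∈ chartDomain) :
    ContDiffAt ℝ ∞ (fun y => chartCoord (frameAct k (chartFrame y))) y :=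
  ((smoothEntriesAt_chartFrame y).frameAct k).chartCoord h

theorem mem_symm_trans_source {M H : Type*} [TopologicalSpace M] [TopologicalSpace H]
    (e e' : OpenPartialHomeomorph M H) (y : H) :
    y ∈ (e.symm ≫ₕ e').source ↔ y ∈ e.target ∧ e.symm y ∈ e'.source := by
  rw [OpenPartialHomeomorph.trans_source, Set.mem_inter_iff, Set.mem_preimage]
  rfl

theorem coe_transition (k l : S3 × SO3) : ⇑((frameChart k).symm ≫ₕ frameChart l) =
    fun y => chartCoord (frameAct (l⁻¹ * k) (chartFrame y)) := by
  funext y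
  rw [OpenPartialHomeomorph.coe_trans, Function.comp_apply, frameChart_transition]

theorem contDiffOn_transition (k l : S3 × SO3) :
    ContDiffOn ℝ ∞ ((frameChart k).symm ≫ₕ frameChart l)
      ((frameChart k).symm ≫ₕ frameChart l).source := by
  intro y hy
  rw [coe_transition]
  have h := (symm_mem_frameChart_source k l y).1 ((mem_symm_trans_source _ _ _).1 hy).2
  exact (contDiffAt_transition (l⁻¹ * k) h).contDiffWithinAt

instance frameIsManifold : IsManifold (𝓡 5) ∞ frameSet := by
  refine isManifold_of_contDiffOn _ _ _ ?_
  rintro _ _ ⟨k, rfl⟩ ⟨l, rfl⟩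
  have h := contDiffOn_transition k l
  simpa using h

/-- The homogeneous coordinates of the rational maps in the domain of a chart. -/
noncomputable def paramVec (k : S3 × SO3) (y : EuclideanSpace ℝ (Fin 5)) : Fin 6 → ℂ :=
  coeffs (frameAct k (chartFrame y))

theorem contDiff_paramVec (k : S3 × SO3) : ContDiff ℝ ∞ (paramVec k) :=
  contDiff_iff_contDiffAt.2 fun y => ((smoothEntriesAt_chartFrame y).frameAct k).coeffs

/-- The coordinates, as a function of homogeneous coordinates. -/
noncomputable def coordVec (k : S3 × SO3) (c : Fin 6 → ℂ) : EuclideanSpace ℝ (Fin 5) :=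
  chartCoord (frameAct k⁻¹ (coeffs.symm c))

theorem frameAct_inv_coeffs_symm (k : S3 × SO3) (y : EuclideanSpace ℝ (Fin 5)) :
    frameAct k⁻¹ (coeffs.symm (paramVec k y)) = chartFrame y := by
  rw [paramVec, LinearEquiv.symm_apply_apply, ← frameAct_mul, inv_mul_cancel, frameAct_one]

theorem coordVec_paramVec (k : S3 × SO3) (y : EuclideanSpace ℝ (Fin 5)) :
    coordVec k (paramVec k y) = y := by
  rw [coordVec, frameAct_inv_coeffs_symm, chartCoord_chartFrame]

theorem contDiffAt_coordVec (k : S3 × SO3) (y : EuclideanSpace ℝ (Fin 5)) :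
    ContDiffAt ℝ ∞ (coordVec k) (paramVec k y) :=
  ((smoothEntriesAt_coeffs_symm _).frameAct k⁻¹).chartCoord (by
    rw [frameAct_inv_coeffs_symm]
    exact chartFrame_mem y)

theorem coordVec_smul (k : S3 × SO3) {a : ℂ} (ha : a ≠ 0) (c : Fin 6 → ℂ) :
    coordVec k (a • c) = coordVec k c := by
  rw [coordVec, map_smul, frameAct_smul, chartCoord_smul ha, coordVec]

/-- The derivative of the parametrization is injective modulo the complex line of the point. -/
theorem fderiv_paramVec_injective (k : S3 × SO3) (y ξ : EuclideanSpace ℝ (Fin 5))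
    (h : fderiv ℝ (paramVec k) y ξ ∈ Submodule.span ℂ {paramVec k y}) : ξ = 0 := by
  obtain ⟨c, hc⟩ := Submodule.mem_span_singleton.1 h
  -- `coordVec k` is a left inverse of `paramVec k`, so its derivative takes the image of `ξ` back
  -- to `ξ`. It is also invariant under complex scaling, so its derivative kills the complex line of
  -- the point.
  have hG : HasFDerivAt (coordVec k) (fderiv ℝ (coordVec k) (paramVec k y)) (paramVec k y) :=
    ((contDiffAt_coordVec k y).differentiableAt (by simp)).hasFDerivAt
  have hP : HasFDerivAt (paramVec k) (fderiv ℝ (paramVec k) y) y :=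
    ((contDiff_paramVec k).differentiable (by simp) y).hasFDerivAt
  have h1 := hG.comp y hP
  rw [show coordVec k ∘ paramVec k = id from funext (coordVec_paramVec k)] at h1
  have h2 := congrArg (fun A => A ξ) (h1.unique (hasFDerivAt_id y))
  simp only [ContinuousLinearMap.comp_apply, ContinuousLinearMap.id_apply, ← hc] at h2
  have hl : HasDerivAt (fun t : ℝ => paramVec k y + t • (c • paramVec k y))
      (c • paramVec k y) 0 := by
    simpa using ((hasDerivAt_id (0 : ℝ)).smul_const (c • paramVec k y)).const_add (paramVec k y)
  have hG' : HasFDerivAt (coordVec k) (fderiv ℝ (coordVec k) (paramVec k y))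
      (paramVec k y + (0 : ℝ) • (c • paramVec k y)) := by simpa using hG
  have h3 := hG'.comp_hasDerivAt (0 : ℝ) hl
  have h4 : (fun t : ℝ => coordVec k (paramVec k y + t • (c • paramVec k y))) =ᶠ[𝓝 0]
      fun _ => coordVec k (paramVec k y) := by
    have hne : ∀ᶠ t : ℝ in 𝓝 0, (1 + t * c : ℂ) ≠ 0 := by
      have hcont : ContinuousAt (fun t : ℝ => (1 + t * c : ℂ)) 0 := by fun_prop
      exact hcont.eventually_ne (by simp)
    filter_upwards [hne] with t ht
    have : paramVec k y + t • (c • paramVec k y) = (1 + t * c : ℂ) • paramVec k y := by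
      rw [add_smul, one_smul, mul_smul]
      rfl
    rw [this, coordVec_smul k ht]
  have h5 := h3.unique ((hasDerivAt_const (0 : ℝ) _).congr_of_eventuallyEq h4)
  rw [← h2, h5]

theorem coe_symm_frameChart (k : S3 × SO3) (y : EuclideanSpace ℝ (Fin 5)) :
    ∃ h : paramVec k y ≠ 0, (((frameChart k).symm y : frameSet) : Rat2).1 =
      Projectivization.mk ℂ (paramVec k y) h := by
  rw [frameChart_symm_apply, pairAct_frameMk]
  exact ⟨_, rfl⟩

theorem isSmoothImmersionToProj_frameSet :
    IsSmoothImmersionToProj 5 (fun m : frameSet => (m : Rat2).1) := by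
  intro m
  set k := chartIndex m with hk
  have hv : ContMDiffOn (𝓡 5) 𝓘(ℝ, Fin 6 → ℂ) ∞ (fun m' => paramVec k (frameChart k m'))
      (frameChart k).source :=
    (contDiff_paramVec k).contMDiff.comp_contMDiffOn
      (contMDiffOn_of_mem_maximalAtlas (IsManifold.subset_maximalAtlas ⟨k, rfl⟩))
  have hm : m ∈ (frameChart k).source := mem_frameChart_chartIndex m
  refine ⟨(frameChart k).source, fun m' => paramVec k (frameChart k m'),
    (frameChart k).open_source, hm, hv, fun m' hm' => ?_, fun ξ hξ => ?_⟩
  · have := coe_symm_frameChart k (frameChart k m')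
    rwa [(frameChart k).left_inv hm'] at this
  · have hd : MDifferentiableAt (𝓡 5) 𝓘(ℝ, Fin 6 → ℂ) (fun m' => paramVec k (frameChart k m')) m :=
      ((hv.contMDiffAt ((frameChart k).open_source.mem_nhds hm)).mdifferentiableAt (by simp))
    rw [hd.mfderiv] at hξ
    -- The preferred chart at `m` is `frameChart k` itself, with full target, so the coordinate
    -- expression is `paramVec k` everywhere.
    have e : writtenInExtChartAt (𝓡 5) 𝓘(ℝ, Fin 6 → ℂ) m
        (fun m' => paramVec k (frameChart k m')) = paramVec k := by
      funext y
      change paramVec k (frameChart k ((frameChart k).symm y)) = _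
      rw [(frameChart k).right_inv (Set.mem_univ _)]
    rw [e] at hξ
    have e2 : Set.range (𝓡 5) = Set.univ := by simp
    rw [e2, fderivWithin_univ] at hξ
    exact fderiv_paramVec_injective k _ ξ hξ

end FrameAtlas

/-! ### Signs of charts in an oriented manifold -/

section Orientation

open IsManifold

variable {n : ℕ} {M : Type*} [TopologicalSpace M]

/-- The Jacobian determinant of a coordinate change. -/
noncomputable def chartJacobian (e e' : OpenPartialHomeomorph M (EuclideanSpace ℝ (Fin n)))
    (x : EuclideanSpace ℝ (Fin n)) : ℝ :=
  (fderiv ℝ (e.symm ≫ₕ e') x).det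

/-- All coordinate changes from `e` to a chart of `A` have positive Jacobian. -/
def IsPositiveChart (A : Set (OpenPartialHomeomorph M (EuclideanSpace ℝ (Fin n))))
    (e : OpenPartialHomeomorph M (EuclideanSpace ℝ (Fin n))) : Prop :=
  ∀ a ∈ A, ∀ x ∈ (e.symm ≫ₕ a).source, 0 < chartJacobian e a x

variable {A : Set (OpenPartialHomeomorph M (EuclideanSpace ℝ (Fin n)))}
  {e e' f : OpenPartialHomeomorph M (EuclideanSpace ℝ (Fin n))}

theorem chartJacobian_self {x : EuclideanSpace ℝ (Fin n)} (hx : x ∈ e.target) :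
    chartJacobian e e x = 1 := by
  have h : (e.symm ≫ₕ e) =ᶠ[𝓝 x] id := by
    filter_upwards [e.open_target.mem_nhds hx] with z hz
    simp [e.right_inv hz]
  rw [chartJacobian, h.fderiv_eq, fderiv_id]
  exact LinearMap.det_id

variable [ChartedSpace (EuclideanSpace ℝ (Fin n)) M]

theorem contDiffAt_of_mem_maximalAtlas (he : e ∈ maximalAtlas (𝓡 n) ∞ M)
    (he' : e' ∈ maximalAtlas (𝓡 n) ∞ M) {x : EuclideanSpace ℝ (Fin n)}
    (hx : x ∈ (e.symm ≫ₕ e').source) : ContDiffAt ℝ ∞ (e.symm ≫ₕ e') x :=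
  (contMDiffOn_of_mem_contDiffGroupoid
    (compatible_of_mem_maximalAtlas he he')).contDiffOn.contDiffAt
    ((e.symm ≫ₕ e').open_source.mem_nhds hx)

theorem chartJacobian_mul (he : e ∈ maximalAtlas (𝓡 n) ∞ M) (he' : e' ∈ maximalAtlas (𝓡 n) ∞ M)
    (hf : f ∈ maximalAtlas (𝓡 n) ∞ M) {x : EuclideanSpace ℝ (Fin n)}
    (hx : x ∈ (e.symm ≫ₕ e').source) (hxf : x ∈ (e.symm ≫ₕ f).source) :
    chartJacobian e f x = chartJacobian e' f (e' (e.symm x)) * chartJacobian e e' x := by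
  have hx' := (mem_symm_trans_source _ _ _).1 hx
  have hxf' := (mem_symm_trans_source _ _ _).1 hxf
  have hy : e' (e.symm x) ∈ (e'.symm ≫ₕ f).source := by
    rw [mem_symm_trans_source, e'.left_inv hx'.2]
    exact ⟨e'.map_source hx'.2, hxf'.2⟩
  have h1 := ((contDiffAt_of_mem_maximalAtlas he he' hx).differentiableAt (by simp)).hasFDerivAt
  have h2 : HasFDerivAt (e'.symm ≫ₕ f) (fderiv ℝ (e'.symm ≫ₕ f) (e' (e.symm x)))
      ((e.symm ≫ₕ e') x) :=
    ((contDiffAt_of_mem_maximalAtlas he' hf hy).differentiableAt (by simp)).hasFDerivAt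
  have h3 := h2.comp x h1
  have h4 : (e.symm ≫ₕ f) =ᶠ[𝓝 x] (e'.symm ≫ₕ f) ∘ (e.symm ≫ₕ e') := by
    filter_upwards [(e.symm ≫ₕ e').open_source.mem_nhds hx] with z hz
    simp [e'.left_inv ((mem_symm_trans_source _ _ _).1 hz).2]
  rw [chartJacobian, (h3.congr_of_eventuallyEq h4).fderiv]
  exact LinearMap.det_comp _ _

theorem chartJacobian_ne_zero (he : e ∈ maximalAtlas (𝓡 n) ∞ M)
    (he' : e' ∈ maximalAtlas (𝓡 n) ∞ M) {x : EuclideanSpace ℝ (Fin n)}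
    (hx : x ∈ (e.symm ≫ₕ e').source) : chartJacobian e e' x ≠ 0 := by
  have hx' := (mem_symm_trans_source _ _ _).1 hx
  have h := chartJacobian_mul he he' he hx
    ((mem_symm_trans_source _ _ _).2 ⟨hx'.1, e.map_target hx'.1⟩)
  rw [chartJacobian_self hx'.1] at h
  exact right_ne_zero_of_mul (h ▸ one_ne_zero)

theorem continuousOn_chartJacobian (he : e ∈ maximalAtlas (𝓡 n) ∞ M)
    (he' : e' ∈ maximalAtlas (𝓡 n) ∞ M) :
    ContinuousOn (chartJacobian e e') (e.symm ≫ₕ e').source := fun x hx =>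
  (ContinuousLinearMap.continuous_det.continuousAt.comp
    ((contDiffAt_of_mem_maximalAtlas he he' hx).fderiv_right (m := 0)
      (by simp)).continuousAt).continuousWithinAt

/-- By the chain rule the sign of the Jacobian towards a chart of `A` does not depend on that chart.
It is locally constant, hence constant on a connected target. -/
theorem isPositiveChart_or (hA : A ⊆ maximalAtlas (𝓡 n) ∞ M)
    (hcov : ∀ m : M, ∃ a ∈ A, m ∈ a.source)
    (hpos : ∀ a ∈ A, ∀ b ∈ A, ∀ x ∈ (a.symm ≫ₕ b).source, 0 < chartJacobian a b x)
    (he : e ∈ maximalAtlas (𝓡 n) ∞ M) (hconn : IsPreconnected e.target) :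
    IsPositiveChart A e ∨ ∀ a ∈ A, ∀ x ∈ (e.symm ≫ₕ a).source, chartJacobian e a x < 0 := by
  let S : Set ℝ → Set (EuclideanSpace ℝ (Fin n)) := fun J =>
    ⋃ a ∈ A, (e.symm ≫ₕ a).source ∩ chartJacobian e a ⁻¹' J
  have hS : ∀ J, IsOpen J → IsOpen (S J) := fun J hJ =>
    isOpen_biUnion fun a ha =>
      (continuousOn_chartJacobian he (hA ha)).isOpen_inter_preimage (e.symm ≫ₕ a).open_source hJ
  have hmem : ∀ J x, x ∈ S J ↔ ∃ a ∈ A, x ∈ (e.symm ≫ₕ a).source ∧ chartJacobian e a x ∈ J :=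
    fun J x => by simp only [S, Set.mem_iUnion, Set.mem_inter_iff, Set.mem_preimage, exists_prop]
  have hmul : ∀ a ∈ A, ∀ b ∈ A, ∀ x ∈ (e.symm ≫ₕ a).source, x ∈ (e.symm ≫ₕ b).source →
      0 < chartJacobian e a x → 0 < chartJacobian e b x := by
    intro a ha b hb x hxa hxb h
    rw [chartJacobian_mul he (hA ha) (hA hb) hxa hxb]
    refine mul_pos (hpos a ha b hb _ ?_) h
    have hxa' := (mem_symm_trans_source _ _ _).1 hxa
    rw [mem_symm_trans_source, a.left_inv hxa'.2]
    exact ⟨a.map_source hxa'.2, ((mem_symm_trans_source _ _ _).1 hxb).2⟩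
  have hdisj : Disjoint (S (Set.Ioi 0)) (S (Set.Iio 0)) := by
    rw [Set.disjoint_left]
    intro x h1 h2
    obtain ⟨a, ha, hxa, h1⟩ := (hmem _ _).1 h1
    obtain ⟨b, hb, hxb, h2⟩ := (hmem _ _).1 h2
    exact lt_asymm (hmul a ha b hb x hxa hxb h1) h2
  have hcover : e.target ⊆ S (Set.Ioi 0) ∪ S (Set.Iio 0) := by
    intro x hx
    obtain ⟨a, ha, hxa⟩ := hcov (e.symm x)
    have hxa' := (mem_symm_trans_source e a x).2 ⟨hx, hxa⟩
    rcases lt_or_gt_of_ne (chartJacobian_ne_zero he (hA ha) hxa') with h | h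
    · exact Or.inr ((hmem _ _).2 ⟨a, ha, hxa', h⟩)
    · exact Or.inl ((hmem _ _).2 ⟨a, ha, hxa', h⟩)
  rcases hconn.subset_or_subset (hS _ isOpen_Ioi) (hS _ isOpen_Iio) hdisj hcover with h | h
  · left
    intro a ha x hx
    obtain ⟨b, hb, hxb, hb'⟩ := (hmem _ _).1 (h ((mem_symm_trans_source _ _ _).1 hx).1)
    exact hmul b hb a ha x hxb hx hb'
  · right
    intro a ha x hx
    obtain ⟨b, hb, hxb, hb'⟩ := (hmem _ _).1 (h ((mem_symm_trans_source _ _ _).1 hx).1)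
    by_contra hcon
    have h0 := lt_of_le_of_ne (not_lt.1 hcon) (chartJacobian_ne_zero he (hA ha) hx).symm
    exact lt_asymm (hmul a ha b hb x hx hxb h0) hb'

/-- The sign of a coordinate change is the product of the signs of the two charts relative to `A`.
-/
theorem IsPositiveChart.chartJacobian_pos_iff (hA : A ⊆ maximalAtlas (𝓡 n) ∞ M)
    (hcov : ∀ m : M, ∃ a ∈ A, m ∈ a.source)
    (hpos : ∀ a ∈ A, ∀ b ∈ A, ∀ x ∈ (a.symm ≫ₕ b).source, 0 < chartJacobian a b x)
    (he : e ∈ maximalAtlas (𝓡 n) ∞ M) (hconn : IsPreconnected e.target)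
    (he' : e' ∈ maximalAtlas (𝓡 n) ∞ M) (hconn' : IsPreconnected e'.target)
    {x : EuclideanSpace ℝ (Fin n)} (hx : x ∈ (e.symm ≫ₕ e').source) :
    0 < chartJacobian e e' x ↔ (IsPositiveChart A e ↔ IsPositiveChart A e') := by
  have hx' := (mem_symm_trans_source _ _ _).1 hx
  obtain ⟨a, ha, hxa⟩ := hcov (e.symm x)
  have hxa' := (mem_symm_trans_source e a x).2 ⟨hx'.1, hxa⟩
  have hy : e' (e.symm x) ∈ (e'.symm ≫ₕ a).source := by
    rw [mem_symm_trans_source, e'.left_inv hx'.2]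
    exact ⟨e'.map_source hx'.2, hxa⟩
  have hmul := chartJacobian_mul he he' (hA ha) hx hxa'
  rcases isPositiveChart_or hA hcov hpos he hconn with h | h <;>
    rcases isPositiveChart_or hA hcov hpos he' hconn' with h' | h'
  · have h1 := h a ha x hxa'
    have h2 := h' a ha _ hy
    rw [hmul] at h1
    simp only [h, h', iff_true]
    exact (mul_pos_iff_of_pos_left h2).1 h1
  · have h1 := h a ha x hxa'
    have h2 := h' a ha _ hy
    have h3 : ¬ IsPositiveChart A e' := fun h3 => lt_asymm h2 (h3 a ha _ hy)
    rw [hmul] at h1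
    simp only [h, h3, iff_false, not_true, not_lt]
    exact (neg_of_mul_pos_right h1 h2.le).le
  · have h1 := h a ha x hxa'
    have h2 := h' a ha _ hy
    have h3 : ¬ IsPositiveChart A e := fun h3 => lt_asymm h1 (h3 a ha _ hxa')
    rw [hmul] at h1
    simp only [h', h3, iff_true, iff_false, not_lt]
    exact (neg_of_mul_neg_right h1 h2.le).le
  · have h1 := h a ha x hxa'
    have h2 := h' a ha _ hy
    have h3 : ¬ IsPositiveChart A e' := fun h3 => lt_asymm h2 (h3 a ha _ hy)
    have h4 : ¬ IsPositiveChart A e := fun h3 => lt_asymm h1 (h3 a ha _ hxa')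
    rw [hmul] at h1
    simp only [h3, h4, iff_true]
    exact pos_of_mul_neg_right h1 h2.le

end Orientation

/-! ### An orientation-reversing loop -/

section NonOrientable

open Quaternion Matrix IsManifold

/-- A one-parameter group of unit quaternions. -/
noncomputable def rollQuat (s : ℝ) : S3 := ⟨quat (Real.cos s) (Real.sin s) 0 0, by
  rw [mem_S3_iff]
  simp⟩

/-- Conjugation by the rotations about the first axis. -/
noncomputable def roll (s : ℝ) : S3 × SO3 := (rollQuat s, rot (rollQuat s))

theorem rollQuat_add (s t : ℝ) : rollQuat (s + t) = rollQuat s * rollQuat t := by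
  refine Subtype.ext ?_
  change quat _ _ _ _ = quat _ _ _ _ * quat _ _ _ _
  rw [Real.cos_add, Real.sin_add]
  refine Quaternion.ext _ _ ?_ ?_ ?_ ?_ <;> simp
  ring

theorem roll_add (s t : ℝ) : roll (s + t) = roll s * roll t := by
  simp [roll, rollQuat_add]

theorem roll_zero : roll 0 = 1 := by
  have h := roll_add 0 0
  rw [add_zero] at h
  exact mul_eq_left.1 h.symm

theorem smoothEntriesAt_roll (p : ℝ × EuclideanSpace ℝ (Fin 5)) :
    SmoothEntriesAt (fun p : ℝ × EuclideanSpace ℝ (Fin 5) => frameAct (roll p.1) (chartFrame p.2))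
      p := by
  have hc : ContDiffAt ℝ ∞ (fun p : ℝ × EuclideanSpace ℝ (Fin 5) => Real.cos p.1) p := by fun_prop
  have hs : ContDiffAt ℝ ∞ (fun p : ℝ × EuclideanSpace ℝ (Fin 5) => Real.sin p.1) p := by fun_prop
  have h1 : SmoothEntriesAt (fun p : ℝ × EuclideanSpace ℝ (Fin 5) =>
      quatMat (quat (Real.cos p.1) (Real.sin p.1) 0 0)) p :=
    smoothEntriesAt_quatMat hc hs contDiffAt_const contDiffAt_const
  have h2 : SmoothEntriesAt (fun p : ℝ × EuclideanSpace ℝ (Fin 5) => chartFrame p.2) p :=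
    fun i j => (smoothEntriesAt_chartFrame p.2 i j).comp p contDiffAt_snd
  have h3 : SmoothEntriesAt (fun p : ℝ × EuclideanSpace ℝ (Fin 5) => cmat (rot (rollQuat p.1))) p :=
    fun i j => by
      refine contDiffAt_ofReal (f := fun p : ℝ × EuclideanSpace ℝ (Fin 5) =>
        rotMat (quat (Real.cos p.1) (Real.sin p.1) 0 0) i j) ?_
      fin_cases i <;> fin_cases j <;> simp [rotMat] <;> fun_prop
  exact (h1.mul h2).mul h3.transpose

/-- The coordinate changes between nearby charts of the one-parameter group preserve the
orientation. -/
theorem eventually_chartJacobian_roll_pos : ∀ᶠ θ : ℝ in 𝓝 0,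
    frameAct (roll θ) (chartFrame 0) ∈ chartDomain ∧
      0 < (fderiv ℝ (fun y => chartCoord (frameAct (roll θ) (chartFrame y))) 0).det := by
  let F : ℝ × EuclideanSpace ℝ (Fin 5) → EuclideanSpace ℝ (Fin 5) :=
    fun p => chartCoord (frameAct (roll p.1) (chartFrame p.2))
  have hF0 : ∀ y, frameAct (roll 0) (chartFrame y) = chartFrame y := fun y => by
    rw [roll_zero, frameAct_one]
  have hF : ContDiffAt ℝ ∞ F (0, 0) := (smoothEntriesAt_roll (0, 0)).chartCoord (by
    change frameAct (roll 0) (chartFrame 0) ∈ chartDomain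
    rw [hF0]
    exact chartFrame_mem 0)
  have hline : Continuous fun θ : ℝ => (θ, (0 : EuclideanSpace ℝ (Fin 5))) := by fun_prop
  have h1 : ∀ᶠ θ : ℝ in 𝓝 0, frameAct (roll θ) (chartFrame 0) ∈ chartDomain := by
    have h := (smoothEntriesAt_roll (0, 0)).eventually_mem_chartDomain (by
      change frameAct (roll 0) (chartFrame 0) ∈ chartDomain
      rw [hF0]
      exact chartFrame_mem 0)
    exact hline.continuousAt.eventually h
  -- The Jacobian in the second variable is continuous in `θ` and equals 1 at `θ = 0`, where the
  -- coordinate change is the identity.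
  let J : ℝ → ℝ := fun θ =>
    ((fderiv ℝ F (θ, 0)).comp (ContinuousLinearMap.inr ℝ ℝ (EuclideanSpace ℝ (Fin 5)))).det
  have hder : ∀ θ, frameAct (roll θ) (chartFrame 0) ∈ chartDomain →
      HasFDerivAt (fun y => chartCoord (frameAct (roll θ) (chartFrame y)))
        ((fderiv ℝ F (θ, 0)).comp (ContinuousLinearMap.inr ℝ ℝ (EuclideanSpace ℝ (Fin 5)))) 0 := by
    intro θ hθ
    have hd : HasFDerivAt F (fderiv ℝ F (θ, 0)) (θ, 0) :=
      (((smoothEntriesAt_roll (θ, 0)).chartCoord hθ).differentiableAt (by simp)).hasFDerivAt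
    exact hd.comp (0 : EuclideanSpace ℝ (Fin 5)) (hasFDerivAt_prodMk_right θ 0)
  have hJ0 : J 0 = 1 := by
    have h := hder 0 (by rw [hF0]; exact chartFrame_mem 0)
    have e : (fun y => chartCoord (frameAct (roll 0) (chartFrame y))) = id :=
      funext fun y => by rw [hF0, chartCoord_chartFrame]; rfl
    rw [e] at h
    simp only [J]
    rw [h.unique (hasFDerivAt_id _)]
    exact LinearMap.det_id
  have hJc : ContinuousAt J 0 := by
    have h2 : ContinuousAt (fun θ : ℝ => fderiv ℝ F (θ, 0)) 0 :=
      ContinuousAt.comp (f := fun θ : ℝ => (θ, (0 : EuclideanSpace ℝ (Fin 5))))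
        (hF.fderiv_right (m := 0) (by simp)).continuousAt hline.continuousAt
    exact ContinuousLinearMap.continuous_det.continuousAt.comp
      (h2.clm_comp continuousAt_const)
  have hJ : ∀ᶠ θ in 𝓝 0, 0 < J θ := hJc.eventually (lt_mem_nhds (hJ0 ▸ one_pos))
  filter_upwards [h1, hJ] with θ hθ hθ'
  refine ⟨hθ, ?_⟩
  rw [(hder θ hθ).fderiv]
  exact hθ'

/-- `roll (π / 2)` combines the half-turns about the first axis in source and target. It takes the
normal `(x, y, 1)` to the line of `(-x, y, 1)`, and conjugation by `i` changes the signs of two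
quaternion coordinates; in particular it fixes the base point. -/
theorem frameAct_roll_half_pi (y : EuclideanSpace ℝ (Fin 5)) :
    frameAct (roll (Real.pi / 2)) (chartFrame y) = -Complex.I •
      (quatMat (quat (-1) (-y 2) (y 3) (y 4)) * planeFrame (-y 0) (y 1)) := by
  have hq : (rollQuat (Real.pi / 2)).1 = quat 0 1 0 0 := by simp [rollQuat]
  rw [frameAct, roll, cmat, coe_rot, hq, chartFrame]
  ext i j
  fin_cases i <;> fin_cases j <;> apply Complex.ext <;>
    simp [quatMat, planeFrame, rotMat, Matrix.mul_apply, Fin.sum_univ_three] <;> ring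

/-- The coordinate change at the end of the loop. -/
theorem chartCoord_roll_half_pi (y : EuclideanSpace ℝ (Fin 5)) :
    chartCoord (frameAct (roll (Real.pi / 2)) (chartFrame y)) =
      !₂[-y 0, y 1, y 2, -y 3, -y 4] := by
  rw [frameAct_roll_half_pi, chartCoord_smul (by simp),
    chartCoord_quatMat_mul_planeFrame (by simp)]
  simp [div_neg]

theorem frameAct_roll_half_pi_mem (y : EuclideanSpace ℝ (Fin 5)) :
    frameAct (roll (Real.pi / 2)) (chartFrame y) ∈ chartDomain := by
  rw [frameAct_roll_half_pi, smul_mem_chartDomain (by simp),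
    quatMat_mul_planeFrame_mem_chartDomain]
  · simp
  · intro h
    simpa using congrArg QuaternionAlgebra.re h

theorem fderiv_roll_half_pi_det (y : EuclideanSpace ℝ (Fin 5)) :
    (fderiv ℝ (fun y => chartCoord (frameAct (roll (Real.pi / 2)) (chartFrame y))) y).det = -1 := by
  let σ := (Matrix.toLpLin 2 2 (Matrix.diagonal ![-1, 1, 1, -1, (-1 : ℝ)])).toContinuousLinearMap
  have e : (fun y => chartCoord (frameAct (roll (Real.pi / 2)) (chartFrame y))) = σ := by
    funext y
    rw [chartCoord_roll_half_pi]
    ext i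
    fin_cases i <;> simp [σ, Matrix.toLpLin_apply, Matrix.mulVec_diagonal]
  rw [e, σ.fderiv]
  change LinearMap.det (Matrix.toLpLin 2 2 (Matrix.diagonal ![-1, 1, 1, -1, (-1 : ℝ)])) = -1
  rw [LinearMap.det_toLpLin, Matrix.det_diagonal]
  simp [Fin.prod_univ_five]

theorem chartJacobian_frameChart (k l : S3 × SO3) (y : EuclideanSpace ℝ (Fin 5)) :
    chartJacobian (frameChart k) (frameChart l) y =
      (fderiv ℝ (fun y => chartCoord (frameAct (l⁻¹ * k) (chartFrame y))) y).det := by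
  rw [chartJacobian, coe_transition]

/-- Subdivide the path `roll` from 0 to `π / 2` into small steps. Consecutive translated charts have
positive Jacobian at the base point, so all have the same sign relative to an oriented atlas. But
the first and the last are related by a coordinate change of determinant -1. -/
theorem not_isOrientable_frameSet : ¬ IsOrientable 5 frameSet := by
  rintro ⟨A, hA, hcov, hpos⟩
  have hmax : ∀ k, frameChart k ∈ maximalAtlas (𝓡 5) ∞ frameSet := fun k =>
    subset_maximalAtlas ⟨k, rfl⟩
  have hconn : ∀ k, IsPreconnected (frameChart k).target := fun k => by
    rw [frameChart_target]
    exact isPreconnected_univ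
  have hsrc : ∀ k l, frameAct (l⁻¹ * k) (chartFrame 0) ∈ chartDomain →
      (0 : EuclideanSpace ℝ (Fin 5)) ∈ ((frameChart k).symm ≫ₕ frameChart l).source :=
    fun k l h => by
      rw [mem_symm_trans_source, frameChart_target, symm_mem_frameChart_source]
      exact ⟨Set.mem_univ _, h⟩
  have key : ∀ k l, frameAct (l⁻¹ * k) (chartFrame 0) ∈ chartDomain →
      (0 < (fderiv ℝ (fun y => chartCoord (frameAct (l⁻¹ * k) (chartFrame y))) 0).det ↔
        (IsPositiveChart A (frameChart k) ↔ IsPositiveChart A (frameChart l))) := fun k l h => by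
    rw [← chartJacobian_frameChart]
    exact IsPositiveChart.chartJacobian_pos_iff hA hcov hpos (hmax k) (hconn k) (hmax l) (hconn l)
      (hsrc k l h)
  obtain ⟨ε, hε, hball⟩ := Metric.eventually_nhds_iff.1 eventually_chartJacobian_roll_pos
  obtain ⟨N, hN⟩ := exists_nat_gt (Real.pi / 2 / ε)
  have hN0 : (0 : ℝ) < N := lt_of_le_of_lt (by positivity) hN
  have hstep : ∀ j : ℕ, IsPositiveChart A (frameChart (roll (j * (Real.pi / 2 / N)))) ↔
      IsPositiveChart A (frameChart 1) := by
    intro j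
    induction j with
    | zero => simp [roll_zero]
    | succ j ih =>
      rw [← ih]
      have h := hball (y := Real.pi / 2 / N) (by
        rw [Real.dist_eq, sub_zero, abs_of_pos (by positivity)]
        rw [div_lt_iff₀ hε] at hN
        rw [div_lt_iff₀ hN0]
        linarith)
      have e : (roll (j * (Real.pi / 2 / N)))⁻¹ * roll ((j + 1 : ℕ) * (Real.pi / 2 / N)) =
          roll (Real.pi / 2 / N) := by
        rw [Nat.cast_succ, add_mul, one_mul, roll_add, inv_mul_cancel_left]
      refine (key _ _ ?_).1 ?_
      · rw [e]
        exact h.1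
      · rw [e]
        exact h.2
  have hend := hstep N
  rw [mul_div_cancel₀ _ hN0.ne'] at hend
  have e : (1 : S3 × SO3)⁻¹ * roll (Real.pi / 2) = roll (Real.pi / 2) := by simp
  have hmem : frameAct ((1 : S3 × SO3)⁻¹ * roll (Real.pi / 2)) (chartFrame 0) ∈ chartDomain := by
    rw [e]
    exact frameAct_roll_half_pi_mem 0
  have h := (key _ _ hmem).2 hend
  rw [e, fderiv_roll_half_pi_det] at h
  linarith

end NonOrientable
theorem theorem2p1 :
    ∃ (M : Set Rat2) (_ : ChartedSpace (EuclideanSpace ℝ (Fin 5)) M) (_ : IsManifold (𝓡 5) ∞ M)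
      (_ : MulAction SO3 M) (proj : M → RP2),
      -- `M` is a compact non-orientable smooth 5-manifold, smoothly embedded in `Rat₂`
      IsCompact M ∧ T2Space M ∧ SecondCountableTopology M ∧
      IsSmoothImmersionToProj 5 (fun m : M => (m : Rat2).1) ∧
      ¬ IsOrientable 5 M ∧
      -- `M` is a deformation retract of `Rat₂`
      IsDeformationRetract M ∧
      -- `M` is a non-trivial principal `SO(3)`-bundle over the projective plane
      IsPrincipalBundle SO3 proj ∧
      ¬ IsTrivialPrincipalBundle SO3 proj ∧
      -- every non-trivial principal `SO(3)`-bundle over the projective plane is isomorphic to it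
      ∀ (P : Type u) [TopologicalSpace P] [MulAction SO3 P] (proj' : P → RP2),
        IsPrincipalBundle SO3 proj' → ¬ IsTrivialPrincipalBundle SO3 proj' →
          PrincipalBundleIso SO3 proj proj' := by
  have hP := isPrincipalBundle_frameProj
  refine ⟨frameSet, frameChartedSpace, frameIsManifold, frameAction, frameProj,
    isCompact_iff_compactSpace.2 inferInstance, inferInstance, inferInstance,
    isSmoothImmersionToProj_frameSet, not_isOrientable_frameSet, isDeformationRetract_frameSet,
    hP, hasClutching_frameProj.not_trivial, fun P _ _ proj' hP' hnt => ?_⟩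
  -- Sign 1 would make the bundle trivial, and sign -1 is shared with the frame bundle.
  rcases exists_hasClutching hP' with h | h
  · exact absurd (h.trivial hP') hnt
  · exact hasClutching_frameProj.iso hP hP' h
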